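/- **Syntax.** Formulae are built from variables $p_0,p_1,p_2,\dots$ and the constant $\mathbf 1$ by the binary connectives $\backslash$, $/$, $\cdot$ and the unary connectives $\langle\rangle$, $[]^{-1}$, $!$. Meta-formulae are finite (possibly empty) sequences, written with commas, whose members are formulae or bracketed meta-formulae $[\Gamma]$; $\Lambda$ is the empty one. $\Delta(\Gamma)$ denotes a meta-formula $\Delta$ with a designated occurrence, at any depth of brackets, of a contiguous part $\Gamma$. A sequent is $\Gamma\to B$ with $\Gamma$ a meta-formula and $B$ a formula. **The calculus $!_{\mathbf b}\mathbf L^{\mathbf 1}$.** The axioms are $A\to A$ and $\Lambda\to\mathbf 1$. The rules are the following (premises $\Rightarrow$ conclusion; $n\ge 0$ in $(\to !)$ and $(\mathrm{contr}_{\mathbf b})$): - $\Gamma\to B,\ \Delta(C)\to D\ \Rightarrow\ \Delta(C/B,\Gamma)\to D$, and $\Gamma,B\to C\ \Rightarrow\ \Gamma\to C/B$; - $\Gamma\to A,\ \Delta(C)\to D\ \Rightarrow\ \Delta(\Gamma,A\backslash C)\to D$, and $A,\Gamma\to C\ \Rightarrow\ \Gamma\to A\backslash C$; - $\Delta(A,B)\to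 D\ \Rightarrow\ \Delta(A\cdot B)\to D$, and $\Gamma_1\to A,\ \Gamma_2\to B\ \Rightarrow\ \Gamma_1,\Gamma_2\to A\cdot B$; - $\Delta(\Lambda)\to A\ \Rightarrow\ \Delta(\mathbf 1)\to A$; - $\Delta([A])\to C\ \Rightarrow\ \Delta(\langle\rangle A)\to C$, and $\Pi\to A\ \Rightarrow\ [\Pi]\to\langle\rangle A$; - $\Delta(A)\to C\ \Rightarrow\ \Delta([[]^{-1}A])\to C$, and $[\Pi]\to A\ \Rightarrow\ \Pi\to[]^{-1}A$; - $\Gamma(A)\to B\ \Rightarrow\ \Gamma(!A)\to B$, and $(\to !)$: $!A_1,\dots,!A_n\to A\ \Rightarrow\ !A_1,\dots,!A_n\to\, !A$; - $(\mathrm{contr}_{\mathbf b})$: $\Delta(!A_1,\dots,!A_n,[!A_1,\dots,!A_n,\Gamma])\to B\ \Rightarrow\ \Delta(!A_1,\dots,!A_n,\Gamma)\to B$; - $\Delta(!A,\Gamma)\to B\ \Rightarrow\ \Delta(\Gamma,!A)\to B$, and conversely $\Delta(\Gamma,!A)\to B\ \Rightarrow\ \Delta(!A,\Gamma)\to B$;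 - cut: $\Pi\to A,\ \Delta(A)\to C\ \Rightarrow\ \Delta(\Pi)\to C$. **Polarity.** Every formula occurs positively in itself. Polarity is inverted when descending into the denominator $A$ of $A\backslash C$ or $B$ of $C/B$, and for formulae on the left-hand side of a sequent; it is not changed by anything else. A sequent obeys the *bracket non-negative condition* if no formula $!A$ that has a negative occurrence in the sequent contains a positive occurrence of a subformula of the form $[]^{-1}C$ or a negative occurrence of a subformula of the form $\langle\rangle C$, where the last two polarities are taken with respect to $!A$. **Theorem.** The derivability problem in $!_{\mathbf b}\mathbf L^{\mathbf 1}$ for sequents that obey the bracket non-negative condition belongs to the class NP. That is, let sequents be written as words over a finite alphabet, with the indices of variables in binary. Then the set of all words that represent a sequent which obeys the bracket non-negative condition and is derivable in $!_{\mathbf b}\mathbf L^{\mathbf 1}$ is in NP: it has a deterministic polynomial-time verifier with certificates of polynomial length. -/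

import Mathlib

namespace BracketLambek

/-! ### Syntax -/

/-- Formulae (types): variables, the unit, the two divisions, the product, and the unary
connectives `⟨⟩`, `[]⁻¹` and `!`. -/
inductive Formula : Type
  | var (i : ℕ)
  | one
  /-- `ldiv A C` is `A \ C`; its denominator is `A`. -/
  | ldiv (A C : Formula)
  /-- `rdiv C B` is `C / B`; its denominator is `B`. -/
  | rdiv (C B : Formula)
  | prod (A B : Formula)
  /-- `dia A` is `⟨⟩A`. -/
  | dia (A : Formula)
  /-- `boxInv A` is `[]⁻¹A`. -/
  | boxInv (A : Formula)
  | bang (A : Formula)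
  deriving DecidableEq

/-- The items separated by commas in a meta-formula: a formula, or a bracketed meta-formula. -/
inductive Item : Type
  | form (A : Formula)
  | brack (Γ : List Item)

/-- Meta-formulae: built from formulae by comma (associative, with the empty meta-formula as its
unit) and brackets. Comma is `++`, the empty meta-formula is `[]`. -/
abbrev MetaFormula : Type := List Item

/-- Sequents `Γ → B`. -/
structure Sequent : Type where
  ante : MetaFormula
  succ : Formula

/-- A meta-formula with a hole, at an arbitrary depth of brackets. -/
inductive Context : Type
  | hole (L R : MetaFormula)
  | brack (L : MetaFormula) (Δ : Context) (R : MetaFormula)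

/-- `Δ.fill Γ` is `Δ(Γ)`. -/
def Context.fill : Context → MetaFormula → MetaFormula
  | .hole L R, Γ => L ++ Γ ++ R
  | .brack L Δ R, Γ => L ++ [Item.brack (Δ.fill Γ)] ++ R

/-- The meta-formula `!A₁, …, !Aₙ` (empty if `n = 0`). -/
def bangs (As : List Formula) : MetaFormula :=
  As.map fun A => Item.form (.bang A)

/-! ### The calculus -/

open Item Formula in
/-- `Derivable Γ B`: the sequent `Γ → B` is derivable (cut is one of the rules). -/
inductive Derivable : MetaFormula → Formula → Prop
  | ax (A : Formula) : Derivable [form A] A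
  | one_right : Derivable [] one
  | rdiv_left (Δ : Context) (Γ : MetaFormula) (B C D : Formula) :
      Derivable Γ B → Derivable (Δ.fill [form C]) D →
      Derivable (Δ.fill ([form (rdiv C B)] ++ Γ)) D
  | rdiv_right (Γ : MetaFormula) (B C : Formula) :
      Derivable (Γ ++ [form B]) C → Derivable Γ (rdiv C B)
  | ldiv_left (Δ : Context) (Γ : MetaFormula) (A C D : Formula) :
      Derivable Γ A → Derivable (Δ.fill [form C]) D →
      Derivable (Δ.fill (Γ ++ [form (ldiv A C)])) D
  | ldiv_right (Γ : MetaFormula) (A C : Formula) :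
      Derivable ([form A] ++ Γ) C → Derivable Γ (ldiv A C)
  | prod_left (Δ : Context) (A B D : Formula) :
      Derivable (Δ.fill [form A, form B]) D → Derivable (Δ.fill [form (prod A B)]) D
  | prod_right (Γ₁ Γ₂ : MetaFormula) (A B : Formula) :
      Derivable Γ₁ A → Derivable Γ₂ B → Derivable (Γ₁ ++ Γ₂) (prod A B)
  | one_left (Δ : Context) (A : Formula) :
      Derivable (Δ.fill []) A → Derivable (Δ.fill [form one]) A
  | dia_left (Δ : Context) (A C : Formula) :
      Derivable (Δ.fill [brack [form A]]) C → Derivable (Δ.fill [form (dia A)]) C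
  | dia_right (Γ : MetaFormula) (A : Formula) :
      Derivable Γ A → Derivable [brack Γ] (dia A)
  | boxInv_left (Δ : Context) (A C : Formula) :
      Derivable (Δ.fill [form A]) C → Derivable (Δ.fill [brack [form (boxInv A)]]) C
  | boxInv_right (Γ : MetaFormula) (A : Formula) :
      Derivable [brack Γ] A → Derivable Γ (boxInv A)
  | bang_left (Δ : Context) (A B : Formula) :
      Derivable (Δ.fill [form A]) B → Derivable (Δ.fill [form (bang A)]) B
  | bang_right (As : List Formula) (A : Formula) :
      Derivable (bangs As) A → Derivable (bangs As) (bang A)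
  | contr (Δ : Context) (As : List Formula) (Γ : MetaFormula) (B : Formula) :
      Derivable (Δ.fill (bangs As ++ [brack (bangs As ++ Γ)])) B →
      Derivable (Δ.fill (bangs As ++ Γ)) B
  | perm₁ (Δ : Context) (Γ : MetaFormula) (A B : Formula) :
      Derivable (Δ.fill ([form (bang A)] ++ Γ)) B → Derivable (Δ.fill (Γ ++ [form (bang A)])) B
  | perm₂ (Δ : Context) (Γ : MetaFormula) (A B : Formula) :
      Derivable (Δ.fill (Γ ++ [form (bang A)])) B → Derivable (Δ.fill ([form (bang A)] ++ Γ)) B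
  | cut (Δ : Context) (Γ : MetaFormula) (A C : Formula) :
      Derivable Γ A → Derivable (Δ.fill [form A]) C → Derivable (Δ.fill Γ) C

/-- Derivability of a sequent. -/
def Sequent.IsDerivable (S : Sequent) : Prop := Derivable S.ante S.succ

/-! ### Polarity and the bracket non-negative condition -/

/-- `OccursIn p F G`: the formula `F` has an occurrence in the formula `G` that is positive
(if `p = true`), resp. negative (if `p = false`). -/
inductive OccursIn : Bool → Formula → Formula → Prop
  | refl (F : Formula) : OccursIn true F F
  | ldiv_den {p : Bool} {F A : Formula} (C : Formula) : OccursIn (!p) F A → OccursIn p F (.ldiv A C)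
  | ldiv_num {p : Bool} {F C : Formula} (A : Formula) : OccursIn p F C → OccursIn p F (.ldiv A C)
  | rdiv_num {p : Bool} {F C : Formula} (B : Formula) : OccursIn p F C → OccursIn p F (.rdiv C B)
  | rdiv_den {p : Bool} {F B : Formula} (C : Formula) : OccursIn (!p) F B → OccursIn p F (.rdiv C B)
  | prod_fst {p : Bool} {F A : Formula} (B : Formula) : OccursIn p F A → OccursIn p F (.prod A B)
  | prod_snd {p : Bool} {F B : Formula} (A : Formula) : OccursIn p F B → OccursIn p F (.prod A B)
  | dia {p : Bool} {F A : Formula} : OccursIn p F A → OccursIn p F (.dia A)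
  | boxInv {p : Bool} {F A : Formula} : OccursIn p F A → OccursIn p F (.boxInv A)
  | bang {p : Bool} {F A : Formula} : OccursIn p F A → OccursIn p F (.bang A)

/-- `InMeta A Γ`: the formula `A` is one of the formulae from which the meta-formula `Γ` is built
(at any depth of brackets). -/
inductive InMeta : Formula → MetaFormula → Prop
  | form {A : Formula} {Γ : MetaFormula} : Item.form A ∈ Γ → InMeta A Γ
  | brack {A : Formula} {Γ Γ' : MetaFormula} : Item.brack Γ' ∈ Γ → InMeta A Γ' → InMeta A Γ

/-- Positive (`p = true`) and negative (`p = false`) occurrences of formulae in a sequent: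
polarities are inverted in the antecedent. -/
inductive Sequent.Occurs : Bool → Formula → Sequent → Prop
  | succ {p : Bool} {F : Formula} {S : Sequent} :
      OccursIn p F S.succ → Sequent.Occurs p F S
  | ante {p : Bool} {F G : Formula} {S : Sequent} :
      InMeta G S.ante → OccursIn (!p) F G → Sequent.Occurs p F S

/-- The bracket non-negative condition: no formula `!A` with a negative occurrence in the sequent
contains a positive occurrence of some `[]⁻¹C` or a negative occurrence of some `⟨⟩C`, where the
latter two polarities are those within the formula `!A`. -/
def Sequent.BracketNonNegative (S : Sequent) : Prop :=
  ∀ A : Formula, S.Occurs false (.bang A) →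
    ∀ C : Formula, ¬ OccursIn true (.boxInv C) (.bang A) ∧ ¬ OccursIn false (.dia C) (.bang A)

/-! ### Sequents as words over a finite alphabet -/

/-- The alphabet in which sequents are written. -/
inductive Sym : Type
  | var | bit (b : Bool) | endVar
  | one | ldiv | rdiv | prod | dia | boxInv | bang
  | lbrack | rbrack | arrow
  deriving DecidableEq, Fintype

/-- Formulae in Polish notation; the index of a variable is written in binary. -/
def Formula.encode : Formula → List Sym
  | .var i => Sym.var :: ((Computability.encodeNat i).map Sym.bit ++ [Sym.endVar])
  | .one => [Sym.one]
  | .ldiv A C => Sym.ldiv :: (A.encode ++ C.encode)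
  | .rdiv C B => Sym.rdiv :: (C.encode ++ B.encode)
  | .prod A B => Sym.prod :: (A.encode ++ B.encode)
  | .dia A => Sym.dia :: A.encode
  | .boxInv A => Sym.boxInv :: A.encode
  | .bang A => Sym.bang :: A.encode

mutual

/-- The word of a formula, or the bracketed word of a meta-formula. -/
def Item.encode : Item → List Sym
  | .form A => A.encode
  | .brack Γ => Sym.lbrack :: (MetaFormula.encode Γ ++ [Sym.rbrack])

/-- The concatenation of the words of the items. -/
def MetaFormula.encode : List Item → List Sym
  | [] => []
  | I :: Γ => I.encode ++ MetaFormula.encode Γ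

end

/-- The word of `Γ → B`. -/
def Sequent.encode (S : Sequent) : List Sym :=
  MetaFormula.encode S.ante ++ Sym.arrow :: S.succ.encode

theorem bits_endVar_inj : ∀ (l m : List Bool) (u v : List Sym),
    l.map Sym.bit ++ Sym.endVar :: u = m.map Sym.bit ++ Sym.endVar :: v → l = m ∧ u = v
  | [], [], u, v, h => by simpa using h
  | [], b :: m, u, v, h => by simp at h
  | a :: l, [], u, v, h => by simp at h
  | a :: l, b :: m, u, v, h => by
    simp only [List.map_cons, List.cons_append, List.cons.injEq, Sym.bit.injEq] at h
    have := bits_endVar_inj l m u v h.2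
    exact ⟨by rw [h.1, this.1], this.2⟩

theorem Formula.encode_append_inj (A : Formula) : ∀ (B : Formula) (u v : List Sym),
    A.encode ++ u = B.encode ++ v → A = B ∧ u = v := by
  induction A with
  | var i =>
    intro B u v h
    cases B <;> simp [Formula.encode] at h
    obtain ⟨h1, h2⟩ := bits_endVar_inj _ _ _ _ h
    have h3 := congrArg Computability.decodeNat h1
    simp only [Computability.decode_encodeNat] at h3
    exact ⟨by rw [h3], h2⟩
  | one => intro B u v h; cases B <;> simp_all [Formula.encode]
  | ldiv A C ihA ihC | rdiv A C ihA ihC | prod A C ihA ihC =>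
    intro B u v h
    cases B <;> simp [Formula.encode] at h
    obtain ⟨rfl, h1⟩ := ihA _ _ _ h
    obtain ⟨rfl, h2⟩ := ihC _ _ _ h1
    exact ⟨rfl, h2⟩
  | dia A ih | boxInv A ih | bang A ih =>
    intro B u v h
    cases B <;> simp [Formula.encode] at h
    obtain ⟨rfl, h1⟩ := ih _ _ _ h
    exact ⟨rfl, h1⟩

/-- The symbols that can follow a meta-formula. -/
def Sym.IsEnd (s : Sym) : Prop := s = .rbrack ∨ s = .arrow

theorem Formula.encode_head (A : Formula) : ∃ (s : Sym) (w : List Sym),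
    A.encode = s :: w ∧ ¬ s.IsEnd ∧ s ≠ .lbrack := by
  cases A <;> simp [Formula.encode, Sym.IsEnd]

theorem Item.encode_head (I : Item) : ∃ (s : Sym) (w : List Sym),
    I.encode = s :: w ∧ ¬ s.IsEnd := by
  cases I with
  | form A =>
    obtain ⟨s, w, h, h', -⟩ := A.encode_head
    exact ⟨s, w, by simpa [Item.encode] using h, h'⟩
  | brack Γ => simp [Item.encode, Sym.IsEnd]

mutual

theorem Item.encode_append_inj : ∀ (I J : Item) (u v : List Sym),
    I.encode ++ u = J.encode ++ v → I = J ∧ u = v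
  | .form A, .form B, u, v, h => by
    obtain ⟨rfl, h1⟩ := A.encode_append_inj B u v (by simpa [Item.encode] using h)
    exact ⟨rfl, h1⟩
  | .form A, .brack Γ, u, v, h => by
    obtain ⟨s, w, hs, -, h'⟩ := A.encode_head
    simp [Item.encode, hs, h'] at h
  | .brack Γ, .form A, u, v, h => by
    obtain ⟨s, w, hs, -, h'⟩ := A.encode_head
    simp [Item.encode, hs, h'.symm] at h
  | .brack Γ, .brack Γ', u, v, h => by
    simp only [Item.encode, List.cons_append, List.append_assoc, List.nil_append,
      List.cons.injEq, true_and] at h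
    obtain ⟨rfl, h⟩ := MetaFormula.encode_append_inj Γ Γ' .rbrack .rbrack u v
      (.inl rfl) (.inl rfl) h
    exact ⟨rfl, by simpa using h⟩

theorem MetaFormula.encode_append_inj : ∀ (Γ Γ' : List Item) (s t : Sym) (u v : List Sym),
    s.IsEnd → t.IsEnd →
    MetaFormula.encode Γ ++ s :: u = MetaFormula.encode Γ' ++ t :: v →
    Γ = Γ' ∧ s :: u = t :: v
  | [], [], s, t, u, v, _, _, h => by simpa [MetaFormula.encode] using h
  | [], J :: Γ', s, t, u, v, hs, _, h => by
    obtain ⟨s', w, hw, h'⟩ := J.encode_head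
    simp [MetaFormula.encode, hw] at h
    exact absurd (h.1 ▸ hs) h'
  | I :: Γ, [], s, t, u, v, _, ht, h => by
    obtain ⟨s', w, hw, h'⟩ := I.encode_head
    simp [MetaFormula.encode, hw] at h
    exact absurd (h.1 ▸ ht) h'
  | I :: Γ, J :: Γ', s, t, u, v, hs, ht, h => by
    simp only [MetaFormula.encode, List.append_assoc] at h
    obtain ⟨rfl, h1⟩ := Item.encode_append_inj I J _ _ h
    obtain ⟨rfl, h2⟩ := MetaFormula.encode_append_inj Γ Γ' s t u v hs ht h1
    exact ⟨rfl, h2⟩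

end

/-- A sequent can be recovered from its word. -/
theorem Sequent.encode_injective : Function.Injective Sequent.encode := by
  rintro ⟨Γ, A⟩ ⟨Γ', A'⟩ h
  obtain ⟨rfl, h⟩ := MetaFormula.encode_append_inj Γ Γ' .arrow .arrow _ _ (.inr rfl) (.inr rfl) h
  obtain ⟨rfl, -⟩ := A.encode_append_inj A' [] [] (by simpa using h)
  rfl

/-- The decision problem `P` for sequents as a formal language: the words of the sequents that
have the property `P`. -/
def languageOf (P : Sequent → Prop) : Language Sym :=
  {w | ∃ S : Sequent, S.encode = w ∧ P S}

/-! ### The class NP -/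

/-- The class NP: the language `L` has a deterministic polynomial-time verifier `V` that takes a
word `x` and a binary certificate `c`, where it is enough to consider certificates of polynomial
length in the length of `x`. -/
def InNP {Γ : Type} [Fintype Γ] (L : Language Γ) : Prop :=
  ∃ (p : Polynomial ℕ) (V : List Γ × List Bool → Bool),
    Nonempty (Turing.TM2ComputableInPolyTime
      (Computability.encodingProd (Computability.encodingList Γ)
        (Computability.encodingList Bool)).encode
      Computability.encodeBool V) ∧
    ∀ x : List Γ, x ∈ L ↔ ∃ c : List Bool, c.length ≤ p.eval x.length ∧ V (x, c) = true

end BracketLambek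

/-!
Read bottom-up, contraction is the only rule that increases the total length of the formulae, and
each of its applications adds a pair of brackets. A pair of brackets disappears bottom-up only through the
decomposition of a negative `[]⁻¹C` or a positive `⟨⟩C`, here called a bracket consumer
(`Formula.eat`), and under the bracket non-negative condition the contracted formulae `!A` contain
no bracket consumers. Hence the number of bracket consumers never grows, and in a cut-free
derivation the number of contractions is at most the number of bracket consumers of the conclusion.
It remains to bound the size of what is contracted: a contraction copies only formulae without
bracket consumers ("light" formulae) that stand next to each other at one level of brackets. The
total length of the light formulae of one level, plus that of all "heavy" formulae, with bracket
consumers, never grows bottom-up: a contraction copies light formulae to another level, and a heavy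
formula may fall into light parts, but is not copied. So each contraction adds at most the length
of the conclusion, and cut-free derivations have quadratically many rule applications, with sequents
of quadratic size, if permutations of formulae `!A` are not counted (`CutFree.bounded`,
`Derivable.boundedProof`). Sequents connected by permutations have the same normal form and are
connected by quadratically many permutations (`moves_of_nf_eq`).

Cut elimination (`Derivable.cutFree`) is proved semantically: in the phase space whose elements are
the sets of meta-formulae closed under the cut-free consequence relation, all rules, including cut,
are sound, and the denotation of a formula `A` contains `A` and consists of meta-formulae from which
`A` is derivable without cut.

For the class NP, derivations are not encoded as words. Instead, `InNP.of_program` shows that it is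
enough to give a nondeterministic recursive program on four stacks that empties its stacks exactly
if the input belongs to the language, within a polynomial number of commands; the certificate lists
the choices, and a multi-stack Turing machine follows them. The procedure `Proc.prove` of `program`
guesses the last rule of a derivation, rewrites the conclusion on the stack into the premises and
calls itself for them. Its soundness is `spec_of_mem_program`, its completeness and the bound on the
number of commands is `BoundedProof.provesIn`.
-/

namespace BracketLambek

/-! ### Nondeterministic recursive programs on four stacks -/

/-- The four stacks of a program. -/
inductive Stk : Type
  | A | B | C | D
  deriving DecidableEq

instance : Fintype Stk := ⟨{.A, .B, .C, .D}, fun k => by cases k <;> simp⟩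

/-- The contents of the four stacks; the head of each list is the top of the stack. -/
structure Store (S : Type) : Type where
  a : List S
  b : List S
  c : List S
  d : List S

/-- The contents of a stack. -/
def Store.get {S : Type} (m : Store S) : Stk → List S
  | .A => m.a
  | .B => m.b
  | .C => m.c
  | .D => m.d

/-- Replaces the contents of a stack. -/
def Store.set {S : Type} (m : Store S) : Stk → List S → Store S
  | .A, l => { m with a := l }
  | .B, l => { m with b := l }
  | .C, l => { m with c := l }
  | .D, l => { m with d := l }

/-- The commands of a program with procedure names in `N`; `pop k s` fails unless the top of the
stack `k` is `s`. -/
inductive Cmd (S N : Type) : Type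
  | push (k : Stk) (s : S)
  | pop (k : Stk) (s : S)
  | call (p : N)
  deriving Fintype

/-- A program: each procedure has a finite list of alternative bodies. -/
abbrev Program (S N : Type) : Type := N → List (List (Cmd S N))

/-- `Exec P cs m m' n`: the commands `cs` can be executed from the store `m`, with some choice of
the bodies of the called procedures, ending in the store `m'`; `n` counts the commands executed. -/
inductive Exec {S N : Type} (P : Program S N) :
    List (Cmd S N) → Store S → Store S → ℕ → Prop
  | nil {m : Store S} : Exec P [] m m 0
  | push {k : Stk} {s : S} {cs : List (Cmd S N)} {m m' : Store S} {n : ℕ} :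
      Exec P cs (m.set k (s :: m.get k)) m' n → Exec P (.push k s :: cs) m m' (n + 1)
  | pop {k : Stk} {s : S} {r : List S} {cs : List (Cmd S N)} {m m' : Store S} {n : ℕ} :
      m.get k = s :: r → Exec P cs (m.set k r) m' n → Exec P (.pop k s :: cs) m m' (n + 1)
  | call {p : N} {body cs : List (Cmd S N)} {m m₁ m' : Store S} {n₁ n₂ : ℕ} :
      body ∈ P p → Exec P body m m₁ n₁ → Exec P cs m₁ m' n₂ →
      Exec P (.call p :: cs) m m' (n₁ + n₂ + 1)

theorem Exec.append {S N : Type} {P : Program S N} {cs ds : List (Cmd S N)}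
    {m m₁ m' : Store S} {n₁ n₂ : ℕ} (h : Exec P cs m m₁ n₁) (h' : Exec P ds m₁ m' n₂) :
    Exec P (cs ++ ds) m m' (n₁ + n₂) := by
  induction h with
  | nil => simpa using h'
  | push _ ih => exact Nat.add_right_comm _ _ _ ▸ (ih h').push
  | pop e _ ih => exact Nat.add_right_comm _ _ _ ▸ Exec.pop e (ih h')
  | call hb h₁ _ _ ih =>
    have := Exec.call hb h₁ (ih h')
    rw [show ∀ a b c : ℕ, a + (b + c) + 1 = a + b + 1 + c by intros; omega] at this
    exact this

/-- The input–output relation of a list of commands when a call of `p` acts as the relation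
`R p`. -/
def RunRel {S N : Type} (R : N → Store S → Store S → Prop) :
    List (Cmd S N) → Store S → Store S → Prop
  | [], m, m' => m = m'
  | .push k s :: cs, m, m' => RunRel R cs (m.set k (s :: m.get k)) m'
  | .pop k s :: cs, m, m' => ∃ r, m.get k = s :: r ∧ RunRel R cs (m.set k r) m'
  | .call p :: cs, m, m' => ∃ m₁, R p m m₁ ∧ RunRel R cs m₁ m'

/-- Partial correctness: a specification of the procedures which all bodies respect holds for all
executions. -/
theorem Exec.runRel {S N : Type} {P : Program S N} {R : N → Store S → Store S → Prop}
    (hR : ∀ p, ∀ body ∈ P p, ∀ m m', RunRel R body m m' → R p m m')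
    {cs : List (Cmd S N)} {m m' : Store S} {n : ℕ} (h : Exec P cs m m' n) :
    RunRel R cs m m' := by
  induction h with
  | nil => rfl
  | push _ ih => exact ih
  | pop e _ ih => exact ⟨_, e, ih⟩
  | call hb _ _ ih₁ ih₂ => exact ⟨_, hR _ _ hb _ _ ih₁, ih₂⟩

/-- The number of symbols on the stacks. -/
def Store.size {S : Type} (m : Store S) : ℕ :=
  m.a.length + m.b.length + m.c.length + m.d.length

theorem Store.size_set {S : Type} (m : Store S) (k : Stk) (l : List S) :
    (m.set k l).size + (m.get k).length = m.size + l.length := by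
  cases k <;> simp only [Store.size, Store.get, Store.set] <;> omega

/-! ### Execution guided by a certificate -/

/-- Reads the choice of an alternative, written in unary: `false` skips an alternative, `true`
takes it. -/
def select {α : Type} : List α → List Bool → Option (α × List Bool)
  | [], _ => none
  | _ :: _, [] => none
  | x :: _, true :: c => some (x, c)
  | _ :: l, false :: c => select l c

theorem select_replicate {α : Type} : ∀ (l₁ : List α) (x : α) (l₂ : List α) (c : List Bool),
    select (l₁ ++ x :: l₂) (List.replicate l₁.length false ++ true :: c) = some (x, c)
  | [], _, _, _ => rfl
  | _ :: l₁, x, l₂, c => select_replicate l₁ x l₂ c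

theorem select_mem {α : Type} : ∀ {l : List α} {c c' : List Bool} {x : α},
    select l c = some (x, c') → x ∈ l
  | [], c, _, _, h => by simp [select] at h
  | _ :: _, [], _, _, h => by simp [select] at h
  | y :: l, true :: c, c', x, h => by
    simp only [select, Option.some.injEq, Prod.mk.injEq] at h
    simp [h.1]
  | y :: l, false :: c, c', x, h => by
    simp only [select] at h
    exact List.mem_cons_of_mem _ (select_mem h)

/-- The certificate `c` leads the pending commands `cs` from the store `m` to the empty store. -/
inductive Accepts {S N : Type} (P : Program S N) :
    List Bool → List (Cmd S N) → Store S → Prop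
  | done {c : List Bool} : Accepts P c [] ⟨[], [], [], []⟩
  | push {c : List Bool} {k : Stk} {s : S} {cs : List (Cmd S N)} {m : Store S} :
      Accepts P c cs (m.set k (s :: m.get k)) → Accepts P c (.push k s :: cs) m
  | pop {c : List Bool} {k : Stk} {s : S} {r : List S} {cs : List (Cmd S N)} {m : Store S} :
      m.get k = s :: r → Accepts P c cs (m.set k r) → Accepts P c (.pop k s :: cs) m
  | call {c c' : List Bool} {p : N} {body cs : List (Cmd S N)} {m : Store S} :
      select (P p) c = some (body, c') → Accepts P c' (body ++ cs) m →
      Accepts P c (.call p :: cs) m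

theorem Exec.split_append {S N : Type} {P : Program S N} {cs ds : List (Cmd S N)}
    {m m' : Store S} {n : ℕ} (h : Exec P (cs ++ ds) m m' n) :
    ∃ m₁ n₁ n₂, Exec P cs m m₁ n₁ ∧ Exec P ds m₁ m' n₂ := by
  induction cs generalizing m n with
  | nil => exact ⟨m, 0, n, .nil, h⟩
  | cons x cs ih =>
    cases h with
    | push h =>
      obtain ⟨m₁, n₁, n₂, h₁, h₂⟩ := ih h
      exact ⟨m₁, _, n₂, h₁.push, h₂⟩
    | pop e h =>
      obtain ⟨m₁, n₁, n₂, h₁, h₂⟩ := ih h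
      exact ⟨m₁, _, n₂, .pop e h₁, h₂⟩
    | call hb hb' h =>
      obtain ⟨m₁, n₁, n₂, h₁, h₂⟩ := ih h
      exact ⟨m₁, _, n₂, .call hb hb' h₁, h₂⟩

theorem Accepts.exists_exec {S N : Type} {P : Program S N} {c : List Bool}
    {cs : List (Cmd S N)} {m : Store S} (h : Accepts P c cs m) :
    ∃ n, Exec P cs m ⟨[], [], [], []⟩ n := by
  induction h with
  | done => exact ⟨0, .nil⟩
  | push _ ih => obtain ⟨n, h⟩ := ih; exact ⟨_, h.push⟩
  | pop e _ ih => obtain ⟨n, h⟩ := ih; exact ⟨_, .pop e h⟩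
  | call hs _ ih =>
    obtain ⟨n, h⟩ := ih
    obtain ⟨m₁, n₁, n₂, h₁, h₂⟩ := h.split_append
    exact ⟨_, .call (select_mem hs) h₁ h₂⟩

/-- An execution of `n` commands is described by a certificate of length `O(n)`. -/
theorem Exec.exists_accepts {S N : Type} {P : Program S N} {L : ℕ}
    (hL : ∀ p, (P p).length ≤ L) {cs : List (Cmd S N)} {m m' : Store S} {n : ℕ}
    (h : Exec P cs m m' n) : ∃ c : List Bool, c.length ≤ L * n ∧
      ∀ (c' : List Bool) (ds : List (Cmd S N)), Accepts P c' ds m' →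
        Accepts P (c ++ c') (cs ++ ds) m := by
  induction h with
  | nil => exact ⟨[], by simp, fun _ _ h => h⟩
  | @push k s cs m m' n _ ih =>
    obtain ⟨c, hc, h⟩ := ih
    exact ⟨c, hc.trans (Nat.mul_le_mul_left _ (Nat.le_succ n)), fun c' ds h' => .push (h c' ds h')⟩
  | @pop k s r cs m m' n e _ ih =>
    obtain ⟨c, hc, h⟩ := ih
    exact ⟨c, hc.trans (Nat.mul_le_mul_left _ (Nat.le_succ n)),
      fun c' ds h' => .pop e (h c' ds h')⟩
  | @call p body cs m m₁ m' n₁ n₂ hb _ _ ih₁ ih₂ =>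
    obtain ⟨c₁, hc₁, h₁⟩ := ih₁
    obtain ⟨c₂, hc₂, h₂⟩ := ih₂
    obtain ⟨l₁, l₂, hl⟩ := List.append_of_mem hb
    refine ⟨List.replicate l₁.length false ++ true :: (c₁ ++ c₂), ?_, fun c' ds h' => ?_⟩
    · have := hL p
      simp only [hl, List.length_append, List.length_cons, List.length_replicate] at this ⊢
      rw [mul_add, mul_add]
      omega
    · refine .call (body := body) (c' := c₁ ++ (c₂ ++ c')) ?_ (h₁ _ _ (h₂ _ _ h'))
      rw [hl, ← select_replicate l₁ body l₂]
      simp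

/-! ### The Turing machine that follows a certificate -/

namespace Verifier

/-- The stacks of the machine: input, pending commands, the four stacks of the program, output. -/
inductive K : Type
  | inp | ctl | work (k : Stk) | out
  deriving DecidableEq, Fintype

variable {S N : Type}

variable (S N) in
/-- The alphabets of the stacks. -/
abbrev Alph : K → Type
  | .inp => S ⊕ Bool
  | .ctl => Cmd S N
  | .work _ => S
  | .out => Bool

variable (S N) in
/-- The registers of the machine: the last command read, the last input symbol read, the last
symbol read from a work stack, and whether all stacks read so far were empty. -/
structure Reg : Type where
  cmd : Option (Cmd S N)
  sym : Option (S ⊕ Bool)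
  top : Option S
  ok : Bool

variable (S N) in
def Reg.equiv : Reg S N ≃ Option (Cmd S N) × Option (S ⊕ Bool) × Option S × Bool where
  toFun v := (v.cmd, v.sym, v.top, v.ok)
  invFun v := ⟨v.1, v.2.1, v.2.2.1, v.2.2.2⟩
  left_inv _ := rfl
  right_inv _ := rfl

instance [Fintype S] [Fintype N] : Fintype (Reg S N) := .ofEquiv _ (Reg.equiv S N).symm

variable (S N) in
/-- The labels of the machine; `choose p i` reads the choice between the alternatives of the
procedure `p` from the `i`-th one on. -/
inductive Label (L : ℕ) : Type
  | load | put (s : S) | start | run | exec (x : Cmd S N) | choose (p : N) (i : Fin (L + 1))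
  | check | clean (b : Bool)
  deriving Fintype

/-- The contents of all stacks. -/
def conts (i : List (S ⊕ Bool)) (t : List (Cmd S N)) (m : Store S) (o : List Bool) :
    ∀ k, List (Alph S N k)
  | .inp => i
  | .ctl => t
  | .work k => m.get k
  | .out => o

section

variable (i : List (S ⊕ Bool)) (t : List (Cmd S N)) (m : Store S) (o : List Bool)

@[simp] theorem conts_inp : conts i t m o .inp = i := rfl
@[simp] theorem conts_ctl : conts i t m o .ctl = t := rfl
@[simp] theorem conts_work (k : Stk) : conts i t m o (.work k) = m.get k := rfl
@[simp] theorem conts_out : conts i t m o .out = o := rfl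

@[simp] theorem update_inp (i' : List (S ⊕ Bool)) :
    Function.update (conts i t m o) .inp i' = conts i' t m o := by
  funext k; cases k <;> simp [Function.update]

@[simp] theorem update_ctl (t' : List (Cmd S N)) :
    Function.update (conts i t m o) .ctl t' = conts i t' m o := by
  funext k; cases k <;> simp [Function.update]

@[simp] theorem update_out (o' : List Bool) :
    Function.update (conts i t m o) .out o' = conts i t m o' := by
  funext k; cases k <;> simp [Function.update]

@[simp] theorem update_work (k : Stk) (l : List S) :
    Function.update (conts i t m o) (.work k) l = conts i t (m.set k l) o := by
  funext k'
  cases k' with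
  | work k' => cases k <;> cases k' <;> simp [Function.update] <;> rfl
  | _ => simp [Function.update]; try rfl

end

open Turing.TM2.Stmt in
/-- The code of the machine. The input is a word followed by a certificate. At the labels `load` and
`put` the word is moved to the work stack `B`, which reverses it; at `run` the topmost pending
command is executed; calls push the body selected by the certificate onto the stack of pending
commands. Each call consumes a part of the certificate, so that every run ends. At `clean b` all
stacks are emptied, as Mathlib requires of halting configurations, and `b` is output. -/
def code [DecidableEq S] [DecidableEq N] (P : Program S N) (main : N) (L : ℕ) :
    Label S N L → Turing.TM2.Stmt (Alph S N) (Label S N L) (Reg S N)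
  | .load => peek .inp (fun v a => { v with sym := a }) <|
      goto fun v => match v.sym with
        | some (.inl s) => .put s
        | _ => .start
  | .put s => pop .inp (fun v _ => v) <| push (.work .B) (fun _ => s) <| goto fun _ => .load
  | .start => push .ctl (fun _ => .call main) <| goto fun _ => .run
  | .run => pop .ctl (fun v a => { v with cmd := a }) <|
      goto fun v => match v.cmd with
        | some x => .exec x
        | none => .check
  | .exec (.push k s) => push (.work k) (fun _ => s) <| goto fun _ => .run
  | .exec (.pop k s) => pop (.work k) (fun v a => { v with top := a }) <|
      goto fun v => if v.top = some s then .run else .clean false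
  | .exec (.call p) => goto fun _ => .choose p 0
  | .choose p i => match (P p)[(i : ℕ)]? with
      | none => goto fun _ => .clean false
      | some body => pop .inp (fun v a => { v with sym := a }) <|
          branch (fun v => v.sym = some (.inr true))
            (body.foldl (fun q x => push .ctl (fun _ => x) q) (goto fun _ => .run)) <|
          goto fun v => if v.sym = some (.inr false) then .choose p (i + 1) else .clean false
  | .check => load (fun v => { v with ok := true }) <|
      peek (.work .A) (fun v a => { v with ok := v.ok && a.isNone }) <|
      peek (.work .B) (fun v a => { v with ok := v.ok && a.isNone }) <|
      peek (.work .C) (fun v a => { v with ok := v.ok && a.isNone }) <|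
      peek (.work .D) (fun v a => { v with ok := v.ok && a.isNone }) <|
      goto fun v => .clean v.ok
  | .clean b => load (fun v => { v with ok := true }) <|
      pop .inp (fun v a => { v with ok := v.ok && a.isNone }) <|
      pop .ctl (fun v a => { v with ok := v.ok && a.isNone }) <|
      pop (.work .A) (fun v a => { v with ok := v.ok && a.isNone }) <|
      pop (.work .B) (fun v a => { v with ok := v.ok && a.isNone }) <|
      pop (.work .C) (fun v a => { v with ok := v.ok && a.isNone }) <|
      pop (.work .D) (fun v a => { v with ok := v.ok && a.isNone }) <|
      branch (fun v => v.ok)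
        (push .out (fun _ => b) <| load (fun _ => ⟨none, none, none, true⟩) halt)
        (goto fun _ => .clean b)

variable (P : Program S N) (main : N) (L : ℕ)

/-- `List.foldl` nests the pushes such that the first command of `body` is pushed last. -/
theorem stepAux_pushAll (body : List (Cmd S N))
    (q : Turing.TM2.Stmt (Alph S N) (Label S N L) (Reg S N)) (v : Reg S N)
    (i : List (S ⊕ Bool)) (t : List (Cmd S N)) (m : Store S) (o : List Bool) :
    Turing.TM2.stepAux (body.foldl (fun q x => .push .ctl (fun _ => x) q) q) v (conts i t m o) =
      Turing.TM2.stepAux q v (conts i (body ++ t) m o) := by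
  induction body generalizing q with
  | nil => rfl
  | cons x body ih => rw [List.foldl_cons, ih]; simp [Turing.TM2.stepAux]

variable [DecidableEq S] [DecidableEq N]

/-- The machine halts in the configuration `r` after at most `n` steps. -/
def HaltsIn (n : ℕ) (x r : Turing.TM2.Cfg (Alph S N) (Label S N L) (Reg S N)) : Prop :=
  ∃ k ≤ n, (flip bind (Turing.TM2.step (code P main L)))^[k] (some x) = some r

variable {P main L}

theorem HaltsIn.mono {n n' : ℕ} {x r : Turing.TM2.Cfg (Alph S N) (Label S N L) (Reg S N)}
    (h : HaltsIn P main L n x r) (hn : n ≤ n') : HaltsIn P main L n' x r :=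
  let ⟨k, hk, e⟩ := h; ⟨k, hk.trans hn, e⟩

theorem HaltsIn.step {n : ℕ} {l : Label S N L} {v : Reg S N} {st : ∀ k, List (Alph S N k)}
    {x r : Turing.TM2.Cfg (Alph S N) (Label S N L) (Reg S N)} (h : HaltsIn P main L n x r)
    (e : Turing.TM2.stepAux (code P main L l) v st = x) :
    HaltsIn P main L (n + 1) ⟨some l, v, st⟩ r := by
  obtain ⟨k, hk, h⟩ := h
  refine ⟨k + 1, by omega, ?_⟩
  rw [Function.iterate_succ_apply, ← h, ← e]
  rfl

variable (S N L) in
/-- The halting configuration with output `b`. -/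
def halted (b : Bool) : Turing.TM2.Cfg (Alph S N) (Label S N L) (Reg S N) :=
  ⟨none, ⟨none, none, none, true⟩, conts [] [] ⟨[], [], [], []⟩ [b]⟩

theorem haltsIn_clean (b : Bool) (n : ℕ) : ∀ (v : Reg S N) (i : List (S ⊕ Bool))
    (t : List (Cmd S N)) (m : Store S), i.length + t.length + m.size ≤ n →
    HaltsIn P main L (n + 1) ⟨some (.clean b), v, conts i t m []⟩ (halted S N L b) := by
  induction n with
  | zero =>
    rintro v i t ⟨a, b, c, d⟩ h
    simp only [Store.size] at h
    obtain rfl := List.length_eq_zero_iff.1 (show i.length = 0 by omega)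
    obtain rfl := List.length_eq_zero_iff.1 (show t.length = 0 by omega)
    obtain rfl := List.length_eq_zero_iff.1 (show a.length = 0 by omega)
    obtain rfl := List.length_eq_zero_iff.1 (show b.length = 0 by omega)
    obtain rfl := List.length_eq_zero_iff.1 (show c.length = 0 by omega)
    obtain rfl := List.length_eq_zero_iff.1 (show d.length = 0 by omega)
    refine HaltsIn.step (x := halted S N L _) ⟨0, le_rfl, rfl⟩ ?_
    simp [code, Store.get, Store.set, halted]
  | succ n ih =>
    rintro v i t ⟨a, b', c, d⟩ h
    by_cases h0 : i = [] ∧ t = [] ∧ a = [] ∧ b' = [] ∧ c = [] ∧ d = []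
    · obtain ⟨rfl, rfl, rfl, rfl, rfl, rfl⟩ := h0
      refine HaltsIn.mono (HaltsIn.step (x := halted S N L _) ⟨0, le_rfl, rfl⟩ ?_)
        (show 0 + 1 ≤ _ by omega)
      simp [code, Store.get, Store.set, halted]
    · have hok : (i.head?.isNone && t.head?.isNone && a.head?.isNone && b'.head?.isNone &&
          c.head?.isNone && d.head?.isNone) = false := by
        rw [Bool.eq_false_iff]
        intro h'
        apply h0
        simpa [and_assoc] using h'
      refine HaltsIn.step
        (ih ⟨v.cmd, v.sym, v.top, false⟩ i.tail t.tail ⟨a.tail, b'.tail, c.tail, d.tail⟩ ?_) ?_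
      · simp only [Store.size, List.length_tail] at h ⊢
        by_contra h'
        apply h0
        simp only [← List.length_eq_zero_iff]
        omega
      · simp only [code, Turing.TM2.stepAux, conts_inp, update_inp, conts_ctl, update_ctl,
          conts_work, update_work, Store.get, Store.set, Bool.true_and, hok, cond_false]

variable {R : ℕ}

theorem haltsIn_fail (v : Reg S N) (c : List (S ⊕ Bool)) (t : List (Cmd S N)) (m : Store S) :
    HaltsIn P main L (c.length + t.length + m.size + 1)
      ⟨some (.clean false), v, conts c t m []⟩ (halted S N L false) :=
  haltsIn_clean false _ v _ t m le_rfl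

/-- Running time from a configuration with `c` bits of certificate, `t` pending commands and `s`
symbols on the work stacks, if all bodies have at most `R` commands: each bit of the certificate
causes at most `R` commands to be pushed. -/
def runTime (R c t s : ℕ) : ℕ := 4 * t + (4 * R + 4) * c + s + 4

theorem haltsIn_check (v : Reg S N) (c : List Bool) (m : Store S) :
    ∃ b, (b = true ↔ Accepts P c [] m) ∧ HaltsIn P main L (c.length + m.size + 2)
      ⟨some .check, v, conts (c.map .inr) [] m []⟩ (halted S N L b) := by
  obtain ⟨a, b, c', d⟩ := m
  refine ⟨a.head?.isNone && b.head?.isNone && c'.head?.isNone && d.head?.isNone, ?_, ?_⟩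
  · constructor
    · intro h
      simp only [Bool.and_eq_true, Option.isNone_iff_eq_none, List.head?_eq_none_iff] at h
      obtain ⟨⟨⟨rfl, rfl⟩, rfl⟩, rfl⟩ := h
      exact .done
    · intro h
      cases h
      rfl
  · refine HaltsIn.step (haltsIn_clean _ _ ⟨v.cmd, v.sym, v.top, a.head?.isNone &&
        b.head?.isNone && c'.head?.isNone && d.head?.isNone⟩ (c.map .inr) []
        ⟨a, b, c', d⟩ (by simp)) ?_
    simp [code, Store.get]

/-- The machine at the label `choose p i` decides whether the certificate leads to the empty store
from a call of `p` in which the first `i` alternatives are excluded. -/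
def DecidesChoose (P : Program S N) (main : N) (L R : ℕ) (c : List Bool) : Prop :=
  ∀ (p : N) (i : Fin (L + 1)) (t : List (Cmd S N)) (m : Store S) (v : Reg S N),
    ∃ b, (b = true ↔ ∃ body c', select ((P p).drop i) c = some (body, c') ∧
        Accepts P c' (body ++ t) m) ∧
      HaltsIn P main L (runTime R c.length t.length m.size + 2)
        ⟨some (.choose p i), v, conts (c.map .inr) t m []⟩ (halted S N L b)

/-- If calls are decided correctly for the certificate `c`, then so are all lists of pending
commands. -/
theorem DecidesChoose.haltsIn_run {c : List Bool} (h : DecidesChoose P main L R c)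
    (t : List (Cmd S N)) : ∀ (m : Store S) (v : Reg S N),
    ∃ b, (b = true ↔ Accepts P c t m) ∧ HaltsIn P main L (runTime R c.length t.length m.size)
      ⟨some .run, v, conts (c.map .inr) t m []⟩ (halted S N L b) := by
  have hc : c.length ≤ (4 * R + 4) * c.length := Nat.le_mul_of_pos_left _ (by omega)
  induction t with
  | nil =>
    intro m v
    obtain ⟨b, hb, h'⟩ := haltsIn_check (P := P) (main := main) (L := L)
      ⟨none, v.sym, v.top, v.ok⟩ c m
    exact ⟨b, hb, (h'.step (by simp [code])).mono (by simp only [runTime, List.length_nil]; omega)⟩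
  | cons x t ih =>
    intro m v
    cases x with
    | push k s =>
      obtain ⟨b, hb, h'⟩ := ih (m.set k (s :: m.get k)) ⟨some (.push k s), v.sym, v.top, v.ok⟩
      refine ⟨b, hb.trans ⟨.push, fun h => by cases h; assumption⟩,
        ((h'.step (l := .exec (.push k s)) (st := conts (c.map .inr) t m [])
          (v := ⟨some (.push k s), v.sym, v.top, v.ok⟩) (by simp [code])).step
            (by simp [code])).mono ?_⟩
      have := m.size_set k (s :: m.get k)
      simp only [runTime, List.length_cons] at this ⊢
      omega
    | pop k s =>
      rcases hk : m.get k with _ | ⟨s', r⟩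
      · refine ⟨false, ⟨nofun, fun h => by cases h; simp_all⟩,
          (((haltsIn_fail ⟨some (.pop k s), v.sym, none, v.ok⟩ (c.map .inr) t (m.set k [])).step
            (l := .exec (.pop k s))
            (v := ⟨some (.pop k s), v.sym, v.top, v.ok⟩)
            (st := conts (c.map .inr) t m []) (by simp [code, hk])).step
              (by simp [code])).mono ?_⟩
        have := m.size_set k []
        simp only [runTime, List.length_cons, List.length_map, List.length_nil] at this ⊢
        omega
      · have := m.size_set k r
        rw [hk] at this
        by_cases hs : s' = s
        · subst hs
          obtain ⟨b, hb, h'⟩ := ih (m.set k r) ⟨some (.pop k s'), v.sym, some s', v.ok⟩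
          refine ⟨b, hb.trans ⟨.pop hk, fun h => ?_⟩,
            ((h'.step (l := .exec (.pop k s')) (v := ⟨some (.pop k s'), v.sym, v.top, v.ok⟩)
              (st := conts (c.map .inr) t m []) (by simp [code, hk])).step
                (by simp [code])).mono ?_⟩
          · cases h with
            | pop e h =>
              rw [hk] at e
              cases e
              exact h
          · simp only [runTime, List.length_cons] at this ⊢
            omega
        · refine ⟨false, ⟨nofun, fun h => by cases h; simp_all⟩,
            (((haltsIn_fail ⟨some (.pop k s), v.sym, some s', v.ok⟩ (c.map .inr) t (m.set k r)).step
              (l := .exec (.pop k s))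
              (v := ⟨some (.pop k s), v.sym, v.top, v.ok⟩)
              (st := conts (c.map .inr) t m []) (by simp [code, hk, hs])).step
                (by simp [code])).mono ?_⟩
          simp only [runTime, List.length_cons, List.length_map] at this ⊢
          omega
    | call p =>
      obtain ⟨b, hb, h'⟩ := h p 0 t m ⟨some (.call p), v.sym, v.top, v.ok⟩
      refine ⟨b, hb.trans ⟨fun ⟨body, c', h₁, h₂⟩ => .call h₁ h₂, fun h => ?_⟩,
        ((h'.step (l := .exec (.call p)) (v := ⟨some (.call p), v.sym, v.top, v.ok⟩)
          (st := conts (c.map .inr) t m []) (by simp [code])).step (by simp [code])).mono ?_⟩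
      · cases h with
        | call h₁ h₂ => exact ⟨_, _, h₁, h₂⟩
      · simp only [runTime, List.length_cons]
        omega

/-- By induction on the certificate: every alternative that is skipped or taken uses up one bit. -/
theorem decidesChoose (hL : ∀ p, (P p).length ≤ L) (hR : ∀ p, ∀ body ∈ P p, body.length ≤ R)
    (c : List Bool) : DecidesChoose P main L R c := by
  induction c with
  | nil =>
    intro p i t m v
    rcases hi : (P p)[(i : ℕ)]? with _ | body
    · refine ⟨false, ⟨nofun, fun ⟨body, c', h, _⟩ => ?_⟩,
        ((haltsIn_fail v [] t m).step (by simp [code, hi])).mono ?_⟩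
      · simp [List.drop_eq_nil_of_le (List.getElem?_eq_none_iff.1 hi), select] at h
      · simp only [runTime, List.length_nil]; omega
    · refine ⟨false, ⟨nofun, fun ⟨body, c', h, _⟩ => ?_⟩,
        ((haltsIn_fail ⟨v.cmd, none, v.top, v.ok⟩ [] t m).step (by simp [code, hi])).mono ?_⟩
      · rcases hd : (P p).drop i with _ | _ <;> simp [hd, select] at h
      · simp only [runTime, List.length_nil]; omega
  | cons x c ih =>
    intro p i t m v
    have hc : c.length ≤ (4 * R + 4) * c.length := Nat.le_mul_of_pos_left _ (by omega)
    have hc' : (4 * R + 4) * (c.length + 1) = (4 * R + 4) * c.length + (4 * R + 4) := by ring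
    rcases hi : (P p)[(i : ℕ)]? with _ | body
    · refine ⟨false, ⟨nofun, fun ⟨body, c', h, _⟩ => ?_⟩,
        ((haltsIn_fail v ((x :: c).map .inr) t m).step (by simp [code, hi])).mono ?_⟩
      · simp [List.drop_eq_nil_of_le (List.getElem?_eq_none_iff.1 hi), select] at h
      · simp only [runTime, List.length_map, List.length_cons]; omega
    · obtain ⟨hlt, rfl⟩ := List.getElem?_eq_some_iff.1 hi
      have hd := List.drop_eq_getElem_cons hlt
      cases x with
      | true =>
        obtain ⟨b, hb, h'⟩ := ih.haltsIn_run ((P p)[(i : ℕ)] ++ t) m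
          ⟨v.cmd, some (.inr true), v.top, v.ok⟩
        refine ⟨b, hb.trans ⟨fun h => ⟨_, c, by rw [hd]; rfl, h⟩, fun ⟨body, c', h₁, h₂⟩ => ?_⟩,
          (h'.step ?_).mono ?_⟩
        · rw [hd] at h₁
          cases h₁
          exact h₂
        · simp [code, hi, stepAux_pushAll]
        · have := hR p _ (List.getElem_mem hlt)
          simp only [runTime, List.length_append, List.length_cons]
          omega
      | false =>
        obtain ⟨b, hb, h'⟩ := ih p (i + 1) t m ⟨v.cmd, some (.inr false), v.top, v.ok⟩
        have hi' : ((i + 1 : Fin (L + 1)) : ℕ) = i + 1 :=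
          Fin.val_add_one_of_lt' (by have := hL p; omega)
        rw [hi'] at hb
        refine ⟨b, hb.trans (by rw [hd]; rfl), (h'.step (by simp [code, hi])).mono ?_⟩
        simp only [runTime, List.length_cons]
        omega

/-- The machine, started on the remaining part `x` of the word, decides whether the certificate is
accepted. -/
theorem haltsIn_load (hL : ∀ p, (P p).length ≤ L) (hR : ∀ p, ∀ body ∈ P p, body.length ≤ R)
    (c : List Bool) (x : List S) : ∀ (y : List S) (v : Reg S N),
    ∃ b, (b = true ↔ Accepts P c [.call main] ⟨[], x.reverse ++ y, [], []⟩) ∧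
      HaltsIn P main L (2 * x.length + 2 + runTime R c.length 1 (x.length + y.length))
        ⟨some .load, v, conts (x.map .inl ++ c.map .inr) [] ⟨[], y, [], []⟩ []⟩
        (halted S N L b) := by
  induction x with
  | nil =>
    intro y v
    obtain ⟨b, hb, h⟩ := (decidesChoose (main := main) hL hR c).haltsIn_run [.call main]
      ⟨[], y, [], []⟩ ⟨v.cmd, (c.map .inr).head?, v.top, v.ok⟩
    refine ⟨b, hb, ((h.step (l := .start) (v := ⟨v.cmd, (c.map .inr).head?, v.top, v.ok⟩)
      (st := conts (c.map .inr) [] ⟨[], y, [], []⟩ []) (by simp [code])).step ?_).mono ?_⟩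
    · cases c <;> simp [code]
    · simp [Store.size]; omega
  | cons s x ih =>
    intro y v
    obtain ⟨b, hb, h⟩ := ih (s :: y) ⟨v.cmd, some (.inl s), v.top, v.ok⟩
    refine ⟨b, by simpa using hb, ((h.step (l := .put s)
      (v := ⟨v.cmd, some (.inl s), v.top, v.ok⟩)
      (st := conts (((s :: x).map .inl) ++ c.map .inr) [] ⟨[], y, [], []⟩ [])
      (by simp [code, Store.get, Store.set])).step (by simp [code])).mono ?_⟩
    simp only [List.length_cons, runTime]
    omega

/-- The machine as a `Turing.FinTM2`. -/
def machine [Fintype S] [Fintype N] (P : Program S N) (main : N) (L : ℕ) : Turing.FinTM2 where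
  K := K
  k₀ := .inp
  k₁ := .out
  Γ := Alph S N
  Λ := Label S N L
  main := .load
  σ := Reg S N
  initialState := ⟨none, none, none, true⟩
  Γk₀Fin := inferInstanceAs (Fintype (S ⊕ Bool))
  m := code P main L

theorem initList_machine [Fintype S] [Fintype N] (l : List (S ⊕ Bool)) :
    Turing.initList (machine P main L) l =
      ⟨some .load, ⟨none, none, none, true⟩, conts l [] ⟨[], [], [], []⟩ []⟩ := by
  refine congrArg (Turing.TM2.Cfg.mk _ _) (funext fun k => ?_)
  cases k with
  | work k => cases k <;> rfl
  | _ => rfl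

theorem haltList_machine [Fintype S] [Fintype N] (b : Bool) :
    Turing.haltList (machine P main L) [b] = halted S N L b := by
  refine congrArg (Turing.TM2.Cfg.mk _ _) (funext fun k => ?_)
  cases k with
  | work k => cases k <;> rfl
  | _ => rfl

end Verifier

open Verifier in
/-- A language is in NP if it consists of the words `x` for which a program, started with the
reversal of `x` on the stack `B`, can empty all stacks, and if polynomially many commands suffice
for this. -/
theorem InNP.of_program {S N : Type} [Fintype S] [Fintype N] {P : Program S N}
    {main : N} {X : Language S} {p : Polynomial ℕ}
    (hsound : ∀ x n, Exec P [.call main] ⟨[], x.reverse, [], []⟩ ⟨[], [], [], []⟩ n → x ∈ X)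
    (hcomplete : ∀ x ∈ X, ∃ n ≤ p.eval x.length,
      Exec P [.call main] ⟨[], x.reverse, [], []⟩ ⟨[], [], [], []⟩ n) : InNP X := by
  classical
  obtain ⟨L, hL⟩ : ∃ L, ∀ q, (P q).length ≤ L :=
    ⟨Finset.univ.sup fun q => (P q).length, fun q =>
      Finset.le_sup (f := fun q => (P q).length) (Finset.mem_univ q)⟩
  obtain ⟨R, hR⟩ : ∃ R, ∀ q, ∀ body ∈ P q, body.length ≤ R := by
    refine ⟨Finset.univ.sup fun q => ((P q).map List.length).sum, fun q body hb => ?_⟩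
    exact (List.le_sum_of_mem (List.mem_map_of_mem hb)).trans
      (Finset.le_sup (f := fun q => ((P q).map List.length).sum) (Finset.mem_univ q))
  let V : List S × List Bool → Bool := fun xc =>
    decide (Accepts P xc.2 [.call main] ⟨[], xc.1.reverse, [], []⟩)
  have hV : ∀ x c, V (x, c) = true ↔ Accepts P c [.call main] ⟨[], x.reverse, [], []⟩ :=
    fun x c => decide_eq_true_iff
  refine ⟨.C L * p, V, ⟨?_⟩, fun x => ⟨fun hx => ?_, fun ⟨c, _, hc⟩ => ?_⟩⟩
  · refine
      { tm := machine P main L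
        inputAlphabet := Equiv.refl (S ⊕ Bool)
        outputAlphabet := Equiv.refl Bool
        time := .C (4 * R + 7) * .X + .C 10
        outputsFun := ?_ }
    rintro ⟨x, c⟩
    have hx := haltsIn_load (main := main) hL hR c x [] ⟨none, none, none, true⟩
    have hx' : ∃ k ≤ (4 * R + 7) * (x.length + c.length) + 10,
        (flip bind (Turing.TM2.step (code P main L)))^[k] (some ⟨some .load,
          ⟨none, none, none, true⟩, conts (x.map .inl ++ c.map .inr) [] ⟨[], [], [], []⟩ []⟩) =
        some (halted S N L (V (x, c))) := by
      obtain ⟨b, hb, k, hk, h⟩ := hx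
      rw [List.append_nil, ← hV, Bool.coe_iff_coe] at hb
      refine ⟨k, hk.trans ?_, hb ▸ h⟩
      have : (4 * R + 7) * (x.length + c.length) =
        (4 * R + 4) * x.length + (4 * R + 4) * c.length + 3 * x.length + 3 * c.length := by ring
      simp only [runTime, List.length_nil]
      omega
    refine ⟨⟨hx'.choose, ?_⟩, hx'.choose_spec.1.trans (le_of_eq ?_)⟩
    · refine Eq.trans ?_ (hx'.choose_spec.2.trans (congrArg some (haltList_machine _).symm))
      exact congrArg (fun y => (flip bind (Turing.TM2.step (code P main L)))^[hx'.choose] (some y))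
        ((congrArg (Turing.initList (machine P main L)) (List.map_id _)).trans
          (initList_machine _))
    · simp [Computability.encodingProd, Computability.encodingList]
  · obtain ⟨n, hn, h⟩ := hcomplete x hx
    obtain ⟨c, hc, h⟩ := h.exists_accepts hL
    refine ⟨c, ?_, (hV x c).2 (by simpa using h [] [] .done)⟩
    simpa using hc.trans (Nat.mul_le_mul_left L hn)
  · obtain ⟨n, h⟩ := ((hV x c).1 hc).exists_exec
    exact hsound x n h

open Item Formula

/-! ### The cut-free calculus -/

/-- Unary left rules other than permutation: `LeftRule X Y` if `Δ(X) → D` yields `Δ(Y) → D`. -/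
inductive LeftRule : MetaFormula → MetaFormula → Prop
  | prod (A B : Formula) : LeftRule [form A, form B] [form (prod A B)]
  | one : LeftRule [] [form one]
  | dia (A : Formula) : LeftRule [brack [form A]] [form (dia A)]
  | boxInv (A : Formula) : LeftRule [form A] [brack [form (boxInv A)]]
  | bang (A : Formula) : LeftRule [form A] [form (bang A)]
  | contr (As : List Formula) (Γ : MetaFormula) :
      LeftRule (bangs As ++ [brack (bangs As ++ Γ)]) (bangs As ++ Γ)

/-- The permutation rules: `PermRule X Y` if `Δ(X) → D` yields `Δ(Y) → D`. -/
inductive PermRule : MetaFormula → MetaFormula → Prop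
  | right (A : Formula) (Γ : MetaFormula) : PermRule ([form (bang A)] ++ Γ) (Γ ++ [form (bang A)])
  | left (A : Formula) (Γ : MetaFormula) : PermRule (Γ ++ [form (bang A)]) ([form (bang A)] ++ Γ)

/-- The left rules of the divisions: `DivRule Γ A C Y` if `Γ → A` and `Δ(C) → D` yield
`Δ(Y) → D`. -/
inductive DivRule : MetaFormula → Formula → Formula → MetaFormula → Prop
  | rdiv (Γ : MetaFormula) (B C : Formula) : DivRule Γ B C ([form (rdiv C B)] ++ Γ)
  | ldiv (Γ : MetaFormula) (A C : Formula) : DivRule Γ A C (Γ ++ [form (ldiv A C)])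

/-- Unary right rules: `RightRule Γ B Γ' B'` if `Γ → B` yields `Γ' → B'`. -/
inductive RightRule : MetaFormula → Formula → MetaFormula → Formula → Prop
  | rdiv (Γ : MetaFormula) (B C : Formula) : RightRule (Γ ++ [form B]) C Γ (rdiv C B)
  | ldiv (Γ : MetaFormula) (A C : Formula) : RightRule ([form A] ++ Γ) C Γ (ldiv A C)
  | dia (Γ : MetaFormula) (A : Formula) : RightRule Γ A [brack Γ] (dia A)
  | boxInv (Γ : MetaFormula) (A : Formula) : RightRule [brack Γ] A Γ (boxInv A)
  | bang (As : List Formula) (A : Formula) : RightRule (bangs As) A (bangs As) (bang A)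

/-- Derivability without the cut rule. -/
inductive CutFree : MetaFormula → Formula → Prop
  | ax (A : Formula) : CutFree [form A] A
  | one_right : CutFree [] one
  | left {X Y : MetaFormula} {D : Formula} (Δ : Context) (h : LeftRule X Y) :
      CutFree (Δ.fill X) D → CutFree (Δ.fill Y) D
  | perm {X Y : MetaFormula} {D : Formula} (Δ : Context) (h : PermRule X Y) :
      CutFree (Δ.fill X) D → CutFree (Δ.fill Y) D
  | div {Γ Y : MetaFormula} {A C D : Formula} (Δ : Context) (h : DivRule Γ A C Y) :
      CutFree Γ A → CutFree (Δ.fill [form C]) D → CutFree (Δ.fill Y) D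
  | right {Γ Γ' : MetaFormula} {B B' : Formula} (h : RightRule Γ B Γ' B') :
      CutFree Γ B → CutFree Γ' B'
  | prod_right {Γ₁ Γ₂ : MetaFormula} {A B : Formula} :
      CutFree Γ₁ A → CutFree Γ₂ B → CutFree (Γ₁ ++ Γ₂) (prod A B)

theorem LeftRule.derivable {X Y : MetaFormula} {D : Formula} (h : LeftRule X Y) (Δ : Context)
    (h' : Derivable (Δ.fill X) D) : Derivable (Δ.fill Y) D := by
  cases h with
  | prod A B => exact .prod_left _ _ _ _ h'
  | one => exact .one_left _ _ h'
  | dia A => exact .dia_left _ _ _ h'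
  | boxInv A => exact .boxInv_left _ _ _ h'
  | bang A => exact .bang_left _ _ _ h'
  | contr As Γ => exact .contr _ _ _ _ h'

theorem PermRule.derivable {X Y : MetaFormula} {D : Formula} (h : PermRule X Y) (Δ : Context)
    (h' : Derivable (Δ.fill X) D) : Derivable (Δ.fill Y) D := by
  cases h with
  | right A Γ => exact .perm₁ _ _ _ _ h'
  | left A Γ => exact .perm₂ _ _ _ _ h'

theorem DivRule.derivable {Γ Y : MetaFormula} {A C D : Formula} (h : DivRule Γ A C Y)
    (Δ : Context) (h₁ : Derivable Γ A) (h₂ : Derivable (Δ.fill [form C]) D) :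
    Derivable (Δ.fill Y) D := by
  cases h with
  | rdiv => exact .rdiv_left _ _ _ _ _ h₁ h₂
  | ldiv => exact .ldiv_left _ _ _ _ _ h₁ h₂

theorem RightRule.derivable {Γ Γ' : MetaFormula} {B B' : Formula} (h : RightRule Γ B Γ' B')
    (h' : Derivable Γ B) : Derivable Γ' B' := by
  cases h with
  | rdiv => exact .rdiv_right _ _ _ h'
  | ldiv => exact .ldiv_right _ _ _ h'
  | dia => exact .dia_right _ _ h'
  | boxInv => exact .boxInv_right _ _ h'
  | bang => exact .bang_right _ _ h'

/-! ### Cut elimination -/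

/-- Composition of contexts. -/
def Context.comp : Context → Context → Context
  | .hole L R, .hole L' R' => .hole (L ++ L') (R' ++ R)
  | .hole L R, .brack L' Δ R' => .brack (L ++ L') Δ (R' ++ R)
  | .brack L Δ R, Δ' => .brack L (Δ.comp Δ') R

theorem Context.fill_comp (Δ Δ' : Context) (X : MetaFormula) :
    (Δ.comp Δ').fill X = Δ.fill (Δ'.fill X) := by
  induction Δ with
  | hole L R => cases Δ' <;> simp [Context.comp, Context.fill]
  | brack L Δ R ih => simp [Context.comp, Context.fill, ih]

/-- The closure of a set of meta-formulae: the meta-formulae that can replace the elements of the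
set in the antecedent of every family of cut-free derivable sequents. -/
def closure (G : Set MetaFormula) : Set MetaFormula :=
  {Γ | ∀ (Δ : Context) (D : Formula), (∀ X ∈ G, CutFree (Δ.fill X) D) → CutFree (Δ.fill Γ) D}

theorem subset_closure (G : Set MetaFormula) : G ⊆ closure G := fun _ h _ _ h' => h' _ h

theorem closure_closure_subset (G : Set MetaFormula) : closure (closure G) ⊆ closure G :=
  fun _ h Δ D h' => h Δ D fun _ hX => hX Δ D h'

/-- The denotation of a formula in the phase space of closed sets of meta-formulae. In the clause
for `!A`, the elements of the form `!A₁, …, !Aₙ` play the role of those that may be permuted and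
contracted. -/
def den : Formula → Set MetaFormula
  | .var i => {Γ | CutFree Γ (.var i)}
  | .one => closure {[]}
  | .ldiv A C => {Γ | ∀ Θ ∈ den A, Θ ++ Γ ∈ den C}
  | .rdiv C B => {Γ | ∀ Θ ∈ den B, Γ ++ Θ ∈ den C}
  | .prod A B => closure {Γ | ∃ Γ₁ ∈ den A, ∃ Γ₂ ∈ den B, Γ = Γ₁ ++ Γ₂}
  | .dia A => closure {Γ | ∃ Θ ∈ den A, Γ = [brack Θ]}
  | .boxInv A => {Γ | [brack Γ] ∈ den A}
  | .bang A => closure {Γ | ∃ As, Γ = bangs As ∧ bangs As ∈ den A}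

/-- In a context, a closed set absorbs closures. -/
theorem fill_mem_of_closure {G Z : Set MetaFormula} (hZ : closure Z ⊆ Z) (Δ : Context)
    (h : ∀ X ∈ G, Δ.fill X ∈ Z) {X : MetaFormula} (hX : X ∈ closure G) : Δ.fill X ∈ Z := by
  refine hZ fun Δ' D h' => ?_
  rw [← Context.fill_comp]
  refine hX _ D fun Y hY => ?_
  rw [Context.fill_comp]
  exact h' _ (h Y hY)

theorem closure_den_subset (A : Formula) : closure (den A) ⊆ den A := by
  induction A with
  | var i =>
    intro Γ h
    simpa [Context.fill, den] using h (.hole [] []) (.var i) (by simp [den, Context.fill])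
  | one | prod | dia | bang => exact closure_closure_subset _
  | ldiv A C _ ih =>
    intro Γ h Θ hΘ
    simpa [Context.fill] using fill_mem_of_closure ih (.hole Θ [])
      (fun X hX => by simpa [Context.fill] using hX Θ hΘ) h
  | rdiv C B ih _ =>
    intro Γ h Θ hΘ
    simpa [Context.fill] using fill_mem_of_closure ih (.hole [] Θ)
      (fun X hX => by simpa [Context.fill] using hX Θ hΘ) h
  | boxInv A ih =>
    intro Γ h
    have := fill_mem_of_closure ih (.brack [] (.hole [] []) [])
      (fun X hX => by simpa [Context.fill, den] using hX) h
    simpa [Context.fill, den] using this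

/-- The denotation of `A` contains `A` and consists of meta-formulae that derive `A`. -/
theorem den_adequate (A : Formula) : [form A] ∈ den A ∧ ∀ Γ ∈ den A, CutFree Γ A := by
  have hole : ∀ {G : Set MetaFormula} {A : Formula}, (∀ Γ ∈ G, CutFree Γ A) →
      ∀ Γ ∈ closure G, CutFree Γ A := fun {G A} h Γ hΓ => by
    simpa [Context.fill] using hΓ (.hole [] []) A (by simpa [Context.fill] using h)
  induction A with
  | var i => exact ⟨.ax _, fun _ h => h⟩
  | one =>
    refine ⟨fun Δ D h => .left Δ .one (h _ rfl), hole fun Γ h => ?_⟩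
    rw [Set.mem_singleton_iff.1 h]
    exact .one_right
  | ldiv A C ihA ihC =>
    refine ⟨fun Θ hΘ => closure_den_subset C fun Δ D h => ?_, fun Γ h => ?_⟩
    · exact .div Δ (.ldiv Θ A C) (ihA.2 Θ hΘ) (h _ ihC.1)
    · exact .right (.ldiv Γ A C) (ihC.2 _ (h _ ihA.1))
  | rdiv C B ihC ihB =>
    refine ⟨fun Θ hΘ => closure_den_subset C fun Δ D h => ?_, fun Γ h => ?_⟩
    · exact .div Δ (.rdiv Θ B C) (ihB.2 Θ hΘ) (h _ ihC.1)
    · exact .right (.rdiv Γ B C) (ihC.2 _ (h _ ihB.1))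
  | prod A B ihA ihB =>
    refine ⟨fun Δ D h => .left Δ (.prod A B) (h _ ⟨_, ihA.1, _, ihB.1, rfl⟩), hole ?_⟩
    rintro _ ⟨Γ₁, h₁, Γ₂, h₂, rfl⟩
    exact .prod_right (ihA.2 _ h₁) (ihB.2 _ h₂)
  | dia A ih =>
    refine ⟨fun Δ D h => .left Δ (.dia A) (h _ ⟨_, ih.1, rfl⟩), hole ?_⟩
    rintro _ ⟨Θ, hΘ, rfl⟩
    exact .right (.dia Θ A) (ih.2 _ hΘ)
  | boxInv A ih =>
    refine ⟨closure_den_subset A fun Δ D h => ?_, fun Γ h => ?_⟩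
    · exact .left Δ (.boxInv A) (h _ ih.1)
    · exact .right (.boxInv Γ A) (ih.2 _ h)
  | bang A ih =>
    refine ⟨fun Δ D h => h [form (bang A)] ⟨[A], rfl, closure_den_subset A fun Δ D h => ?_⟩,
      hole ?_⟩
    · exact .left Δ (.bang A) (h _ ih.1)
    · rintro _ ⟨As, rfl, h⟩
      exact .right (.bang As A) (ih.2 _ h)

theorem den_bang_subset (A : Formula) : den (bang A) ⊆ den A := by
  intro Γ h
  have := fill_mem_of_closure (closure_den_subset A) (.hole [] []) (X := Γ)
    (by rintro _ ⟨As, rfl, h⟩; simpa [Context.fill] using h) h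
  simpa [Context.fill] using this

/-- `Subst Γ Γ'`: the meta-formula `Γ'` arises from `Γ` by replacing each formula by an element of
its denotation. -/
inductive Subst : MetaFormula → MetaFormula → Prop
  | nil : Subst [] []
  | form {A : Formula} {X Γ Γ' : MetaFormula} :
      X ∈ den A → Subst Γ Γ' → Subst (form A :: Γ) (X ++ Γ')
  | brack {Θ Θ' Γ Γ' : MetaFormula} :
      Subst Θ Θ' → Subst Γ Γ' → Subst (brack Θ :: Γ) (brack Θ' :: Γ')

theorem Subst.append {Γ₁ Γ₁' Γ₂ Γ₂' : MetaFormula} (h₁ : Subst Γ₁ Γ₁') (h₂ : Subst Γ₂ Γ₂') :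
    Subst (Γ₁ ++ Γ₂) (Γ₁' ++ Γ₂') := by
  induction h₁ with
  | nil => exact h₂
  | form hX _ ih => rw [List.append_assoc]; exact .form hX ih
  | brack h _ _ ih => exact .brack h ih

theorem Subst.exists_append {Γ₁ Γ₂ X : MetaFormula} (h : Subst (Γ₁ ++ Γ₂) X) :
    ∃ X₁ X₂, X = X₁ ++ X₂ ∧ Subst Γ₁ X₁ ∧ Subst Γ₂ X₂ := by
  induction Γ₁ generalizing X with
  | nil => exact ⟨[], X, rfl, .nil, h⟩
  | cons I Γ₁ ih =>
    cases h with
    | form hX h =>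
      obtain ⟨X₁, X₂, rfl, h₁, h₂⟩ := ih h
      exact ⟨_, X₂, (List.append_assoc ..).symm, .form hX h₁, h₂⟩
    | brack hX h =>
      obtain ⟨X₁, X₂, rfl, h₁, h₂⟩ := ih h
      exact ⟨_, X₂, rfl, .brack hX h₁, h₂⟩

theorem subst_form_iff {A : Formula} {X : MetaFormula} : Subst [form A] X ↔ X ∈ den A := by
  constructor
  · intro h
    cases h with
    | form hX h => cases h; simpa using hX
  · intro h
    simpa using Subst.form h .nil

theorem Subst.exists_brack {Θ X : MetaFormula} (h : Subst [Item.brack Θ] X) :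
    ∃ Θ', X = [Item.brack Θ'] ∧ Subst Θ Θ' := by
  cases h with
  | brack hΘ h => cases h; exact ⟨_, rfl, hΘ⟩

theorem Subst.exists_fill {Δ : Context} {Γ X : MetaFormula} (h : Subst (Δ.fill Γ) X) :
    ∃ Δ' Γ', X = Context.fill Δ' Γ' ∧ Subst Γ Γ' ∧
      ∀ Y Y', Subst Y Y' → Subst (Δ.fill Y) (Δ'.fill Y') := by
  induction Δ generalizing X with
  | hole L R =>
    obtain ⟨X₁, R', rfl, h₁, hR⟩ := h.exists_append
    obtain ⟨L', Γ', rfl, hL, hΓ⟩ := h₁.exists_append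
    exact ⟨.hole L' R', Γ', rfl, hΓ, fun Y Y' hY => (hL.append hY).append hR⟩
  | brack L Δ R ih =>
    obtain ⟨X₁, R', rfl, h₁, hR⟩ := h.exists_append
    obtain ⟨L', X', rfl, hL, hX⟩ := h₁.exists_append
    obtain ⟨Θ', rfl, hΘ⟩ := hX.exists_brack
    obtain ⟨Δ', Γ', rfl, hΓ, hΔ⟩ := ih hΘ
    exact ⟨.brack L' Δ' R', Γ', rfl, hΓ,
      fun Y Y' hY => (hL.append (.brack (hΔ Y Y' hY) .nil)).append hR⟩

theorem bangs_append (As Bs : List Formula) : bangs (As ++ Bs) = bangs As ++ bangs Bs :=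
  List.map_append

/-- In a context of a closed set, the instances of `!A₁, …, !Aₙ` may be assumed to have the form
`!B₁, …, !Bₘ`. -/
theorem Subst.fill_mem_of_bangs {Z : Set MetaFormula} (hZ : closure Z ⊆ Z)
    {As : List Formula} {X : MetaFormula} (hX : Subst (bangs As) X) (Δ : Context)
    (h : ∀ Bs, Subst (bangs As) (bangs Bs) → Δ.fill (bangs Bs) ∈ Z) : Δ.fill X ∈ Z := by
  induction As generalizing X Δ with
  | nil => cases hX; exact h [] .nil
  | cons A As ih =>
    cases hX with
    | @form _ X _ Γ' hX hΓ =>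
      have := fill_mem_of_closure hZ (Δ.comp (.hole [] Γ')) (X := X) ?_ hX
      · simpa [Context.fill_comp, Context.fill] using this
      rintro _ ⟨Bs, rfl, hBs⟩
      have := ih hΓ (Δ.comp (.hole (bangs Bs) [])) fun Cs hCs => ?_
      · simpa [Context.fill_comp, Context.fill] using this
      have := h (Bs ++ Cs) (bangs_append Bs Cs ▸ .form (subset_closure _ ⟨Bs, rfl, hBs⟩) hCs)
      simpa [Context.fill_comp, Context.fill, bangs_append] using this

/-- The permutation rule for a whole sequence `!B₁, …, !Bₘ`. -/
theorem cutFree_bangs_right (Bs : List Formula) : ∀ (Δ : Context) (Γ : MetaFormula) (D : Formula),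
    CutFree (Δ.fill (bangs Bs ++ Γ)) D → CutFree (Δ.fill (Γ ++ bangs Bs)) D := by
  induction Bs with
  | nil => simp [bangs]
  | cons B Bs ih =>
    intro Δ Γ D h
    have h₁ := ih (Δ.comp (.hole [form (bang B)] [])) Γ D
      (by simpa [Context.fill_comp, Context.fill, bangs] using h)
    have h₂ := CutFree.perm (D := D) (Δ.comp (.hole [] (bangs Bs))) (.right B Γ)
      (by simpa [Context.fill_comp, Context.fill, bangs] using h₁)
    simpa [Context.fill_comp, Context.fill, bangs] using h₂

theorem cutFree_bangs_left (Bs : List Formula) : ∀ (Δ : Context) (Γ : MetaFormula) (D : Formula),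
    CutFree (Δ.fill (Γ ++ bangs Bs)) D → CutFree (Δ.fill (bangs Bs ++ Γ)) D := by
  induction Bs with
  | nil => simp [bangs]
  | cons B Bs ih =>
    intro Δ Γ D h
    have h₁ := CutFree.perm (D := D) (Δ.comp (.hole [] (bangs Bs))) (.left B Γ)
      (by simpa [Context.fill_comp, Context.fill, bangs] using h)
    have h₂ := ih (Δ.comp (.hole [form (bang B)] [])) Γ D
      (by simpa [Context.fill_comp, Context.fill, bangs] using h₁)
    simpa [Context.fill_comp, Context.fill, bangs] using h₂

/-- All rules, including cut, are sound for the phase space. -/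
theorem Derivable.mem_den {Γ : MetaFormula} {B : Formula} (h : Derivable Γ B) :
    ∀ X, Subst Γ X → X ∈ den B := by
  induction h with
  | ax A => exact fun X h => subst_form_iff.1 h
  | one_right => intro X h; cases h; exact subset_closure _ rfl
  | rdiv_left Δ Γ B C D _ _ ih₁ ih₂ =>
    intro X h
    obtain ⟨Δ', X, rfl, hX, hΔ⟩ := h.exists_fill
    obtain ⟨X₁, X₂, rfl, h₁, h₂⟩ := hX.exists_append
    exact ih₂ _ (hΔ _ _ (subst_form_iff.2 (subst_form_iff.1 h₁ _ (ih₁ _ h₂))))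
  | rdiv_right Γ B C _ ih => exact fun X h Θ hΘ => ih _ (h.append (subst_form_iff.2 hΘ))
  | ldiv_left Δ Γ A C D _ _ ih₁ ih₂ =>
    intro X h
    obtain ⟨Δ', X, rfl, hX, hΔ⟩ := h.exists_fill
    obtain ⟨X₁, X₂, rfl, h₁, h₂⟩ := hX.exists_append
    exact ih₂ _ (hΔ _ _ (subst_form_iff.2 (subst_form_iff.1 h₂ _ (ih₁ _ h₁))))
  | ldiv_right Γ A C _ ih => exact fun X h Θ hΘ => ih _ ((subst_form_iff.2 hΘ).append h)
  | prod_left Δ A B D _ ih =>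
    intro X h
    obtain ⟨Δ', X, rfl, hX, hΔ⟩ := h.exists_fill
    refine fill_mem_of_closure (closure_den_subset D) Δ' ?_ (subst_form_iff.1 hX)
    rintro _ ⟨X₁, h₁, X₂, h₂, rfl⟩
    exact ih _ (hΔ _ _ (.form h₁ (subst_form_iff.2 h₂)))
  | prod_right Γ₁ Γ₂ A B _ _ ih₁ ih₂ =>
    intro X h
    obtain ⟨X₁, X₂, rfl, h₁, h₂⟩ := h.exists_append
    exact subset_closure _ ⟨_, ih₁ _ h₁, _, ih₂ _ h₂, rfl⟩
  | one_left Δ D _ ih =>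
    intro X h
    obtain ⟨Δ', X, rfl, hX, hΔ⟩ := h.exists_fill
    refine fill_mem_of_closure (closure_den_subset D) Δ' ?_ (subst_form_iff.1 hX)
    rintro _ rfl
    exact ih _ (hΔ _ _ .nil)
  | dia_left Δ A D _ ih =>
    intro X h
    obtain ⟨Δ', X, rfl, hX, hΔ⟩ := h.exists_fill
    refine fill_mem_of_closure (closure_den_subset D) Δ' ?_ (subst_form_iff.1 hX)
    rintro _ ⟨Θ, hΘ, rfl⟩
    exact ih _ (hΔ _ _ (.brack (subst_form_iff.2 hΘ) .nil))
  | dia_right Γ A _ ih =>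
    intro X h
    obtain ⟨Θ, rfl, hΘ⟩ := h.exists_brack
    exact subset_closure _ ⟨Θ, ih _ hΘ, rfl⟩
  | boxInv_left Δ A D _ ih =>
    intro X h
    obtain ⟨Δ', X, rfl, hX, hΔ⟩ := h.exists_fill
    obtain ⟨Θ, rfl, hΘ⟩ := hX.exists_brack
    have hbox : Θ ∈ den (boxInv A) := subst_form_iff.1 hΘ
    exact ih _ (hΔ _ _ (subst_form_iff.2 hbox))
  | boxInv_right Γ A _ ih => exact fun X h => ih _ (.brack h .nil)
  | bang_left Δ A B _ ih =>
    intro X h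
    obtain ⟨Δ', X, rfl, hX, hΔ⟩ := h.exists_fill
    exact ih _ (hΔ _ _ (subst_form_iff.2 (den_bang_subset A (subst_form_iff.1 hX))))
  | bang_right As A _ ih =>
    intro X h
    have := h.fill_mem_of_bangs (closure_den_subset (bang A)) (.hole [] []) fun Bs hBs =>
      subset_closure _ ⟨Bs, by simp [Context.fill], ih _ hBs⟩
    simpa [Context.fill] using this
  | contr Δ As Γ B _ ih =>
    intro X h
    -- Contraction is available for instances of `!A₁, …, !Aₙ` of the form `!B₁, …, !Bₘ` only.
    obtain ⟨Δ', X, rfl, hX, hΔ⟩ := h.exists_fill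
    obtain ⟨X₁, X₂, rfl, h₁, h₂⟩ := hX.exists_append
    have := h₁.fill_mem_of_bangs (closure_den_subset B) (Δ'.comp (.hole [] X₂)) fun Bs hBs => ?_
    · simpa [Context.fill_comp, Context.fill] using this
    refine closure_den_subset B fun Δ'' D h => ?_
    have := h _ (ih _ (hΔ _ _ (hBs.append (.brack (hBs.append h₂) .nil))))
    rw [← Context.fill_comp] at this
    simpa [Context.fill_comp, Context.fill] using CutFree.left _ (.contr _ _) this
  | perm₁ Δ Γ A B _ ih =>
    intro X h
    obtain ⟨Δ', X, rfl, hX, hΔ⟩ := h.exists_fill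
    obtain ⟨X₁, X₂, rfl, h₁, h₂⟩ := hX.exists_append
    have := fill_mem_of_closure (closure_den_subset B) (Δ'.comp (.hole X₁ []))
      (fun Y hY => ?_) (subst_form_iff.1 h₂)
    · simpa [Context.fill_comp, Context.fill] using this
    obtain ⟨Bs, rfl, hBs⟩ := hY
    refine closure_den_subset B fun Δ'' D h => ?_
    have := h _ (ih _ (hΔ _ _ (.append (subst_form_iff.2 (subset_closure _ ⟨Bs, rfl, hBs⟩)) h₁)))
    rw [← Context.fill_comp] at this
    simpa [Context.fill_comp, Context.fill] using cutFree_bangs_right _ _ _ _ this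
  | perm₂ Δ Γ A B _ ih =>
    intro X h
    obtain ⟨Δ', X, rfl, hX, hΔ⟩ := h.exists_fill
    obtain ⟨X₁, X₂, rfl, h₁, h₂⟩ := hX.exists_append
    have := fill_mem_of_closure (closure_den_subset B) (Δ'.comp (.hole [] X₂))
      (fun Y hY => ?_) (subst_form_iff.1 h₁)
    · simpa [Context.fill_comp, Context.fill] using this
    obtain ⟨Bs, rfl, hBs⟩ := hY
    refine closure_den_subset B fun Δ'' D h => ?_
    have := h _ (ih _ (hΔ _ _ (.append h₂ (subst_form_iff.2 (subset_closure _ ⟨Bs, rfl, hBs⟩)))))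
    rw [← Context.fill_comp] at this
    simpa [Context.fill_comp, Context.fill] using cutFree_bangs_left _ _ _ _ this
  | cut Δ Γ A C _ _ ih₁ ih₂ =>
    intro X h
    obtain ⟨Δ', X, rfl, hX, hΔ⟩ := h.exists_fill
    exact ih₂ _ (hΔ _ _ (subst_form_iff.2 (ih₁ _ hX)))

/-- Every meta-formula is an instance of itself, since `A` belongs to the denotation of `A`. -/
theorem subst_self : ∀ Γ : MetaFormula, Subst Γ Γ
  | [] => .nil
  | .form A :: Γ => .form (den_adequate A).1 (subst_self Γ)
  | .brack Θ :: Γ => .brack (subst_self Θ) (subst_self Γ)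

/-- Cut elimination: the derivable sequents hold in the phase space, and the sequents that hold
there are derivable without cut. -/
theorem Derivable.cutFree {Γ : MetaFormula} {B : Formula} (h : Derivable Γ B) : CutFree Γ B :=
  (den_adequate B).2 Γ (h.mem_den Γ (subst_self Γ))

/-! ### Tokens and contexts -/

/-- The tokens of which a meta-formula consists. -/
inductive Tok : Type
  | form (A : Formula)
  | lb
  | rb

/-- The list of tokens of a meta-formula. -/
def flat : MetaFormula → List Tok
  | [] => []
  | .form A :: Γ => .form A :: flat Γ
  | .brack Θ :: Γ => .lb :: (flat Θ ++ .rb :: flat Γ)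
termination_by Γ => sizeOf Γ

theorem MetaFormula.induct {P : MetaFormula → Prop} (nil : P [])
    (form : ∀ A Γ, P Γ → P (.form A :: Γ)) (brack : ∀ Θ Γ, P Θ → P Γ → P (.brack Θ :: Γ)) :
    ∀ Γ, P Γ
  | [] => nil
  | .form A :: Γ => form A Γ (MetaFormula.induct nil form brack Γ)
  | .brack Θ :: Γ =>
    brack Θ Γ (MetaFormula.induct nil form brack Θ) (MetaFormula.induct nil form brack Γ)
termination_by Γ => sizeOf Γ

@[simp] theorem flat_nil : flat [] = [] := by simp [flat]
@[simp] theorem flat_form (A : Formula) (Γ : MetaFormula) :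
    flat (.form A :: Γ) = .form A :: flat Γ := by simp [flat]
@[simp] theorem flat_brack (Θ Γ : MetaFormula) :
    flat (.brack Θ :: Γ) = .lb :: (flat Θ ++ .rb :: flat Γ) := by simp [flat]

@[simp] theorem flat_append (Γ Γ' : MetaFormula) : flat (Γ ++ Γ') = flat Γ ++ flat Γ' := by
  induction Γ with
  | nil => simp
  | cons I Γ ih => cases I <;> simp [ih]

/-- The tokens of a context before its hole. -/
def Context.pre : Context → List Tok
  | .hole L _ => flat L
  | .brack L Δ _ => flat L ++ .lb :: Δ.pre

/-- The tokens of a context after its hole. -/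
def Context.post : Context → List Tok
  | .hole _ R => flat R
  | .brack _ Δ R => Δ.post ++ .rb :: flat R

theorem flat_fill (Δ : Context) (X : MetaFormula) :
    flat (Δ.fill X) = Δ.pre ++ flat X ++ Δ.post := by
  induction Δ with
  | hole L R => simp [Context.fill, Context.pre, Context.post]
  | brack L Δ R ih => simp [Context.fill, Context.pre, Context.post, ih]

/-! ### Normal forms under permutation -/

/-- The formula `A`, if the item is `!A`. -/
def Item.bang? : Item → Option Formula
  | .form (.bang A) => some A
  | _ => none

/-- The formulae `A` for which `!A` stands at the outermost level of a meta-formula. -/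
def topBangs (Γ : MetaFormula) : List Formula := Γ.filterMap Item.bang?

/-- The items other than formulae `!A`, with the contents of brackets in normal form. -/
noncomputable def nfRest : MetaFormula → MetaFormula
  | [] => []
  | .form A :: Γ => (if (form A).bang?.isSome then [] else [form A]) ++ nfRest Γ
  | .brack Θ :: Γ => .brack (bangs (Multiset.ofList (topBangs Θ)).toList ++ nfRest Θ) :: nfRest Γ
termination_by Γ => sizeOf Γ

/-- The normal form of a meta-formula under permutation of formulae `!A`: in each bracket these
formulae are collected at the front, in an order that depends on their multiset only. -/
noncomputable def nf (Γ : MetaFormula) : MetaFormula :=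
  bangs (Multiset.ofList (topBangs Γ)).toList ++ nfRest Γ

theorem nfRest_nil : nfRest [] = [] := by simp [nfRest]
theorem nfRest_form (A : Formula) (Γ : MetaFormula) : nfRest (.form A :: Γ) =
    (if (form A).bang?.isSome then [] else [form A]) ++ nfRest Γ := by rw [nfRest]
theorem nfRest_brack (Θ Γ : MetaFormula) : nfRest (.brack Θ :: Γ) = .brack (nf Θ) :: nfRest Γ := by
  rw [nfRest, nf]

theorem nfRest_append (Γ Γ' : MetaFormula) : nfRest (Γ ++ Γ') = nfRest Γ ++ nfRest Γ' := by
  induction Γ with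
  | nil => simp [nfRest_nil]
  | cons I Γ ih => cases I <;> simp [nfRest_form, nfRest_brack, ih]

theorem topBangs_append (Γ Γ' : MetaFormula) :
    topBangs (Γ ++ Γ') = topBangs Γ ++ topBangs Γ' := List.filterMap_append

/-- The normal form of a meta-formula depends on a part of it only through the multiset of the
formulae `!A` and the other items of this part. -/
theorem nf_fill {X Y : MetaFormula} (h : (topBangs X).Perm (topBangs Y)) (h' : nfRest X = nfRest Y)
    (Δ : Context) : nf (Δ.fill X) = nf (Δ.fill Y) := by
  have key : (topBangs (Δ.fill X)).Perm (topBangs (Δ.fill Y)) ∧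
      nfRest (Δ.fill X) = nfRest (Δ.fill Y) := by
    induction Δ with
    | hole L R =>
      simp only [Context.fill, topBangs_append, nfRest_append, h', and_true]
      exact (h.append_left _).append_right _
    | brack L Δ R ih =>
      have e : nf (Δ.fill X) = nf (Δ.fill Y) := by
        rw [nf, nf, ih.2, Multiset.coe_eq_coe.2 ih.1]
      simp only [Context.fill, topBangs_append, nfRest_append, nfRest_brack, e, and_true]
      exact .refl _
  rw [nf, nf, key.2, Multiset.coe_eq_coe.2 key.1]

theorem PermRule.nf_eq {X Y : MetaFormula} (h : PermRule X Y) (Δ : Context) :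
    nf (Δ.fill X) = nf (Δ.fill Y) := by
  have hb : ∀ A, nfRest [form (bang A)] = [] := fun A => by
    simp [nfRest_form, nfRest_nil, Item.bang?]
  cases h with
  | right A Γ | left A Γ =>
    refine nf_fill ?_ (by simp only [nfRest_append, hb, List.nil_append,
      List.append_nil]) Δ
    simp only [topBangs_append]
    exact List.perm_append_comm

theorem PermRule.symm {X Y : MetaFormula} (h : PermRule X Y) : PermRule Y X := by
  cases h with
  | right A Γ => exact .left A Γ
  | left A Γ => exact .right A Γ

/-- `Moves n Γ Γ'`: at most `n` applications of the permutation rules lead from `Γ` to `Γ'`. -/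
inductive Moves : ℕ → MetaFormula → MetaFormula → Prop
  | refl {n : ℕ} (Γ : MetaFormula) : Moves n Γ Γ
  | step {n : ℕ} {X Y Γ : MetaFormula} (Δ : Context) (h : PermRule X Y) :
      Moves n (Δ.fill Y) Γ → Moves (n + 1) (Δ.fill X) Γ

theorem Moves.mono {n n' : ℕ} {Γ Γ' : MetaFormula} (h : Moves n Γ Γ') (hn : n ≤ n') :
    Moves n' Γ Γ' := by
  induction h generalizing n' with
  | refl => exact .refl _
  | step Δ h _ ih =>
    obtain ⟨n', rfl⟩ := Nat.exists_eq_succ_of_ne_zero (show n' ≠ 0 by omega)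
    exact .step Δ h (ih (by omega))

theorem Moves.trans {n n' : ℕ} {Γ Γ' Γ'' : MetaFormula} (h : Moves n Γ Γ') (h' : Moves n' Γ' Γ'') :
    Moves (n + n') Γ Γ'' := by
  induction h with
  | refl => exact h'.mono (by omega)
  | step Δ h _ ih => exact (Moves.step Δ h (ih h')).mono (by omega)

theorem Moves.symm {n : ℕ} {Γ Γ' : MetaFormula} (h : Moves n Γ Γ') : Moves n Γ' Γ := by
  induction h with
  | refl => exact .refl _
  | step Δ h _ ih => exact ih.trans (.step (n := 0) Δ h.symm (.refl _))

theorem Moves.fill {n : ℕ} {Γ Γ' : MetaFormula} (h : Moves n Γ Γ') (Δ : Context) :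
    Moves n (Δ.fill Γ) (Δ.fill Γ') := by
  induction h with
  | refl => exact .refl _
  | step Δ' h _ ih =>
    rw [← Context.fill_comp] at ih ⊢
    exact .step _ h ih

theorem moves_item_bangs (I : Item) (R : MetaFormula) (l : List Formula) :
    Moves l.length (I :: (bangs l ++ R)) (bangs l ++ I :: R) := by
  induction l with
  | nil => exact .refl _
  | cons A l ih =>
    have h₁ := Moves.step (n := 0) (.hole [] (bangs l ++ R)) (.left A [I]) (.refl _)
    have h₂ := ih.fill (.hole [form (bang A)] [])
    simp only [Context.fill, List.nil_append, List.append_nil] at h₁ h₂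
    refine Moves.mono (h₁.trans ?_) (show 0 + 1 + l.length ≤ _ by simp; omega)
    simpa [bangs] using h₂

theorem moves_bangs {l l' : List Formula} (h : l.Perm l') (R : MetaFormula) :
    Moves l'.length (bangs l ++ R) (bangs l' ++ R) := by
  induction l' generalizing l with
  | nil => rw [h.eq_nil]; exact .refl _
  | cons A l' ih =>
    obtain ⟨l₁, l₂, rfl⟩ := List.append_of_mem (h.mem_iff.2 (List.mem_cons_self ..))
    have h' := ih (List.perm_cons A |>.1 (List.perm_middle.symm.trans h))
    have h₁ := Moves.step (n := 0) (.hole [] (bangs l₂ ++ R)) (.left A (bangs l₁)) (.refl _)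
    have h₂ := h'.fill (.hole [form (bang A)] [])
    refine (Moves.mono (Moves.trans ?_ h₂) (show 0 + 1 + l'.length ≤ _ by simp; omega)).trans
      (n' := 0) ?_
    · simpa [Context.fill, bangs] using h₁
    · simpa [Context.fill, bangs] using Moves.refl _

theorem length_topBangs_le (Γ : MetaFormula) : (topBangs Γ).length ≤ (flat Γ).length := by
  induction Γ with
  | nil => simp [topBangs]
  | cons I Γ ih =>
    rw [topBangs, List.filterMap_cons]
    cases I with
    | form A => split <;> simp [topBangs] at ih ⊢ <;> omega
    | brack Θ => simp [Item.bang?, topBangs] at ih ⊢; omega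

/-- Insertion sort: each item is moved past the formulae `!A` to its right. -/
theorem moves_nf (Γ : MetaFormula) : Moves ((flat Γ).length ^ 2) Γ (nf Γ) := by
  induction Γ using MetaFormula.induct with
  | nil => simpa [nf, topBangs, nfRest_nil, bangs] using Moves.refl _
  | form A Γ ih =>
    have hl := length_topBangs_le Γ
    rcases hA : (form A).bang? with _ | B
    · have h := (ih.fill (.hole [form A] [])).trans
        (n' := (topBangs Γ).length) (Γ'' := nf (form A :: Γ)) ?_
      · refine Moves.mono (by simpa [Context.fill] using h) ?_
        rw [flat_form, List.length_cons]
        nlinarith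
      · have := moves_item_bangs (form A) (nfRest Γ) (Multiset.ofList (topBangs Γ)).toList
        simpa [Context.fill, nf, nfRest_form, hA, topBangs, List.filterMap_cons] using this
    · obtain rfl : A = bang B := by
        cases A <;> simp_all [Item.bang?]
      have h := (ih.fill (.hole [form (bang B)] [])).trans
        (n' := (topBangs Γ).length + 1) (Γ'' := nf (form (bang B) :: Γ)) ?_
      · refine Moves.mono (by simpa [Context.fill] using h) ?_
        rw [flat_form, List.length_cons]
        nlinarith
      · have e : topBangs (form (bang B) :: Γ) = B :: topBangs Γ := rfl
        have := moves_bangs (l := B :: (Multiset.ofList (topBangs Γ)).toList)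
          (l' := (Multiset.ofList (topBangs (form (bang B) :: Γ))).toList) ?_ (nfRest Γ)
        · simpa [Context.fill, nf, nfRest_form, hA, e, bangs] using this
        · rw [← Multiset.coe_eq_coe, Multiset.coe_toList, ← Multiset.cons_coe, Multiset.coe_toList,
            e, Multiset.cons_coe]
  | brack Θ Γ ihΘ ih =>
    have hl := length_topBangs_le Γ
    have h₁ : Moves ((flat Θ).length ^ 2) (brack Θ :: Γ) (brack (nf Θ) :: Γ) := by
      simpa [Context.fill] using ihΘ.fill (.brack [] (.hole [] []) Γ)
    have h₂ : Moves ((flat Γ).length ^ 2) (brack (nf Θ) :: Γ) (brack (nf Θ) :: nf Γ) := by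
      simpa [Context.fill] using ih.fill (.hole [brack (nf Θ)] [])
    have h := (h₁.trans h₂).trans (n' := (topBangs Γ).length) (Γ'' := nf (brack Θ :: Γ)) ?_
    · refine Moves.mono (by simpa [Context.fill] using h) ?_
      simp only [flat_brack, List.length_cons, List.length_append]
      generalize (flat Θ).length = a at *
      have := Nat.zero_le (a * (flat Γ).length)
      nlinarith
    · have := moves_item_bangs (brack (nf Θ)) (nfRest Γ) (Multiset.ofList (topBangs Γ)).toList
      simpa [Context.fill, nf, nfRest_brack, topBangs, List.filterMap_cons, Item.bang?] using this

theorem PermRule.flat_perm {X Y : MetaFormula} (h : PermRule X Y) : (flat X).Perm (flat Y) := by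
  cases h <;> simp only [flat_append] <;> exact List.perm_append_comm

/-- In particular, permutations preserve all sums over tokens. -/
theorem Moves.flat_perm {n : ℕ} {Γ Γ' : MetaFormula} (h : Moves n Γ Γ') :
    (flat Γ).Perm (flat Γ') := by
  induction h with
  | refl => exact .refl _
  | step Δ h _ ih =>
    refine List.Perm.trans ?_ ih
    rw [flat_fill, flat_fill]
    exact (h.flat_perm.append_left _).append_right _

/-- Meta-formulae with the same normal form are connected by quadratically many permutations. -/
theorem moves_of_nf_eq {Γ Γ' : MetaFormula} (h : nf Γ = nf Γ') :
    Moves (2 * (flat Γ).length ^ 2) Γ Γ' := by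
  have h₁ := moves_nf Γ
  have h₂ := moves_nf Γ'
  have e : (flat Γ).length = (flat Γ').length := by
    rw [h₁.flat_perm.length_eq, h₂.flat_perm.length_eq, h]
  rw [← h, ← e] at h₂
  rw [two_mul]
  exact h₁.trans h₂.symm

/-! ### Measures of formulae and meta-formulae -/

/-- The length of the word of a formula. -/
def Formula.len (A : Formula) : ℕ := A.encode.length

@[simp] theorem len_one : one.len = 1 := rfl
@[simp] theorem len_ldiv (A C : Formula) : (ldiv A C).len = A.len + C.len + 1 := by
  simp [Formula.len, Formula.encode]
@[simp] theorem len_rdiv (C B : Formula) : (rdiv C B).len = C.len + B.len + 1 := by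
  simp [Formula.len, Formula.encode]
@[simp] theorem len_prod (A B : Formula) : (prod A B).len = A.len + B.len + 1 := by
  simp [Formula.len, Formula.encode]
@[simp] theorem len_dia (A : Formula) : (dia A).len = A.len + 1 := rfl
@[simp] theorem len_boxInv (A : Formula) : (boxInv A).len = A.len + 1 := rfl
@[simp] theorem len_bang (A : Formula) : (bang A).len = A.len + 1 := rfl

theorem Formula.len_pos (A : Formula) : 0 < A.len := by
  obtain ⟨s, w, h, -⟩ := A.encode_head
  simp [Formula.len, h]

/-- The number of bracket consumers in an occurrence of polarity `p` of a formula in a sequent: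
the negative occurrences of `[]⁻¹C` and the positive occurrences of `⟨⟩C`. Bottom-up, these are the
formulae whose rules remove a pair of brackets. -/
def Formula.eat : Bool → Formula → ℕ
  | _, .var _ => 0
  | _, .one => 0
  | p, .ldiv A C => A.eat (!p) + C.eat p
  | p, .rdiv C B => C.eat p + B.eat (!p)
  | p, .prod A B => A.eat p + B.eat p
  | p, .dia A => p.toNat + A.eat p
  | p, .boxInv A => (!p).toNat + A.eat p
  | p, .bang A => A.eat p

/-- The bracket non-negative condition for an occurrence of polarity `p` of a formula. -/
def Formula.Safe : Bool → Formula → Prop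
  | _, .var _ => True
  | _, .one => True
  | p, .ldiv A C => A.Safe (!p) ∧ C.Safe p
  | p, .rdiv C B => C.Safe p ∧ B.Safe (!p)
  | p, .prod A B => A.Safe p ∧ B.Safe p
  | p, .dia A => A.Safe p
  | p, .boxInv A => A.Safe p
  | p, .bang A => (p = false → A.eat p = 0) ∧ A.Safe p

theorem eat_le_len (p : Bool) (A : Formula) : A.eat p ≤ A.len := by
  induction A generalizing p with
  | var | one => simp [Formula.eat]
  | ldiv A C ihA ihC => have := ihA (!p); have := ihC p; simp [Formula.eat]; omega
  | rdiv C B ihC ihB => have := ihB (!p); have := ihC p; simp [Formula.eat]; omega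
  | prod A B ihA ihB => have := ihA p; have := ihB p; simp [Formula.eat]; omega
  | dia A ih | boxInv A ih => have := ih p; cases p <;> simp [Formula.eat] at this ⊢ <;> omega
  | bang A ih => have := ih p; simp [Formula.eat]; omega

/-- The length of a formula that contains bracket consumers, and 0 for other formulae. -/
def Formula.heavy (p : Bool) (A : Formula) : ℕ := if A.eat p = 0 then 0 else A.len

/-- The length of a formula that contains no bracket consumers, and 0 for other formulae. -/
def Formula.light (p : Bool) (A : Formula) : ℕ := if A.eat p = 0 then A.len else 0

theorem heavy_light (p : Bool) (A : Formula) :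
    (A.eat p = 0 ∧ A.heavy p = 0 ∧ A.light p = A.len) ∨
      (0 < A.eat p ∧ A.heavy p = A.len ∧ A.light p = 0) := by
  unfold Formula.heavy Formula.light
  split <;> omega

/-- The weight of a token; that of a pair of brackets is assigned to its left bracket. -/
def Tok.weight (f : Formula → ℕ) (g : ℕ) : Tok → ℕ
  | .form A => f A
  | .lb => g
  | .rb => 0

/-- The sum of the weights `f A` of all formulae in a meta-formula and of the weight `g` of each
pair of brackets. -/
def total (f : Formula → ℕ) (g : ℕ) (Γ : MetaFormula) : ℕ := ((flat Γ).map (Tok.weight f g)).sum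

section

variable (f : Formula → ℕ) (g : ℕ)

@[simp] theorem total_nil : total f g [] = 0 := by simp [total]
@[simp] theorem total_form (A : Formula) (Γ : MetaFormula) :
    total f g (.form A :: Γ) = f A + total f g Γ := by simp [total, Tok.weight]
@[simp] theorem total_brack (Θ Γ : MetaFormula) :
    total f g (.brack Θ :: Γ) = g + total f g Θ + total f g Γ := by
  simp [total, Tok.weight]; omega
@[simp] theorem total_append (Γ Γ' : MetaFormula) :
    total f g (Γ ++ Γ') = total f g Γ + total f g Γ' := by simp [total]

theorem total_fill (Δ : Context) (X : MetaFormula) :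
    total f g (Δ.fill X) = total f g (Δ.fill []) + total f g X := by
  simp [total, flat_fill]; omega

/-- The contribution of the brackets can be split off. -/
theorem total_bracket_weight (Γ : MetaFormula) :
    total f g Γ = total f 0 Γ + g * total (fun _ => 0) 1 Γ := by
  induction Γ using MetaFormula.induct with
  | nil => simp
  | form A Γ ih => simp [ih]; ring
  | brack Θ Γ ihΘ ih => simp [ihΘ, ih]; ring

theorem total_eq_of_perm {Γ Γ' : MetaFormula} (h : (flat Γ).Perm (flat Γ')) :
    total f g Γ = total f g Γ' := (h.map _).sum_eq

end

/-- All formulae in an antecedent satisfy the bracket non-negative condition. -/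
def SafeAnte (Γ : MetaFormula) : Prop := ∀ A, Tok.form A ∈ flat Γ → A.Safe false

@[simp] theorem safeAnte_nil : SafeAnte [] := by simp [SafeAnte]
@[simp] theorem safeAnte_form (A : Formula) (Γ : MetaFormula) :
    SafeAnte (.form A :: Γ) ↔ A.Safe false ∧ SafeAnte Γ := by
  simp [SafeAnte, or_imp, forall_and]
@[simp] theorem safeAnte_brack (Θ Γ : MetaFormula) :
    SafeAnte (.brack Θ :: Γ) ↔ SafeAnte Θ ∧ SafeAnte Γ := by
  simp [SafeAnte, or_imp, forall_and]
@[simp] theorem safeAnte_append (Γ Γ' : MetaFormula) :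
    SafeAnte (Γ ++ Γ') ↔ SafeAnte Γ ∧ SafeAnte Γ' := by
  simp [SafeAnte, or_imp, forall_and]
theorem safeAnte_fill (Δ : Context) (X : MetaFormula) :
    SafeAnte (Δ.fill X) ↔ SafeAnte (Δ.fill []) ∧ SafeAnte X := by
  simp only [SafeAnte, flat_fill, List.mem_append, or_imp, forall_and, flat_nil, List.not_mem_nil]
  tauto

/-- The total length of the light formulae at the outermost level of an antecedent. -/
def topLight : MetaFormula → ℕ
  | [] => 0
  | .form A :: Γ => A.light false + topLight Γ
  | .brack _ :: Γ => topLight Γ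

/-- The maximum of `topLight` over the brackets of an antecedent. -/
def maxLight : MetaFormula → ℕ
  | [] => 0
  | .form _ :: Γ => maxLight Γ
  | .brack Θ :: Γ => max (max (topLight Θ) (maxLight Θ)) (maxLight Γ)
termination_by Γ => sizeOf Γ

@[simp] theorem maxLight_nil : maxLight [] = 0 := by simp [maxLight]
@[simp] theorem maxLight_form (A : Formula) (Γ : MetaFormula) :
    maxLight (.form A :: Γ) = maxLight Γ := by simp [maxLight]
@[simp] theorem maxLight_brack (Θ Γ : MetaFormula) : maxLight (.brack Θ :: Γ) =
    max (max (topLight Θ) (maxLight Θ)) (maxLight Γ) := by simp [maxLight]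

@[simp] theorem topLight_append (Γ Γ' : MetaFormula) :
    topLight (Γ ++ Γ') = topLight Γ + topLight Γ' := by
  induction Γ with
  | nil => simp [topLight]
  | cons I Γ ih => cases I <;> simp [topLight, ih]; omega

@[simp] theorem maxLight_append (Γ Γ' : MetaFormula) :
    maxLight (Γ ++ Γ') = max (maxLight Γ) (maxLight Γ') := by
  induction Γ with
  | nil => simp
  | cons I Γ ih => cases I <;> simp [ih, max_assoc]

/-- A local change of an antecedent that does not increase the light weight of any level by more
than the decrease `h' - h` of a second quantity. -/
theorem light_fill_le {X Y : MetaFormula} {h h' : ℕ} (hh : h ≤ h')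
    (h₁ : topLight X + h ≤ topLight Y + h')
    (h₂ : maxLight X + h ≤ max (topLight Y) (maxLight Y) + h') (Δ : Context) :
    topLight (Δ.fill X) + h ≤ topLight (Δ.fill Y) + h' ∧
      maxLight (Δ.fill X) + h ≤ max (topLight (Δ.fill Y)) (maxLight (Δ.fill Y)) + h' := by
  induction Δ with
  | hole L R => simp only [Context.fill, topLight_append, maxLight_append]; omega
  | brack L Δ R ih =>
    simp only [Context.fill, topLight_append, maxLight_append, topLight, maxLight_brack,
      maxLight_nil]
    omega

/-- The light weights of the levels of a part of an antecedent are bounded by those of the whole. -/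
theorem light_le_fill (Δ : Context) (Y : MetaFormula) :
    topLight Y ≤ max (topLight (Δ.fill Y)) (maxLight (Δ.fill Y)) ∧
      maxLight Y ≤ maxLight (Δ.fill Y) := by
  induction Δ with
  | hole L R => simp only [Context.fill, topLight_append, maxLight_append]; omega
  | brack L Δ R ih =>
    simp only [Context.fill, topLight_append, maxLight_append, topLight, maxLight_brack,
      maxLight_nil]
    omega

/-- The formulae `!A` of an antecedent that obeys the bracket non-negative condition are light. -/
theorem bangs_light {As : List Formula} (h : SafeAnte (bangs As)) :
    topLight (bangs As) = total len 0 (bangs As) ∧ maxLight (bangs As) = 0 ∧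
      total (eat false) 0 (bangs As) = 0 ∧ total (heavy false) 0 (bangs As) = 0 ∧
      total (fun _ => 0) 1 (bangs As) = 0 := by
  induction As with
  | nil => simp [bangs, topLight]
  | cons A As ih =>
    simp only [bangs, List.map_cons, safeAnte_form, Formula.Safe, forall_const] at h ih ⊢
    obtain ⟨⟨h₁, -⟩, h₂⟩ := h
    obtain ⟨i₁, i₂, i₃, i₄, i₅⟩ := ih h₂
    simp [topLight, i₁, i₂, i₃, i₄, i₅, light, heavy, eat, h₁]

/-- The effect of a unary left rule, read from the conclusion `Y` to the premise `X`, on the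
measures; `k` is 1 for contraction and 0 for other rules. -/
theorem LeftRule.measure {X Y : MetaFormula} (h : LeftRule X Y) (hY : SafeAnte Y) :
    SafeAnte X ∧ ∃ k, (k = 0 ∨ k = 1) ∧
      total len 0 X + 1 ≤ total len 0 Y + k * (topLight Y + 1) ∧
      total (fun _ => 0) 1 Y + total (eat false) 0 X + k ≤
        total (eat false) 0 Y + total (fun _ => 0) 1 X ∧
      total (eat false) 0 X ≤ total (eat false) 0 Y ∧
      total (heavy false) 0 X ≤ total (heavy false) 0 Y ∧
      topLight X + total (heavy false) 0 X ≤ topLight Y + total (heavy false) 0 Y ∧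
      maxLight X + total (heavy false) 0 X ≤
        max (topLight Y) (maxLight Y) + total (heavy false) 0 Y := by
  cases h with
  | prod A B =>
    refine ⟨by simpa [Formula.Safe] using hY, 0, .inl rfl, ?_⟩
    have := heavy_light false A
    have := heavy_light false B
    have h₀ := heavy_light false (.prod A B)
    simp [topLight, Formula.eat] at h₀ ⊢
    omega
  | one => exact ⟨by simp, 0, .inl rfl, by simp [topLight, Formula.eat]⟩
  | dia A =>
    refine ⟨by simpa [Formula.Safe] using hY, 0, .inl rfl, ?_⟩
    have := heavy_light false A
    have h₀ := heavy_light false (.dia A)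
    simp [topLight, Formula.eat] at h₀ ⊢
    omega
  | boxInv A =>
    refine ⟨by simpa [Formula.Safe] using hY, 0, .inl rfl, ?_⟩
    have := heavy_light false A
    have h₀ := heavy_light false (.boxInv A)
    simp [topLight, Formula.eat] at h₀ ⊢
    omega
  | bang A =>
    simp [Formula.Safe] at hY
    refine ⟨by simpa using hY.2, 0, .inl rfl, ?_⟩
    have := heavy_light false A
    have h₀ := heavy_light false (.bang A)
    simp [topLight, Formula.eat] at h₀ ⊢
    omega
  | contr As Γ =>
    rw [safeAnte_append] at hY
    -- The new copies of the contracted formulae are light, and they stand at another level.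
    obtain ⟨i₁, i₂, i₃, i₄, i₅⟩ := bangs_light hY.1
    refine ⟨by simpa using hY, 1, .inr rfl, ?_⟩
    simp only [total_append, total_brack, total_nil, topLight_append, maxLight_append, topLight,
      maxLight_brack, maxLight_nil]
    omega

/-- The effect of a left rule of a division on the measures. -/
theorem DivRule.measure {Γ Y : MetaFormula} {A C : Formula} (h : DivRule Γ A C Y)
    (hY : SafeAnte Y) :
    (SafeAnte Γ ∧ A.Safe true ∧ C.Safe false) ∧
      total len 0 Γ + A.len + C.len + 1 = total len 0 Y ∧
      total (fun _ => 0) 1 Γ = total (fun _ => 0) 1 Y ∧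
      total (eat false) 0 Γ + A.eat true + C.eat false = total (eat false) 0 Y ∧
      total (heavy false) 0 Γ + A.heavy true + C.heavy false ≤ total (heavy false) 0 Y ∧
      topLight Γ + A.light true + C.light false + total (heavy false) 0 Γ + A.heavy true +
        C.heavy false ≤ topLight Y + total (heavy false) 0 Y ∧
      maxLight Γ = maxLight Y := by
  cases h with
  | rdiv =>
    simp only [safeAnte_append, safeAnte_form, Formula.Safe] at hY
    refine ⟨⟨hY.2, hY.1.1.2, hY.1.1.1⟩, ?_⟩
    have := heavy_light false C
    have := heavy_light true A
    have h₀ := heavy_light false (.rdiv C A)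
    simp [topLight, Formula.eat] at h₀ ⊢
    omega
  | ldiv =>
    simp only [safeAnte_append, safeAnte_form, Formula.Safe] at hY
    refine ⟨⟨hY.1, hY.2.1⟩, ?_⟩
    have := heavy_light false C
    have := heavy_light true A
    have h₀ := heavy_light false (.ldiv A C)
    simp [topLight, Formula.eat] at h₀ ⊢
    omega

/-- The effect of a unary right rule on the measures. -/
theorem RightRule.measure {Γ Γ' : MetaFormula} {B B' : Formula} (h : RightRule Γ B Γ' B')
    (hΓ : SafeAnte Γ') (hB : B'.Safe true) :
    (SafeAnte Γ ∧ B.Safe true) ∧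
      total len 0 Γ + B.len + 1 = total len 0 Γ' + B'.len ∧
      total (fun _ => 0) 1 Γ' + total (eat false) 0 Γ + B.eat true ≤
        total (eat false) 0 Γ' + B'.eat true + total (fun _ => 0) 1 Γ ∧
      total (eat false) 0 Γ + B.eat true ≤ total (eat false) 0 Γ' + B'.eat true ∧
      topLight Γ + B.light true + total (heavy false) 0 Γ + B.heavy true ≤
        max (topLight Γ' + B'.light true) (maxLight Γ') + total (heavy false) 0 Γ' +
          B'.heavy true ∧
      maxLight Γ + total (heavy false) 0 Γ + B.heavy true ≤
        max (topLight Γ' + B'.light true) (maxLight Γ') + total (heavy false) 0 Γ' +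
          B'.heavy true := by
  have hl := heavy_light true B
  have hl' := heavy_light true B'
  cases h with
  | rdiv Γ B C =>
    have hl'' := heavy_light false B
    simp [topLight, Formula.eat, Formula.Safe] at hl hl' hB ⊢
    exact ⟨⟨⟨hΓ, hB.2⟩, hB.1⟩, by omega⟩
  | ldiv Γ A C =>
    have hl'' := heavy_light false A
    simp [topLight, Formula.eat, Formula.Safe] at hl hl' hB ⊢
    exact ⟨⟨⟨hB.1, hΓ⟩, hB.2⟩, by omega⟩
  | dia Γ A =>
    simp [topLight, Formula.eat, Formula.Safe] at hl hl' hB hΓ ⊢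
    exact ⟨⟨hΓ, hB⟩, by omega⟩
  | boxInv Γ A =>
    simp [topLight, Formula.eat, Formula.Safe] at hl hl' hB hΓ ⊢
    exact ⟨⟨hΓ, hB⟩, by omega⟩
  | bang As A =>
    simp [Formula.eat, Formula.Safe] at hl hl' hB ⊢
    exact ⟨⟨hΓ, hB⟩, by omega⟩

/-! ### Polynomial bounds for cut-free derivations -/

/-- The length of the word of the sequent `Γ → B`. -/
def seqSize (Γ : MetaFormula) (B : Formula) : ℕ := total len 2 Γ + B.len + 1

/-- Cut-free derivations with at most `n` rule applications other than permutations, in which the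
words of all sequents have length at most `s`. -/
inductive BoundedProof (s : ℕ) : ℕ → MetaFormula → Formula → Prop
  | ax (A : Formula) : seqSize [form A] A ≤ s → BoundedProof s 1 [form A] A
  | one_right : seqSize [] one ≤ s → BoundedProof s 1 [] one
  | left {n : ℕ} {X Y : MetaFormula} {D : Formula} (Δ : Context) (h : LeftRule X Y) :
      seqSize (Δ.fill Y) D ≤ s → BoundedProof s n (Δ.fill X) D →
      BoundedProof s (n + 1) (Δ.fill Y) D
  | perm {n : ℕ} {Γ Γ' : MetaFormula} {D : Formula} : nf Γ = nf Γ' →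
      BoundedProof s n Γ D → BoundedProof s n Γ' D
  | div {n₁ n₂ : ℕ} {Γ Y : MetaFormula} {A C D : Formula} (Δ : Context) (h : DivRule Γ A C Y) :
      seqSize (Δ.fill Y) D ≤ s → BoundedProof s n₁ Γ A → BoundedProof s n₂ (Δ.fill [form C]) D →
      BoundedProof s (n₁ + n₂ + 1) (Δ.fill Y) D
  | right {n : ℕ} {Γ Γ' : MetaFormula} {B B' : Formula} (h : RightRule Γ B Γ' B') :
      seqSize Γ' B' ≤ s → BoundedProof s n Γ B → BoundedProof s (n + 1) Γ' B'
  | prod_right {n₁ n₂ : ℕ} {Γ₁ Γ₂ : MetaFormula} {A B : Formula} :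
      seqSize (Γ₁ ++ Γ₂) (prod A B) ≤ s → BoundedProof s n₁ Γ₁ A → BoundedProof s n₂ Γ₂ B →
      BoundedProof s (n₁ + n₂ + 1) (Γ₁ ++ Γ₂) (prod A B)

theorem seqSize_eq (Γ : MetaFormula) (B : Formula) :
    seqSize Γ B = total len 0 Γ + 2 * total (fun _ => 0) 1 Γ + B.len + 1 := by
  rw [seqSize, total_bracket_weight]

/-- Permutations do not change the light weight of any level. -/
theorem PermRule.light_eq {X Y : MetaFormula} (h : PermRule X Y) :
    topLight X = topLight Y ∧ maxLight X = maxLight Y := by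
  cases h <;> simp [topLight, Nat.add_comm]

/-- The number `K` of contractions of a cut-free derivation is bounded by the number of bracket
consumers of the sequent, less its brackets. If `M` bounds the weight of the light formulae at each
level plus that of the heavy formulae, which is never increased when rules are read bottom-up, then
each contraction adds at most `M` to the total length of the formulae. -/
theorem CutFree.bounded {Γ : MetaFormula} {B : Formula} (h : CutFree Γ B) :
    SafeAnte Γ → B.Safe true →
    ∃ K, K + total (fun _ => 0) 1 Γ ≤ total (eat false) 0 Γ + B.eat true ∧
      ∀ M s, topLight Γ + B.light true + total (heavy false) 0 Γ + B.heavy true ≤ M →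
        maxLight Γ + total (heavy false) 0 Γ + B.heavy true ≤ M →
        total len 0 Γ + B.len + K * M + 2 * (total (eat false) 0 Γ + B.eat true) + 1 ≤ s →
        ∃ n ≤ total len 0 Γ + B.len + K * (M + 1), BoundedProof s n Γ B := by
  induction h with
  | ax A =>
    refine fun _ _ => ⟨0, by simp, fun M s _ _ hs => ⟨1, ?_, .ax A ?_⟩⟩
    · have := A.len_pos; omega
    · rw [seqSize_eq]; simp at hs ⊢; omega
  | one_right =>
    refine fun _ _ => ⟨0, by simp, fun M s _ _ hs => ⟨1, by simp, .one_right ?_⟩⟩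
    rw [seqSize_eq]; simp at hs ⊢; omega
  | @left X Y D Δ h _ ih =>
    intro hΓ hD
    rw [safeAnte_fill] at hΓ
    obtain ⟨hX, k, hk, m₁, m₂, m₃, m₄, m₅, m₆⟩ := h.measure hΓ.2
    obtain ⟨K, hK, ih⟩ := ih ((safeAnte_fill Δ X).2 ⟨hΓ.1, hX⟩) hD
    have lX := light_fill_le m₄ m₅ m₆ Δ
    have lY := light_le_fill Δ Y
    rw [total_fill _ _ Δ X, total_fill _ _ Δ X] at hK
    simp only [total_fill _ _ Δ X, total_fill _ _ Δ Y] at ih ⊢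
    refine ⟨K + k, by omega, fun M s hM₁ hM₂ hs => ?_⟩
    have hkY : k * (topLight Y + 1) ≤ k * (M + 1) := Nat.mul_le_mul_left _ (by omega)
    rw [add_mul] at hs ⊢
    have hkM : k * (M + 1) = k * M + k := by ring
    obtain ⟨n, hn, hp⟩ := ih M s (by omega) (by omega) (by omega)
    refine ⟨n + 1, by omega, .left Δ h ?_ hp⟩
    rw [seqSize_eq, total_fill _ _ Δ Y, total_fill _ _ Δ Y]
    omega
  | @perm X Y D Δ h _ ih =>
    have e : ∀ f g, total f g (Δ.fill X) = total f g (Δ.fill Y) := fun f g => by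
      rw [total_fill, total_fill _ _ Δ Y, total_eq_of_perm _ _ h.flat_perm]
    have hS : SafeAnte (Δ.fill Y) ↔ SafeAnte (Δ.fill X) := by
      rw [safeAnte_fill, safeAnte_fill Δ X, SafeAnte, SafeAnte, SafeAnte]
      simp only [h.flat_perm.mem_iff]
    have l := light_fill_le (X := X) (Y := Y) (le_refl 0) (by rw [h.light_eq.1])
      (by rw [h.light_eq.2]; omega) Δ
    rw [hS]
    intro hΓ hD
    obtain ⟨K, hK, ih⟩ := ih hΓ hD
    simp only [e] at hK ih
    refine ⟨K, hK, fun M s hM₁ hM₂ hs => ?_⟩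
    obtain ⟨n, hn, hp⟩ := ih M s (by omega) (by omega) hs
    exact ⟨n, hn, .perm (h.nf_eq Δ) hp⟩
  | @div Γ Y A C D Δ h _ _ ih₁ ih₂ =>
    intro hΓ hD
    rw [safeAnte_fill] at hΓ
    obtain ⟨⟨s₁, s₂, s₃⟩, m₁, m₂, m₃, m₄, m₅, m₆⟩ := h.measure hΓ.2
    obtain ⟨K₁, hK₁, ih₁⟩ := ih₁ s₁ s₂
    obtain ⟨K₂, hK₂, ih₂⟩ := ih₂ ((safeAnte_fill Δ [form C]).2 ⟨hΓ.1, by simpa using s₃⟩) hD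
    have lX := light_fill_le (X := [form C]) (Y := Y)
      (h := total (heavy false) 0 [form C]) (h' := total (heavy false) 0 Y)
      (by simp; omega) (by simp [topLight]; omega) (by simp; omega) Δ
    have lY := light_le_fill Δ Y
    rw [total_fill _ _ Δ [form C], total_fill _ _ Δ [form C]] at hK₂
    simp only [total_fill _ _ Δ [form C], total_fill _ _ Δ Y] at ih₂ ⊢
    simp only [total_form, total_nil, add_zero] at hK₂ ih₂ lX
    refine ⟨K₁ + K₂, by omega, fun M s hM₁ hM₂ hs => ?_⟩
    rw [add_mul] at hs ⊢
    have hKM₁ : K₁ * (M + 1) = K₁ * M + K₁ := by ring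
    have hKM₂ : K₂ * (M + 1) = K₂ * M + K₂ := by ring
    obtain ⟨n₁, hn₁, hp₁⟩ := ih₁ M s (by omega) (by omega) (by omega)
    obtain ⟨n₂, hn₂, hp₂⟩ := ih₂ M s (by omega) (by omega) (by omega)
    refine ⟨n₁ + n₂ + 1, by omega, .div Δ h ?_ hp₁ hp₂⟩
    rw [seqSize_eq, total_fill _ _ Δ Y, total_fill _ _ Δ Y]
    omega
  | @right Γ Γ' B B' h _ ih =>
    intro hΓ hB
    obtain ⟨⟨s₁, s₂⟩, m₁, m₂, m₃, m₄, m₅⟩ := h.measure hΓ hB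
    obtain ⟨K, hK, ih⟩ := ih s₁ s₂
    refine ⟨K, by omega, fun M s hM₁ hM₂ hs => ?_⟩
    obtain ⟨n, hn, hp⟩ := ih M s (by omega) (by omega) (by omega)
    refine ⟨n + 1, by omega, .right h ?_ hp⟩
    rw [seqSize_eq]
    omega
  | @prod_right Γ₁ Γ₂ A B _ _ ih₁ ih₂ =>
    intro hΓ hB
    rw [safeAnte_append] at hΓ
    obtain ⟨K₁, hK₁, ih₁⟩ := ih₁ hΓ.1 hB.1
    obtain ⟨K₂, hK₂, ih₂⟩ := ih₂ hΓ.2 hB.2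
    have l₁ := heavy_light true A
    have l₂ := heavy_light true B
    have l₃ := heavy_light true (.prod A B)
    simp only [len_prod, eat] at l₃
    simp only [total_append, topLight_append, maxLight_append, len_prod, eat]
    refine ⟨K₁ + K₂, by omega, fun M s hM₁ hM₂ hs => ?_⟩
    rw [add_mul] at hs ⊢
    obtain ⟨n₁, hn₁, hp₁⟩ := ih₁ M s (by omega) (by omega) (by omega)
    obtain ⟨n₂, hn₂, hp₂⟩ := ih₂ M s (by omega) (by omega) (by omega)
    refine ⟨n₁ + n₂ + 1, by omega, .prod_right ?_ hp₁ hp₂⟩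
    rw [seqSize_eq, total_append, total_append, len_prod]
    omega

theorem topLight_maxLight_le (Γ : MetaFormula) :
    topLight Γ + maxLight Γ + total (heavy false) 0 Γ ≤ total len 0 Γ := by
  induction Γ using MetaFormula.induct with
  | nil => simp [topLight]
  | form A Γ ih => have := heavy_light false A; simp [topLight]; omega
  | brack Θ Γ ihΘ ih => simp [topLight]; omega

theorem total_eat_le (Γ : MetaFormula) : total (eat false) 0 Γ ≤ total len 0 Γ := by
  induction Γ using MetaFormula.induct with
  | nil => simp
  | form A Γ ih => have := eat_le_len false A; simp; omega
  | brack Θ Γ ihΘ ih => simp; omega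

/-- Derivable sequents that obey the bracket non-negative condition have derivations of polynomial
size. -/
theorem Derivable.boundedProof {Γ : MetaFormula} {B : Formula} (h : Derivable Γ B)
    (hΓ : SafeAnte Γ) (hB : B.Safe true) {N : ℕ} (hN : seqSize Γ B ≤ N) :
    ∃ n ≤ (N + 2) ^ 2, BoundedProof ((N + 2) ^ 2) n Γ B := by
  obtain ⟨K, hK, h⟩ := h.cutFree.bounded hΓ hB
  rw [seqSize_eq] at hN
  have h₁ := topLight_maxLight_le Γ
  have h₂ := total_eat_le Γ
  have h₃ := eat_le_len true B
  have h₄ := heavy_light true B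
  have hKN : K ≤ N := by omega
  -- The length of the conclusion serves as the bound `M` on the weight of one level.
  obtain ⟨n, hn, hp⟩ := h N ((N + 2) ^ 2) (by omega) (by omega) (by nlinarith)
  exact ⟨n, by nlinarith, hp⟩

/-! ### The bracket non-negative condition -/

theorem occursIn_var_iff {q : Bool} {F : Formula} {i : ℕ} :
    OccursIn q F (var i) ↔ q = true ∧ F = var i :=
  ⟨fun h => by cases h; simp, by rintro ⟨rfl, rfl⟩; exact .refl _⟩

theorem occursIn_one_iff {q : Bool} {F : Formula} :
    OccursIn q F one ↔ q = true ∧ F = one :=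
  ⟨fun h => by cases h; simp, by rintro ⟨rfl, rfl⟩; exact .refl _⟩

theorem occursIn_ldiv_iff {q : Bool} {F A C : Formula} : OccursIn q F (ldiv A C) ↔
    (q = true ∧ F = ldiv A C) ∨ OccursIn (!q) F A ∨ OccursIn q F C :=
  ⟨fun h => by cases h <;> simp_all, by
    rintro (⟨rfl, rfl⟩ | h | h)
    exacts [.refl _, .ldiv_den C h, .ldiv_num A h]⟩

theorem occursIn_rdiv_iff {q : Bool} {F C B : Formula} : OccursIn q F (rdiv C B) ↔
    (q = true ∧ F = rdiv C B) ∨ OccursIn q F C ∨ OccursIn (!q) F B :=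
  ⟨fun h => by cases h <;> simp_all, by
    rintro (⟨rfl, rfl⟩ | h | h)
    exacts [.refl _, .rdiv_num B h, .rdiv_den C h]⟩

theorem occursIn_prod_iff {q : Bool} {F A B : Formula} : OccursIn q F (prod A B) ↔
    (q = true ∧ F = prod A B) ∨ OccursIn q F A ∨ OccursIn q F B :=
  ⟨fun h => by cases h <;> simp_all, by
    rintro (⟨rfl, rfl⟩ | h | h)
    exacts [.refl _, .prod_fst B h, .prod_snd A h]⟩

theorem occursIn_dia_iff {q : Bool} {F A : Formula} : OccursIn q F (dia A) ↔
    (q = true ∧ F = dia A) ∨ OccursIn q F A :=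
  ⟨fun h => by cases h <;> simp_all, by
    rintro (⟨rfl, rfl⟩ | h)
    exacts [.refl _, .dia h]⟩

theorem occursIn_boxInv_iff {q : Bool} {F A : Formula} : OccursIn q F (boxInv A) ↔
    (q = true ∧ F = boxInv A) ∨ OccursIn q F A :=
  ⟨fun h => by cases h <;> simp_all, by
    rintro (⟨rfl, rfl⟩ | h)
    exacts [.refl _, .boxInv h]⟩

theorem occursIn_bang_iff {q : Bool} {F A : Formula} : OccursIn q F (bang A) ↔
    (q = true ∧ F = bang A) ∨ OccursIn q F A :=
  ⟨fun h => by cases h <;> simp_all, by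
    rintro (⟨rfl, rfl⟩ | h)
    exacts [.refl _, .bang h]⟩

/-- The polarities within a formula of polarity `p` in the sequent: for `p = false` they are the
opposite of the polarities in the sequent. -/
theorem eat_eq_zero_iff (p : Bool) (A : Formula) : A.eat p = 0 ↔
    ∀ C, ¬ OccursIn (!p) (boxInv C) A ∧ ¬ OccursIn p (dia C) A := by
  induction A generalizing p with
  | var | one => simp [eat, occursIn_var_iff, occursIn_one_iff]
  | ldiv A C ihA ihC => simp [eat, ihA, ihC, occursIn_ldiv_iff, forall_and]; tauto
  | rdiv C B ihC ihB => simp [eat, ihC, ihB, occursIn_rdiv_iff, forall_and]; tauto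
  | prod A B ihA ihB => simp [eat, ihA, ihB, occursIn_prod_iff, forall_and]; tauto
  | dia A ih => cases p <;> simp [eat, ih, occursIn_dia_iff, forall_and]
  | boxInv A ih => cases p <;> simp [eat, ih, occursIn_boxInv_iff, forall_and]
  | bang A ih => cases p <;> simp [eat, ih, occursIn_bang_iff, forall_and]

theorem safe_iff (p : Bool) (F : Formula) : F.Safe p ↔
    ∀ A, OccursIn (!p) (bang A) F → ∀ C, ¬ OccursIn true (boxInv C) (bang A) ∧
      ¬ OccursIn false (dia C) (bang A) := by
  have key : ∀ A, (∀ C, ¬ OccursIn true (boxInv C) (bang A) ∧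
      ¬ OccursIn false (dia C) (bang A)) ↔ A.eat false = 0 := fun A =>
    (eat_eq_zero_iff false (bang A)).symm
  simp only [key]
  induction F generalizing p with
  | var | one => simp [Safe, occursIn_var_iff, occursIn_one_iff]
  | ldiv A C ihA ihC => simp [Safe, ihA, ihC, occursIn_ldiv_iff, or_imp, forall_and]
  | rdiv C B ihC ihB => simp [Safe, ihC, ihB, occursIn_rdiv_iff, or_imp, forall_and]
  | prod A B ihA ihB => simp [Safe, ihA, ihB, occursIn_prod_iff, or_imp, forall_and]
  | dia A ih => simp [Safe, ih, occursIn_dia_iff]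
  | boxInv A ih => simp [Safe, ih, occursIn_boxInv_iff]
  | bang A ih => cases p <;> simp [Safe, ih, occursIn_bang_iff, or_imp, forall_and]

theorem inMeta_iff (A : Formula) (Γ : MetaFormula) : InMeta A Γ ↔ Tok.form A ∈ flat Γ := by
  constructor
  · intro h
    induction h with
    | form h =>
      obtain ⟨L, R, rfl⟩ := List.append_of_mem h
      simp
    | brack h _ ih =>
      obtain ⟨L, R, rfl⟩ := List.append_of_mem h
      simp [ih]
  · induction Γ using MetaFormula.induct with
    | nil => simp
    | form B Γ ih =>
      intro h
      rw [flat_form, List.mem_cons] at h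
      rcases h with h | h
      · cases h; exact .form (List.mem_cons_self ..)
      · cases ih h with
        | form h => exact .form (List.mem_cons_of_mem _ h)
        | brack h h' => exact .brack (List.mem_cons_of_mem _ h) h'
    | brack Θ Γ ihΘ ih =>
      intro h
      simp only [flat_brack, List.mem_cons, List.mem_append, reduceCtorEq, false_or] at h
      rcases h with h | h
      · exact .brack (List.mem_cons_self ..) (ihΘ h)
      · cases ih h with
        | form h => exact .form (List.mem_cons_of_mem _ h)
        | brack h h' => exact .brack (List.mem_cons_of_mem _ h) h'

theorem bracketNonNegative_iff (S : Sequent) :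
    S.BracketNonNegative ↔ SafeAnte S.ante ∧ S.succ.Safe true := by
  simp only [SafeAnte, safe_iff, ← inMeta_iff]
  constructor
  · exact fun h => ⟨fun F hF A hA => h A (.ante hF hA), fun A hA => h A (.succ hA)⟩
  · rintro ⟨h₁, h₂⟩ A h
    cases h with
    | succ h => exact h₂ A h
    | ante hF h => exact h₁ _ hF A h

/-! ### Words of tokens -/

/-- The word of a token. -/
def Tok.enc : Tok → List Sym
  | .form A => A.encode
  | .lb => [.lbrack]
  | .rb => [.rbrack]

/-- The word of a list of tokens. -/
def encT (u : List Tok) : List Sym := u.flatMap Tok.enc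

@[simp] theorem encT_nil : encT [] = [] := rfl
@[simp] theorem encT_cons (t : Tok) (u : List Tok) : encT (t :: u) = t.enc ++ encT u := rfl
@[simp] theorem encT_append (u v : List Tok) : encT (u ++ v) = encT u ++ encT v :=
  List.flatMap_append

/-- The word of a meta-formula. -/
def enc (Γ : MetaFormula) : List Sym := encT (flat Γ)

@[simp] theorem enc_nil : enc [] = [] := by simp [enc]
@[simp] theorem enc_form (A : Formula) (Γ : MetaFormula) :
    enc (form A :: Γ) = A.encode ++ enc Γ := by simp [enc, Tok.enc]
@[simp] theorem enc_brack (Θ Γ : MetaFormula) :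
    enc (brack Θ :: Γ) = .lbrack :: (enc Θ ++ .rbrack :: enc Γ) := by
  simp [enc, Tok.enc]
@[simp] theorem enc_append (Γ Θ : MetaFormula) : enc (Γ ++ Θ) = enc Γ ++ enc Θ := by
  simp [enc]

theorem encode_eq_enc (Γ : MetaFormula) : MetaFormula.encode Γ = enc Γ := by
  induction Γ using MetaFormula.induct with
  | nil => simp [MetaFormula.encode]
  | form A Γ ih => simp [MetaFormula.encode, Item.encode, ih]
  | brack Θ Γ ihΘ ih => simp [MetaFormula.encode, Item.encode, ihΘ, ih]

theorem Sequent.encode_append_eq (S : Sequent) (r : List Sym) :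
    S.encode ++ r = enc S.ante ++ .arrow :: (S.succ.encode ++ r) := by
  simp [Sequent.encode, encode_eq_enc]

theorem length_enc (Γ : MetaFormula) : (enc Γ).length = total len 2 Γ := by
  induction Γ using MetaFormula.induct with
  | nil => simp
  | form A Γ ih => simp [len, ih]
  | brack Θ Γ ihΘ ih => simp [ihΘ, ih]; omega

theorem length_flat_le (Γ : MetaFormula) : (flat Γ).length ≤ (enc Γ).length := by
  induction Γ using MetaFormula.induct with
  | nil => simp
  | form A Γ ih => have := A.len_pos; simp [len] at this ⊢; omega
  | brack Θ Γ ihΘ ih => simp; omega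

@[simp] theorem arrow_notMem_encode (A : Formula) : Sym.arrow ∉ A.encode := by
  induction A <;> simp_all [Formula.encode]

@[simp] theorem arrow_notMem_encT (u : List Tok) : Sym.arrow ∉ encT u := by
  induction u with
  | nil => simp
  | cons t u ih => cases t <;> simp [Tok.enc, ih]

@[simp] theorem arrow_notMem_enc (Γ : MetaFormula) : Sym.arrow ∉ enc Γ := arrow_notMem_encT _

theorem Tok.enc_append_inj {t t' : Tok} {x x' : List Sym} (h : t.enc ++ x = t'.enc ++ x') :
    t = t' ∧ x = x' := by
  have key : ∀ (A : Formula) (t : Tok), (∀ B, t ≠ .form B) → ∀ x x',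
      A.encode ++ x ≠ t.enc ++ x' := by
    intro A t ht x x' h
    obtain ⟨s, w, hs, h₁, h₂⟩ := A.encode_head
    cases t with
    | form B => exact ht B rfl
    | lb | rb => simp_all [Tok.enc, Sym.IsEnd]
  cases t with
  | form A =>
    cases t' with
    | form A' =>
      obtain ⟨rfl, h'⟩ : A = A' ∧ x = x' := A.encode_append_inj A' x x' h
      exact ⟨rfl, h'⟩
    | lb | rb => exact absurd h (key A _ (by simp) _ _)
  | lb | rb =>
    cases t' with
    | form A' => exact absurd h.symm (key A' _ (by simp) _ _)
    | lb | rb => simp_all [Tok.enc]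

theorem Tok.enc_ne_arrow (t : Tok) (x y : List Sym) : t.enc ++ x ≠ .arrow :: y := by
  intro h
  have := arrow_notMem_encT [t]
  cases t with
  | form A =>
    obtain ⟨s, w, hs, h₁, h₂⟩ := A.encode_head
    simp_all [Tok.enc]
  | lb | rb => simp [Tok.enc] at h

/-- Words of tokens can be decoded uniquely. -/
theorem exists_of_encT_append_eq {u v : List Tok} {x y : List Sym}
    (h : encT u ++ x = encT v ++ .arrow :: y) : ∃ v', v = u ++ v' ∧ x = encT v' ++ .arrow :: y := by
  induction u generalizing v with
  | nil => exact ⟨v, rfl, h⟩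
  | cons t u ih =>
    cases v with
    | nil => simp only [encT_cons, List.append_assoc] at h; exact absurd h (t.enc_ne_arrow _ _)
    | cons t' v =>
      simp only [encT_cons, List.append_assoc] at h
      obtain ⟨rfl, h₁⟩ := Tok.enc_append_inj h
      obtain ⟨v', rfl, h₂⟩ := ih h₁
      exact ⟨v', rfl, h₂⟩

/-! ### Decomposing meta-formulae at the level of tokens -/

/-- If the tokens of `X` are an initial part of those of `R`, possibly followed by a closing
bracket, then `X` is an initial part of `R`. -/
theorem exists_eq_append_of_flat {X R : MetaFormula} {v z : List Tok}
    (hz : z = [] ∨ ∃ z', z = .rb :: z') (h : flat R ++ z = flat X ++ v) :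
    ∃ R', R = X ++ R' ∧ v = flat R' ++ z := by
  induction X using MetaFormula.induct generalizing R v z with
  | nil => exact ⟨R, rfl, by simpa using h.symm⟩
  | form A X ih =>
    rcases R with _ | ⟨A' | Θ', R⟩
    · rcases hz with rfl | ⟨z', rfl⟩ <;> simp at h
    · simp only [flat_form, List.cons_append, List.cons.injEq, Tok.form.injEq] at h
      obtain ⟨R', rfl, hv⟩ := ih hz h.2
      exact ⟨R', by rw [h.1]; rfl, hv⟩
    · simp at h
  | brack Θ X ihΘ ih =>
    rcases R with _ | ⟨A' | Θ', R⟩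
    · rcases hz with rfl | ⟨z', rfl⟩ <;> simp at h
    · simp at h
    · simp only [flat_brack, List.cons_append, List.append_assoc, List.cons.injEq, true_and] at h
      obtain ⟨Θ'', rfl, hΘ⟩ := ihΘ (.inr ⟨_, rfl⟩) h
      rcases Θ'' with _ | ⟨A | Ξ, Θ''⟩
      · simp only [flat_nil, List.nil_append, List.cons.injEq, true_and] at hΘ
        obtain ⟨R', rfl, hR⟩ := ih hz hΘ.symm
        exact ⟨R', by simp, hR⟩
      · simp at hΘ
      · simp at hΘ

/-- Every position between two tokens of `Γ` is the position of an empty part of `Γ`. -/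
theorem exists_context_of_flat {Γ : MetaFormula} {u w : List Tok} (h : flat Γ = u ++ w) :
    ∃ Δ : Context, Γ = Δ.fill [] ∧ u = Δ.pre ∧ w = Δ.post := by
  induction Γ using MetaFormula.induct generalizing u w with
  | nil =>
    obtain ⟨rfl, rfl⟩ : u = [] ∧ w = [] := by simpa using h
    exact ⟨.hole [] [], by simp [Context.fill, Context.pre, Context.post]⟩
  | form A Γ ih =>
    rcases u with _ | ⟨t, u⟩
    · exact ⟨.hole [] (form A :: Γ), by
        simpa [Context.fill, Context.pre, Context.post] using h.symm⟩
    · simp only [flat_form, List.cons_append, List.cons.injEq] at h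
      obtain ⟨rfl, h⟩ := h
      obtain ⟨Δ, rfl, rfl, rfl⟩ := ih h
      exact ⟨Context.comp (.hole [form A] []) Δ, by
        rw [Context.fill_comp]; simp [Context.fill], by cases Δ <;> simp [Context.comp, Context.pre],
        by cases Δ <;> simp [Context.comp, Context.post]⟩
  | brack Θ Γ ihΘ ih =>
    rcases u with _ | ⟨t, u⟩
    · exact ⟨.hole [] (brack Θ :: Γ), by
        simpa [Context.fill, Context.pre, Context.post] using h.symm⟩
    · simp only [flat_brack, List.cons_append, List.cons.injEq] at h
      obtain ⟨rfl, h⟩ := h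
      rcases List.append_eq_append_iff.1 h with ⟨u', rfl, h'⟩ | ⟨w', h', rfl⟩
      · rcases u' with _ | ⟨t, u'⟩
        · obtain ⟨Δ, rfl, h₁, h₂⟩ := ihΘ (u := flat Θ) (w := []) (by simp)
          refine ⟨.brack [] Δ Γ, by simp [Context.fill], by simp [Context.pre, h₁], ?_⟩
          rw [Context.post, ← h₂]
          exact h'.symm
        · simp only [List.cons_append, List.cons.injEq] at h'
          obtain ⟨rfl, h'⟩ := h'
          obtain ⟨Δ, rfl, rfl, rfl⟩ := ih h'
          exact ⟨Context.comp (.hole [brack Θ] []) Δ, by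
            rw [Context.fill_comp]; simp [Context.fill], by cases Δ <;> simp [Context.comp, Context.pre],
            by cases Δ <;> simp [Context.comp, Context.post]⟩
      · obtain ⟨Δ, rfl, rfl, rfl⟩ := ihΘ h'
        exact ⟨.brack [] Δ Γ, by simp [Context.fill], by simp [Context.pre],
          by simp [Context.post]⟩

/-- If the tokens of `X` follow the hole of `Δ`, then the hole can be widened to an occurrence of
`X`. -/
theorem Context.exists_fill_of_post {Δ : Context} {X : MetaFormula} {v z : List Tok}
    (hz : z = [] ∨ ∃ z', z = .rb :: z') (h : Δ.post ++ z = flat X ++ v) :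
    ∃ Δ' : Context, Δ.fill [] = Δ'.fill X ∧ Δ'.pre = Δ.pre ∧ v = Δ'.post ++ z := by
  induction Δ generalizing z with
  | hole L R =>
    obtain ⟨R', rfl, hv⟩ := exists_eq_append_of_flat hz h
    exact ⟨.hole L R', by simp [Context.fill], rfl, hv⟩
  | brack L Δ R ih =>
    rw [Context.post, List.append_assoc] at h
    obtain ⟨Δ', h₁, h₂, h₃⟩ := ih (.inr ⟨_, rfl⟩) h
    exact ⟨.brack L Δ' R, by simp [Context.fill, h₁], by simp [Context.pre, h₂],
      by simp [Context.post, h₃]⟩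

/-- A part of the token list of `Γ` that is the token list of a meta-formula `X` is an occurrence
of `X` in a context. -/
theorem exists_fill_of_flat {Γ X : MetaFormula} {u v : List Tok} (h : flat Γ = u ++ (flat X ++ v)) :
    ∃ Δ : Context, Γ = Δ.fill X ∧ u = Δ.pre ∧ v = Δ.post := by
  obtain ⟨Δ, rfl, rfl, hw⟩ := exists_context_of_flat h
  obtain ⟨Δ', h₁, h₂, h₃⟩ := Context.exists_fill_of_post (z := []) (.inl rfl)
    (by simpa using hw.symm)
  exact ⟨Δ', h₁, h₂.symm, by simpa using h₃⟩

theorem enc_fill (Δ : Context) (X : MetaFormula) :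
    enc (Δ.fill X) = encT Δ.pre ++ (enc X ++ encT Δ.post) := by
  simp [enc, flat_fill]

/-- A rule applied to words: if `Δ(X) → D` always yields `Δ(Y) → D`, then replacing `X` by `Y` in
the word of a derivable sequent yields the word of a derivable sequent. -/
theorem exists_derivable_of_word {X Y : MetaFormula}
    (h : ∀ (Δ : Context) (D : Formula), Derivable (Δ.fill X) D → Derivable (Δ.fill Y) D)
    {u : List Tok} {x r : List Sym} {S : Sequent} (hS : S.IsDerivable)
    (e : encT u ++ (enc X ++ x) = S.encode ++ r) :
    ∃ S' : Sequent, S'.IsDerivable ∧ encT u ++ (enc Y ++ x) = S'.encode ++ r := by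
  obtain ⟨Γ, D⟩ := S
  rw [Sequent.encode_append_eq, ← List.append_assoc, enc, enc, ← encT_append] at e
  obtain ⟨v, hv, rfl⟩ := exists_of_encT_append_eq e
  obtain ⟨Δ, rfl, rfl, rfl⟩ := exists_fill_of_flat (Γ := Γ) (X := X) (by simpa using hv)
  exact ⟨⟨Δ.fill Y, D⟩, h Δ D hS, by simp [Sequent.encode_append_eq, enc_fill]⟩

theorem enc_arrow_inj {Γ : MetaFormula} {x r : List Sym} {S : Sequent}
    (e : enc Γ ++ .arrow :: x = S.encode ++ r) : Γ = S.ante ∧ x = S.succ.encode ++ r := by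
  rw [Sequent.encode_append_eq, ← encode_eq_enc, ← encode_eq_enc] at e
  obtain ⟨h₁, h₂⟩ := MetaFormula.encode_append_inj _ _ _ _ _ _ (.inr rfl) (.inr rfl) e
  exact ⟨h₁, by simpa using h₂⟩

/-! ### Binary numerals -/

theorem getLast?_encodePosNum (n : PosNum) :
    (Computability.encodePosNum n).getLast? = some true := by
  induction n with
  | one => rfl
  | bit0 n ih | bit1 n ih => simp [Computability.encodePosNum, List.getLast?_cons, ih]

theorem encodePosNum_decodePosNum : ∀ l : List Bool, l.getLast? = some true →
    Computability.encodePosNum (Computability.decodePosNum l) = l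
  | [], h => by simp at h
  | [b], h => by
    obtain rfl : b = true := by simpa using h
    rfl
  | false :: b :: l, h => by
    have := encodePosNum_decodePosNum (b :: l) (by simpa using h)
    simp [Computability.decodePosNum, Computability.encodePosNum, this]
  | true :: b :: l, h => by
    have := encodePosNum_decodePosNum (b :: l) (by simpa using h)
    simp [Computability.decodePosNum, Computability.encodePosNum, this]

/-- The numerals are the lists of digits whose most significant digit, if any, is 1. -/
theorem exists_encodeNat_iff (l : List Bool) :
    (∃ i, Computability.encodeNat i = l) ↔ l.getLast? ≠ some false := by
  constructor
  · rintro ⟨i, rfl⟩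
    unfold Computability.encodeNat Computability.encodeNum
    split
    · simp
    · simp [getLast?_encodePosNum]
  · intro h
    rcases l with _ | ⟨b, l⟩
    · exact ⟨0, rfl⟩
    · have h' : (b :: l).getLast? = some true := by
        rcases hl : (b :: l).getLast? with _ | _ | _ <;> simp_all
      refine ⟨Computability.decodeNat (b :: l), ?_⟩
      unfold Computability.encodeNat Computability.decodeNat Computability.decodeNum
      simp [Computability.encodeNum, encodePosNum_decodePosNum _ h']

/-! ### A program that searches for a proof -/

/-- Where parsed symbols are moved: onto one of the stacks `B`, `C`, `D`, or onto both `B`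
and `C`. -/
inductive Tgt : Type
  | B | C | D | BC
  deriving DecidableEq

instance : Fintype Tgt := ⟨{.B, .C, .D, .BC}, fun t => by cases t <;> simp⟩

/-- The condition under which a formula is accepted by the parser: `none` accepts all formulae;
`some (b, p)` accepts the formulae whose occurrences of polarity `p` obey the bracket non-negative
condition and, if `b` holds, contain no bracket consumers. -/
abbrev Mode : Type := Option (Bool × Bool)

/-- The mode for denominators. -/
def Mode.flip : Mode → Mode
  | none => none
  | some (b, p) => some (b, !p)

/-- The mode below `!`. -/
def Mode.bang : Mode → Mode
  | none => none
  | some (b, p) => some (b || !p, p)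

/-- The formulae that are accepted in a mode. -/
def Mode.Accepts : Mode → Formula → Prop
  | none, _ => True
  | some (b, p), A => (b = true → A.eat p = 0) ∧ A.Safe p

/-- The procedures of the program: `formula μ t` and `ante μ t` move a formula, resp. a
meta-formula, from the stack `A` to `t`; `bits t` and `bitsZero t` move the remaining digits of a
variable, where the digit before them, if any, is 1, resp. is 0; `bangs t` moves formulae `!A`;
`nav` moves tokens to `B`; `ret k` moves the symbols above the topmost marker of `k` back to `A`;
`cmp` removes equal words from the tops of `B` and `C`; `prove` removes a derivable sequent from
`A`; and `main` moves the input from `B` to `A`, checks the bracket non-negative condition and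
proves the sequent. -/
inductive Proc : Type
  | bits (t : Tgt) | bitsZero (t : Tgt)
  | formula (μ : Mode) (t : Tgt)
  | ante (μ : Mode) (t : Tgt)
  | nav
  | ret (k : Stk)
  | bangs (t : Tgt)
  | cmp
  | prove
  | main
  deriving Fintype

/-- The commands that push `s` onto the target `t`. -/
def Tgt.push : Tgt → Sym → List (Cmd Sym Proc)
  | .B, s => [.push .B s]
  | .C, s => [.push .C s]
  | .D, s => [.push .D s]
  | .BC, s => [.push .B s, .push .C s]

/-- The commands that move the symbol `s` from the stack `A` to the target `t`. -/
def move (t : Tgt) (s : Sym) : List (Cmd Sym Proc) := .pop .A s :: t.push s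

/-- For the rules that change a part of the antecedent, the commands that replace this part of the
conclusion by that of the premise, after everything to its left has been moved to `B`. The symbol
`Sym.arrow` serves as the marker for `ret`. -/
def rewrites : List (List (Cmd Sym Proc)) := [
  [.pop .A .prod, .call (.formula none .B), .call (.formula none .B)],
  [.pop .A .one],
  [.pop .A .dia, .push .B .lbrack, .call (.formula none .B), .push .B .rbrack],
  [.pop .A .lbrack, .pop .A .boxInv, .call (.formula none .B), .pop .A .rbrack],
  [.pop .A .bang, .call (.formula none .B)],
  [.push .C .arrow, .call (.bangs .BC), .push .D .arrow, .call (.ante none .D),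
    .push .A .rbrack, .call (.ret .D), .push .B .lbrack, .call (.ret .C)],
  [.push .C .arrow, .call (.ante none .C), .pop .A .bang, .push .B .bang,
    .call (.formula none .B), .call (.ret .C)],
  [.pop .A .bang, .push .C .arrow, .call (.formula none .C), .call (.ante none .B),
    .call (.ret .C), .push .A .bang]]

/-- The commands that take apart the principal part of a left rule of a division: the antecedent of
the minor premise is moved to `C`, its succedent to `D`, and the formula in the major premise
to `B`. -/
def divisions : List (List (Cmd Sym Proc)) := [
  [.pop .A .rdiv, .call (.formula none .B), .push .D .arrow, .call (.formula none .D),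
    .push .C .arrow, .call (.ante none .C)],
  [.push .C .arrow, .call (.ante none .C), .pop .A .ldiv, .push .D .arrow,
    .call (.formula none .D), .call (.formula none .B)]]

/-- The commands that replace the conclusion of a unary right rule by its premise. -/
def rightRewrites : List (List (Cmd Sym Proc)) := [
  [.push .B .arrow, .call (.ante none .B), .pop .A .arrow, .pop .A .rdiv, .push .D .arrow,
    .call (.formula none .D), .call (.formula none .B), .call (.ret .D), .push .A .arrow,
    .call (.ret .B)],
  [.push .B .arrow, .call (.ante none .B), .pop .A .arrow, .pop .A .ldiv, .push .D .arrow,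
    .call (.formula none .D), .push .A .arrow, .call (.ret .B), .call (.ret .D)],
  [.pop .A .lbrack, .push .B .arrow, .call (.ante none .B), .pop .A .rbrack, .pop .A .arrow,
    .pop .A .dia, .push .A .arrow, .call (.ret .B)],
  [.push .B .arrow, .call (.ante none .B), .pop .A .arrow, .pop .A .boxInv, .push .A .arrow,
    .push .A .rbrack, .call (.ret .B), .push .A .lbrack],
  [.push .B .arrow, .call (.bangs .B), .pop .A .arrow, .pop .A .bang, .push .A .arrow,
    .call (.ret .B)]]

/-- The commands that replace the conclusion of the right rule of the product by its premises. -/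
def splitProd : List (Cmd Sym Proc) :=
  [.push .C .arrow, .call (.ante none .C), .push .B .arrow, .call (.ante none .B), .pop .A .arrow,
    .pop .A .prod, .push .D .arrow, .call (.formula none .D), .push .A .arrow, .call (.ret .B),
    .call (.ret .D), .push .A .arrow, .call (.ret .C)]

/-- The commands that remove an axiom. -/
def removeAxiom : List (Cmd Sym Proc) :=
  [.push .B .arrow, .call (.formula none .B), .pop .A .arrow, .push .C .arrow,
    .call (.formula none .C), .call .cmp]

/-- The commands that parse a sequent and check the bracket non-negative condition. -/
def checkSequent : List (Cmd Sym Proc) :=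
  [.push .B .arrow, .call (.ante (some (false, false)) .B), .pop .A .arrow, .push .C .arrow,
    .call (.formula (some (false, true)) .C), .call (.ret .C), .push .A .arrow, .call (.ret .B)]

/-- The alternative bodies of the procedures. The parser checks that numerals do not end in the
digit 0, so that it accepts exactly the words of formulae. Since `ret` stops at the topmost marker,
each procedure leaves alone what the calling procedures have put on the stacks. -/
noncomputable def program : Program Sym Proc
  | .bits t => [move t .endVar, move t (.bit true) ++ [.call (.bits t)],
      move t (.bit false) ++ [.call (.bitsZero t)]]
  | .bitsZero t => [move t (.bit true) ++ [.call (.bits t)],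
      move t (.bit false) ++ [.call (.bitsZero t)]]
  | .formula μ t => [
      move t .var ++ [.call (.bits t)],
      move t .one,
      move t .ldiv ++ [.call (.formula μ.flip t), .call (.formula μ t)],
      move t .rdiv ++ [.call (.formula μ t), .call (.formula μ.flip t)],
      move t .prod ++ [.call (.formula μ t), .call (.formula μ t)],
      move t .bang ++ [.call (.formula μ.bang t)]] ++
      (if μ = some (true, true) then [] else [move t .dia ++ [.call (.formula μ t)]]) ++
      (if μ = some (true, false) then [] else [move t .boxInv ++ [.call (.formula μ t)]])
  | .ante μ t => [[], [.call (.formula μ t), .call (.ante μ t)],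
      move t .lbrack ++ .call (.ante μ t) :: (move t .rbrack ++ [.call (.ante μ t)])]
  | .nav => [[], [.call (.formula none .B), .call .nav], move .B .lbrack ++ [.call .nav],
      move .B .rbrack ++ [.call .nav]]
  | .ret .A => []
  | .ret k => [.pop k .arrow] :: (Finset.univ.erase Sym.arrow).toList.map fun s =>
      [.pop k s, .push .A s, .call (.ret k)]
  | .bangs t => [[], move t .bang ++ [.call (.formula none t), .call (.bangs t)]]
  | .cmp => [.pop .B .arrow, .pop .C .arrow] :: (Finset.univ.erase Sym.arrow).toList.map fun s =>
      [.pop .B s, .pop .C s, .call .cmp]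
  | .prove => [removeAxiom, [.pop .A .arrow, .pop .A .one],
        splitProd ++ [.call .prove, .call .prove]] ++
      rewrites.map (fun cs => [.push .B .arrow, .call .nav] ++ cs ++
        [.call (.ret .B), .call .prove]) ++
      divisions.map (fun cs => [.push .B .arrow, .call .nav] ++ cs ++
        [.call (.ret .B), .call (.ret .D), .push .A .arrow, .call (.ret .C), .call .prove,
          .call .prove]) ++
      rightRewrites.map (fun cs => cs ++ [.call .prove])
  | .main => (checkSequent ++ [.call .prove]) :: Finset.univ.toList.map fun s =>
      [.pop .B s, .push .A s, .call .main]

/-! ### Soundness of the program -/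

/-- The store after the word `w` has been moved to the target. -/
def Tgt.put : Tgt → List Sym → Store Sym → Store Sym
  | .B, w, m => { m with b := w.reverse ++ m.b }
  | .C, w, m => { m with c := w.reverse ++ m.c }
  | .D, w, m => { m with d := w.reverse ++ m.d }
  | .BC, w, m => { m with b := w.reverse ++ m.b, c := w.reverse ++ m.c }

/-- The store `m'` arises from `m` by moving the word `w` from the stack `A` to `t`. -/
def Moved (t : Tgt) (w : List Sym) (m m' : Store Sym) : Prop :=
  ∃ r, m.a = w ++ r ∧ m' = t.put w { m with a := r }

theorem Moved.nil (t : Tgt) (m : Store Sym) : Moved t [] m m :=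
  ⟨m.a, rfl, by cases t <;> rfl⟩

theorem Moved.append {t : Tgt} {u v : List Sym} {m m₁ m' : Store Sym} (h : Moved t u m m₁)
    (h' : Moved t v m₁ m') : Moved t (u ++ v) m m' := by
  obtain ⟨r, e, rfl⟩ := h
  obtain ⟨r', e', rfl⟩ := h'
  refine ⟨r', ?_, ?_⟩
  · cases t <;> simp_all [Tgt.put]
  · cases t <;> simp [Tgt.put]

theorem RunRel.append {R : Proc → Store Sym → Store Sym → Prop} {cs ds : List (Cmd Sym Proc)}
    {m m' : Store Sym} (h : RunRel R (cs ++ ds) m m') :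
    ∃ m₁, RunRel R cs m m₁ ∧ RunRel R ds m₁ m' := by
  induction cs generalizing m with
  | nil => exact ⟨m, rfl, h⟩
  | cons x cs ih =>
    cases x with
    | push k s => exact ih h
    | pop k s =>
      obtain ⟨r, e, h⟩ := h
      obtain ⟨m₁, h₁, h₂⟩ := ih h
      exact ⟨m₁, ⟨r, e, h₁⟩, h₂⟩
    | call p =>
      obtain ⟨m₂, e, h⟩ := h
      obtain ⟨m₁, h₁, h₂⟩ := ih h
      exact ⟨m₁, ⟨m₂, e, h₁⟩, h₂⟩

theorem RunRel.move {R : Proc → Store Sym → Store Sym → Prop} {t : Tgt} {s : Sym}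
    {m m' : Store Sym} (h : RunRel R (move t s) m m') : Moved t [s] m m' := by
  obtain ⟨r, e, h⟩ := h
  refine ⟨r, e, ?_⟩
  cases t <;> exact h.symm

theorem RunRel.move_append {R : Proc → Store Sym → Store Sym → Prop} {t : Tgt} {s : Sym}
    {cs : List (Cmd Sym Proc)} {m m' : Store Sym}
    (h : RunRel R (BracketLambek.move t s ++ cs) m m') :
    ∃ m₁, Moved t [s] m m₁ ∧ RunRel R cs m₁ m' := by
  obtain ⟨m₁, h₁, h₂⟩ := h.append
  exact ⟨m₁, h₁.move, h₂⟩

/-- The store `m'` arises from `m` by removing the word of a derivable sequent from `A`. -/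
def Proved (m m' : Store Sym) : Prop :=
  ∃ S : Sequent, S.IsDerivable ∧ ∃ r, m.a = S.encode ++ r ∧ m' = { m with a := r }

/-- The symbols of `k` above its topmost marker have been moved back to the stack `A`. -/
def Returned (k : Stk) (m m' : Store Sym) : Prop :=
  ∃ w r, Sym.arrow ∉ w ∧ m.get k = w ++ .arrow :: r ∧
    m' = { m.set k r with a := w.reverse ++ m.a }

/-- The input-output relations of the procedures. For `main` the relation says nothing about the
stacks `C` and `D`, which are empty at the end of the executions that matter. -/
def spec : Proc → Store Sym → Store Sym → Prop
  | .bits t, m, m' => ∃ l : List Bool, l.getLast? ≠ some false ∧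
      Moved t (l.map .bit ++ [.endVar]) m m'
  | .bitsZero t, m, m' => ∃ l : List Bool, (false :: l).getLast? ≠ some false ∧
      Moved t (l.map .bit ++ [.endVar]) m m'
  | .formula μ t, m, m' => ∃ A, μ.Accepts A ∧ Moved t A.encode m m'
  | .ante μ t, m, m' => ∃ Γ, (∀ A, Tok.form A ∈ flat Γ → μ.Accepts A) ∧ Moved t (enc Γ) m m'
  | .nav, m, m' => ∃ u, Moved .B (encT u) m m'
  | .ret k, m, m' => Returned k m m'
  | .bangs t, m, m' => ∃ As, Moved t (enc (bangs As)) m m'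
  | .cmp, m, m' => ∃ w b c, Sym.arrow ∉ w ∧ m.b = w ++ .arrow :: b ∧ m.c = w ++ .arrow :: c ∧
      m' = { m with b := b, c := c }
  | .prove, m, m' => Proved m m'
  | .main, m, m' => ∃ w, m.b = w ++ m'.b ∧ ∃ S : Sequent, S.BracketNonNegative ∧ S.IsDerivable ∧
      w.reverse ++ m.a = S.encode ++ m'.a

/-- A formula is accepted if its parts are accepted in the modes in which they are parsed. -/
theorem spec_formula {μ : Mode} {t : Tgt} {body : List (Cmd Sym Proc)}
    (hb : body ∈ program (.formula μ t)) {m m' : Store Sym} (h : RunRel spec body m m') :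
    spec (.formula μ t) m m' := by
  simp only [program, List.cons_append, List.nil_append, List.mem_cons, List.mem_append,
    List.mem_ite_nil_left, List.not_mem_nil, or_false] at hb
  rcases hb with rfl | rfl | rfl | rfl | rfl | rfl | hb
  · obtain ⟨m₁, h₁, m₂, ⟨l, hl, h₂⟩, rfl⟩ := h.move_append
    obtain ⟨i, rfl⟩ := (exists_encodeNat_iff l).2 hl
    exact ⟨.var i, by rcases μ with _ | ⟨b, p⟩ <;> simp [Mode.Accepts, Formula.eat, Formula.Safe],
      h₁.append h₂⟩
  · exact ⟨.one, by rcases μ with _ | ⟨b, p⟩ <;> simp [Mode.Accepts, Formula.eat, Formula.Safe],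
      h.move⟩
  · obtain ⟨m₁, h₁, m₂, ⟨A, hA, h₂⟩, m₃, ⟨C, hC, h₃⟩, rfl⟩ := h.move_append
    refine ⟨.ldiv A C, ?_, h₁.append (h₂.append h₃)⟩
    rcases μ with _ | ⟨b, p⟩ <;>
      simp_all [Mode.Accepts, Mode.flip, Formula.eat, Formula.Safe]
  · obtain ⟨m₁, h₁, m₂, ⟨A, hA, h₂⟩, m₃, ⟨C, hC, h₃⟩, rfl⟩ := h.move_append
    refine ⟨.rdiv A C, ?_, h₁.append (h₂.append h₃)⟩
    rcases μ with _ | ⟨b, p⟩ <;>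
      simp_all [Mode.Accepts, Mode.flip, Formula.eat, Formula.Safe]
  · obtain ⟨m₁, h₁, m₂, ⟨A, hA, h₂⟩, m₃, ⟨C, hC, h₃⟩, rfl⟩ := h.move_append
    refine ⟨.prod A C, ?_, h₁.append (h₂.append h₃)⟩
    rcases μ with _ | ⟨b, p⟩ <;>
      simp_all [Mode.Accepts, Formula.eat, Formula.Safe]
  · obtain ⟨m₁, h₁, m₂, ⟨A, hA, h₂⟩, rfl⟩ := h.move_append
    refine ⟨.bang A, ?_, h₁.append h₂⟩
    rcases μ with _ | ⟨_ | _, _ | _⟩ <;>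
      simp_all [Mode.Accepts, Mode.bang, Formula.eat, Formula.Safe]
  · rcases hb with ⟨hμ, rfl⟩ | ⟨hμ, rfl⟩
    · obtain ⟨m₁, h₁, m₂, ⟨A, hA, h₂⟩, rfl⟩ := h.move_append
      refine ⟨.dia A, ?_, h₁.append h₂⟩
      rcases μ with _ | ⟨_ | _, _ | _⟩ <;>
        simp_all [Mode.Accepts, Formula.eat, Formula.Safe]
    · obtain ⟨m₁, h₁, m₂, ⟨A, hA, h₂⟩, rfl⟩ := h.move_append
      refine ⟨.boxInv A, ?_, h₁.append h₂⟩
      rcases μ with _ | ⟨_ | _, _ | _⟩ <;>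
        simp_all [Mode.Accepts, Formula.eat, Formula.Safe]

/-- The topmost marker on a stack determines the symbols above it. -/
theorem append_arrow_inj {w w' r r' : List Sym} (hw : Sym.arrow ∉ w) (hw' : Sym.arrow ∉ w')
    (h : w ++ .arrow :: r = w' ++ .arrow :: r') : w = w' ∧ r = r' := by
  induction w generalizing w' with
  | nil =>
    cases w' with
    | nil => simpa using h
    | cons s' w' =>
      simp only [List.nil_append, List.cons_append, List.cons.injEq] at h
      exact absurd (h.1 ▸ List.mem_cons_self) hw'
  | cons s w ih =>
    cases w' with
    | nil =>
      simp only [List.nil_append, List.cons_append, List.cons.injEq] at h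
      exact absurd (h.1 ▸ List.mem_cons_self) hw
    | cons s' w' =>
      simp only [List.mem_cons, not_or, List.cons_append, List.cons.injEq] at hw hw' h
      obtain ⟨rfl, rfl⟩ := ih hw.2 hw'.2 h.2
      exact ⟨by rw [h.1], rfl⟩

theorem Returned.eq {k : Stk} {m m' : Store Sym} (h : Returned k m m') {w r : List Sym}
    (hw : Sym.arrow ∉ w) (e : m.get k = w ++ .arrow :: r) :
    m' = { m.set k r with a := w.reverse ++ m.a } := by
  obtain ⟨w', r', hw', e', rfl⟩ := h
  obtain ⟨rfl, rfl⟩ := append_arrow_inj hw' hw (e'.symm.trans e)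
  rfl

/-- The correctness of the commands in `rewrites`. -/
theorem exists_rule_of_rewrites {cs : List (Cmd Sym Proc)} (hcs : cs ∈ rewrites)
    {m m' : Store Sym} (h : RunRel spec cs m m') : ∃ X Y x p,
      (∀ (Δ : Context) (D : Formula), Derivable (Δ.fill X) D → Derivable (Δ.fill Y) D) ∧
      m.a = enc Y ++ x ∧ Sym.arrow ∉ p ∧ p ++ m'.a = enc X ++ x ∧ m'.b = p.reverse ++ m.b ∧
      m'.c = m.c ∧ m'.d = m.d := by
  obtain ⟨a, b, c, d⟩ := m
  simp only [rewrites, List.mem_cons, List.not_mem_nil, or_false] at hcs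
  rcases hcs with rfl | rfl | rfl | rfl | rfl | rfl | rfl | rfl
  · obtain ⟨r₁, e₁, m₂, ⟨A, -, r₂, e₂, rfl⟩, m₃, ⟨B, -, r₃, e₃, rfl⟩, rfl⟩ := h
    refine ⟨_, _, r₃, A.encode ++ B.encode, fun Δ D => (LeftRule.prod A B).derivable Δ, ?_⟩
    simp_all [Store.get, Store.set, Tgt.put, Formula.encode]
  · obtain ⟨r₁, e₁, rfl⟩ := h
    refine ⟨_, _, r₁, [], fun Δ D => LeftRule.one.derivable Δ, ?_⟩
    simp_all [Store.get, Store.set, Formula.encode]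
  · obtain ⟨r₁, e₁, m₂, ⟨A, -, r₂, e₂, rfl⟩, rfl⟩ := h
    refine ⟨_, _, r₂, .lbrack :: (A.encode ++ [.rbrack]),
      fun Δ D => (LeftRule.dia A).derivable Δ, ?_⟩
    simp_all [Store.get, Store.set, Tgt.put, Formula.encode]
  · obtain ⟨r₁, e₁, r₂, e₂, m₂, ⟨A, -, r₃, e₃, rfl⟩, r₄, e₄, rfl⟩ := h
    refine ⟨_, _, r₄, A.encode, fun Δ D => (LeftRule.boxInv A).derivable Δ, ?_⟩
    simp_all [Store.get, Store.set, Tgt.put, Formula.encode]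
  · obtain ⟨r₁, e₁, m₂, ⟨A, -, r₂, e₂, rfl⟩, rfl⟩ := h
    refine ⟨_, _, r₂, A.encode, fun Δ D => (LeftRule.bang A).derivable Δ, ?_⟩
    simp_all [Store.get, Store.set, Tgt.put, Formula.encode]
  · obtain ⟨m₁, ⟨As, r₁, e₁, rfl⟩, m₂, ⟨Γ, -, r₂, e₂, rfl⟩, m₃, h₃, m₄, h₄, rfl⟩ := h
    obtain rfl := h₃.eq (w := (enc Γ).reverse) (r := d) (by simp)
      (by simp [Store.get, Store.set, Tgt.put])
    obtain rfl := h₄.eq (w := (enc (bangs As)).reverse) (r := c) (by simp)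
      (by simp [Store.get, Store.set, Tgt.put])
    refine ⟨_, _, r₂, enc (bangs As) ++ [.lbrack], fun Δ D => (LeftRule.contr As Γ).derivable Δ, ?_⟩
    simp_all [Store.get, Store.set, Tgt.put]
  · obtain ⟨m₁, ⟨Γ, -, r₁, e₁, rfl⟩, r₂, e₂, m₃, ⟨A, -, r₃, e₃, rfl⟩, m₄, h₄, rfl⟩ := h
    obtain rfl := h₄.eq (w := (enc Γ).reverse) (r := c) (by simp)
      (by simp [Store.get, Store.set, Tgt.put])
    refine ⟨_, _, r₃, .bang :: A.encode, fun Δ D => (PermRule.right A Γ).derivable Δ, ?_⟩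
    simp_all [Store.get, Store.set, Tgt.put, Formula.encode]
  · obtain ⟨r₁, e₁, m₂, ⟨A, -, r₂, e₂, rfl⟩, m₃, ⟨Γ, -, r₃, e₃, rfl⟩, m₄, h₄, rfl⟩ := h
    obtain rfl := h₄.eq (w := A.encode.reverse) (r := c) (by simp)
      (by simp [Store.get, Store.set, Tgt.put])
    refine ⟨_, _, r₃, enc Γ, fun Δ D => (PermRule.left A Γ).derivable Δ, ?_⟩
    simp_all [Store.get, Store.set, Tgt.put, Formula.encode]

theorem proved_of_rewrites {cs : List (Cmd Sym Proc)} (hcs : cs ∈ rewrites) {m m' : Store Sym}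
    (h : RunRel spec
      ([.push .B .arrow, .call .nav] ++ cs ++ [.call (.ret .B), .call .prove]) m m') :
    Proved m m' := by
  obtain ⟨m₃, h₁, m₄, h₄, _, ⟨S, hS, r, e, rfl⟩, rfl⟩ := h.append
  obtain ⟨m₂, h₂, h₃⟩ := h₁.append
  obtain ⟨_, ⟨u, r₁, e₁, rfl⟩, rfl⟩ := h₂
  obtain ⟨X, Y, x, p, hXY, e₂, hp, e₃, hb, hc, hd⟩ := exists_rule_of_rewrites hcs h₃
  obtain ⟨a, b, c, d⟩ := m
  obtain ⟨a₃, b₃, c₃, d₃⟩ := m₃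
  simp only [Store.get, Store.set, Tgt.put] at e₁ e₂ e₃ hb hc hd
  subst hb hc hd e₁ e₂
  obtain rfl := h₄.eq (w := p.reverse ++ (encT u).reverse) (r := b) (by simp [hp])
    (by simp [Store.get])
  simp only [List.reverse_append, List.reverse_reverse, List.append_assoc, e₃] at e
  obtain ⟨S', hS', e'⟩ := exists_derivable_of_word hXY hS e
  exact ⟨S', hS', r, e', rfl⟩

/-- The correctness of the commands in `divisions`. -/
theorem exists_rule_of_divisions {cs : List (Cmd Sym Proc)} (hcs : cs ∈ divisions)
    {m m' : Store Sym} (h : RunRel spec cs m m') : ∃ Γ A C Y x, DivRule Γ A C Y ∧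
      m.a = enc Y ++ x ∧ m' = ⟨x, C.encode.reverse ++ m.b, (enc Γ).reverse ++ .arrow :: m.c,
        A.encode.reverse ++ .arrow :: m.d⟩ := by
  obtain ⟨a, b, c, d⟩ := m
  simp only [divisions, List.mem_cons, List.not_mem_nil, or_false] at hcs
  rcases hcs with rfl | rfl
  · obtain ⟨r₁, e₁, _, ⟨C, -, r₂, e₂, rfl⟩, _, ⟨B, -, r₃, e₃, rfl⟩, _, ⟨Γ, -, r₄, e₄, rfl⟩,
      rfl⟩ := h
    refine ⟨Γ, B, C, _, r₄, .rdiv Γ B C, ?_⟩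
    simp_all [Store.get, Store.set, Tgt.put, Formula.encode]
  · obtain ⟨_, ⟨Γ, -, r₁, e₁, rfl⟩, r₂, e₂, _, ⟨A, -, r₃, e₃, rfl⟩, _, ⟨C, -, r₄, e₄, rfl⟩,
      rfl⟩ := h
    refine ⟨Γ, A, C, _, r₄, .ldiv Γ A C, ?_⟩
    simp_all [Store.get, Store.set, Tgt.put, Formula.encode]

theorem Proved.of_arrow {Γ : MetaFormula} {x b c d : List Sym} {m' : Store Sym}
    (h : Proved ⟨enc Γ ++ .arrow :: x, b, c, d⟩ m') :
    ∃ D r, Derivable Γ D ∧ x = D.encode ++ r ∧ m' = ⟨r, b, c, d⟩ := by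
  obtain ⟨S, hS, r, e, rfl⟩ := h
  obtain ⟨rfl, rfl⟩ := enc_arrow_inj e
  exact ⟨_, r, hS, rfl, rfl⟩

theorem proved_of_divisions {cs : List (Cmd Sym Proc)} (hcs : cs ∈ divisions) {m m' : Store Sym}
    (h : RunRel spec ([.push .B .arrow, .call .nav] ++ cs ++ [.call (.ret .B), .call (.ret .D),
      .push .A .arrow, .call (.ret .C), .call .prove, .call .prove]) m m') :
    Proved m m' := by
  obtain ⟨m₃, h₁, m₄, h₄, m₅, h₅, m₆, h₆, m₇, h₇, m₈, h₈, rfl⟩ := h.append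
  obtain ⟨m₂, h₂, h₃⟩ := h₁.append
  obtain ⟨_, ⟨u, r₁, e₁, rfl⟩, rfl⟩ := h₂
  obtain ⟨Γ, A, C, Y, x, hY, e₂, rfl⟩ := exists_rule_of_divisions hcs h₃
  obtain ⟨a, b, c, d⟩ := m
  simp only [Store.get, Store.set, Tgt.put] at e₁ e₂
  subst e₁ e₂
  obtain rfl := h₄.eq (w := C.encode.reverse ++ (encT u).reverse) (r := b) (by simp)
    (by simp [Store.get, Store.set, Tgt.put])
  obtain rfl := h₅.eq (w := A.encode.reverse) (r := d) (by simp)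
    (by simp [Store.get, Store.set, Tgt.put])
  obtain rfl := h₆.eq (w := (enc Γ).reverse) (r := c) (by simp)
    (by simp [Store.get, Store.set, Tgt.put])
  simp only [Store.get, Store.set, Tgt.put, List.reverse_reverse, List.reverse_append,
    List.append_assoc] at h₇
  obtain ⟨A', r, hA, e, rfl⟩ := Proved.of_arrow h₇
  obtain ⟨rfl, rfl⟩ := A.encode_append_inj _ _ _ e
  obtain ⟨S, hS, r, e', rfl⟩ := h₈
  obtain ⟨S', hS', e''⟩ := exists_derivable_of_word (X := [form C]) (Y := Y) (u := u) (x := x)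
    (fun Δ D => hY.derivable Δ hA) hS (by simpa using e')
  exact ⟨S', hS', r, e'', rfl⟩

theorem proved_of_rightRewrites {cs : List (Cmd Sym Proc)} (hcs : cs ∈ rightRewrites)
    {m m' : Store Sym} (h : RunRel spec (cs ++ [.call .prove]) m m') : Proved m m' := by
  obtain ⟨a, b, c, d⟩ := m
  obtain ⟨m₁, h₀, _, hP, rfl⟩ := h.append
  clear h
  -- The succedent of the premise need not have been parsed: then only the recursive call shows
  -- that it is a formula.
  suffices ∃ Γ Γ' x, m₁ = ⟨enc Γ ++ .arrow :: x, b, c, d⟩ ∧ ∀ B r, x = B.encode ++ r →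
      ∃ B', RightRule Γ B Γ' B' ∧ a = enc Γ' ++ .arrow :: (B'.encode ++ r) by
    obtain ⟨Γ, Γ', x, rfl, hR⟩ := this
    obtain ⟨B, r, hB, e, rfl⟩ := hP.of_arrow
    obtain ⟨B', hR', rfl⟩ := hR B r e
    exact ⟨⟨Γ', B'⟩, hR'.derivable hB, r, by simp [Sequent.encode_append_eq], rfl⟩
  simp only [rightRewrites, List.mem_cons, List.not_mem_nil, or_false] at hcs
  rcases hcs with rfl | rfl | rfl | rfl | rfl
  · obtain ⟨_, ⟨Γ, -, r₁, e₁, rfl⟩, r₂, e₂, r₃, e₃, _, ⟨C, -, r₄, e₄, rfl⟩, _,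
      ⟨B, -, r₅, e₅, rfl⟩, _, h₆, _, h₇, rfl⟩ := h₀
    obtain rfl := h₆.eq (w := C.encode.reverse) (r := d) (by simp)
      (by simp [Store.get, Store.set, Tgt.put])
    obtain rfl := h₇.eq (w := B.encode.reverse ++ (enc Γ).reverse) (r := b) (by simp)
      (by simp [Store.get, Store.set, Tgt.put])
    refine ⟨Γ ++ [form B], Γ, C.encode ++ r₅, by simp [Store.get, Store.set, Tgt.put],
      fun D r e => ?_⟩
    obtain ⟨rfl, rfl⟩ := C.encode_append_inj _ _ _ e
    refine ⟨_, .rdiv Γ B C, ?_⟩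
    simp_all [Store.get, Store.set, Tgt.put, Formula.encode]
  · obtain ⟨_, ⟨Γ, -, r₁, e₁, rfl⟩, r₂, e₂, r₃, e₃, _, ⟨A, -, r₄, e₄, rfl⟩, _, h₆, _, h₇, rfl⟩ := h₀
    obtain rfl := h₆.eq (w := (enc Γ).reverse) (r := b) (by simp)
      (by simp [Store.get, Store.set, Tgt.put])
    obtain rfl := h₇.eq (w := A.encode.reverse) (r := d) (by simp)
      (by simp [Store.get, Store.set, Tgt.put])
    refine ⟨[form A] ++ Γ, Γ, r₄, by simp [Store.get, Store.set, Tgt.put],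
      fun B r e => ⟨_, .ldiv Γ A B, ?_⟩⟩
    simp_all [Store.get, Store.set, Tgt.put, Formula.encode]
  · obtain ⟨r₁, e₁, _, ⟨Γ, -, r₂, e₂, rfl⟩, r₃, e₃, r₄, e₄, r₅, e₅, _, h₆, rfl⟩ := h₀
    obtain rfl := h₆.eq (w := (enc Γ).reverse) (r := b) (by simp)
      (by simp [Store.get, Store.set, Tgt.put])
    refine ⟨Γ, [brack Γ], r₅, by simp [Store.get, Store.set, Tgt.put],
      fun B r e => ⟨_, .dia Γ B, ?_⟩⟩
    simp_all [Store.get, Store.set, Tgt.put, Formula.encode]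
  · obtain ⟨_, ⟨Γ, -, r₁, e₁, rfl⟩, r₂, e₂, r₃, e₃, _, h₄, rfl⟩ := h₀
    obtain rfl := h₄.eq (w := (enc Γ).reverse) (r := b) (by simp)
      (by simp [Store.get, Store.set, Tgt.put])
    refine ⟨[brack Γ], Γ, r₃, by simp [Store.get, Store.set, Tgt.put],
      fun B r e => ⟨_, .boxInv Γ B, ?_⟩⟩
    simp_all [Store.get, Store.set, Tgt.put, Formula.encode]
  · obtain ⟨_, ⟨As, r₁, e₁, rfl⟩, r₂, e₂, r₃, e₃, _, h₄, rfl⟩ := h₀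
    obtain rfl := h₄.eq (w := (enc (bangs As)).reverse) (r := b) (by simp)
      (by simp [Store.get, Store.set, Tgt.put])
    refine ⟨bangs As, bangs As, r₃, by simp [Store.get, Store.set, Tgt.put],
      fun B r e => ⟨_, .bang As B, ?_⟩⟩
    simp_all [Store.get, Store.set, Tgt.put, Formula.encode]

theorem proved_of_splitProd {m m' : Store Sym}
    (h : RunRel spec (splitProd ++ [.call .prove, .call .prove]) m m') : Proved m m' := by
  obtain ⟨a, b, c, d⟩ := m
  obtain ⟨_, ⟨Γ₁, -, r₁, e₁, rfl⟩, _, ⟨Γ₂, -, r₂, e₂, rfl⟩, r₃, e₃, r₄, e₄, _, ⟨A, -, r₅, e₅, rfl⟩,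
    _, h₆, _, h₇, _, h₈, _, h₉, _, h₁₀, rfl⟩ := h
  obtain rfl := h₆.eq (w := (enc Γ₂).reverse) (r := b) (by simp)
    (by simp [Store.get, Store.set, Tgt.put])
  obtain rfl := h₇.eq (w := A.encode.reverse) (r := d) (by simp)
    (by simp [Store.get, Store.set, Tgt.put])
  obtain rfl := h₈.eq (w := (enc Γ₁).reverse) (r := c) (by simp)
    (by simp [Store.get, Store.set, Tgt.put])
  simp only [Store.get, Store.set, Tgt.put, List.reverse_reverse] at *
  obtain ⟨A', r, hA, e, rfl⟩ := Proved.of_arrow h₉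
  obtain ⟨rfl, rfl⟩ := A.encode_append_inj _ _ _ e
  obtain ⟨B, r, hB, rfl, rfl⟩ := Proved.of_arrow h₁₀
  refine ⟨⟨Γ₁ ++ Γ₂, .prod A B⟩, .prod_right _ _ _ _ hA hB, r, ?_, rfl⟩
  simp_all [Sequent.encode_append_eq, Formula.encode]

theorem proved_of_removeAxiom {m m' : Store Sym} (h : RunRel spec removeAxiom m m') :
    Proved m m' := by
  obtain ⟨a, b, c, d⟩ := m
  obtain ⟨_, ⟨A, -, r₁, e₁, rfl⟩, r₂, e₂, _, ⟨B, -, r₃, e₃, rfl⟩, _, ⟨w, b', c', hw, e₄, e₅, rfl⟩,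
    rfl⟩ := h
  simp only [Store.get, Store.set, Tgt.put] at *
  obtain ⟨rfl, rfl⟩ := append_arrow_inj (by simp) hw e₄
  obtain ⟨h, rfl⟩ := append_arrow_inj (by simp) (by simp) e₅
  obtain ⟨rfl, -⟩ := B.encode_append_inj A [] [] (by simpa using h)
  refine ⟨⟨[form B], B⟩, .ax B, r₃, ?_, rfl⟩
  simp_all [Sequent.encode_append_eq]

theorem spec_prove {body : List (Cmd Sym Proc)} (hb : body ∈ program .prove) {m m' : Store Sym}
    (h : RunRel spec body m m') : Proved m m' := by
  simp only [program, List.mem_append, List.mem_cons, List.mem_map, List.not_mem_nil,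
    or_false] at hb
  rcases hb with (((rfl | rfl | rfl) | ⟨cs, hcs, rfl⟩) | ⟨cs, hcs, rfl⟩) | ⟨cs, hcs, rfl⟩
  · exact proved_of_removeAxiom h
  · obtain ⟨r₁, e₁, r₂, e₂, rfl⟩ := h
    refine ⟨⟨[], .one⟩, .one_right, r₂, ?_, rfl⟩
    simp_all [Sequent.encode_append_eq, Store.get, Store.set, Formula.encode]
  · exact proved_of_splitProd h
  · exact proved_of_rewrites hcs h
  · exact proved_of_divisions hcs h
  · exact proved_of_rightRewrites hcs h

theorem spec_main {body : List (Cmd Sym Proc)} (hb : body ∈ program .main) {m m' : Store Sym}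
    (h : RunRel spec body m m') : spec .main m m' := by
  simp only [program, List.mem_cons, List.mem_map, Finset.mem_toList, Finset.mem_univ,
    true_and] at hb
  rcases hb with rfl | ⟨s, rfl⟩
  · obtain ⟨a, b, c, d⟩ := m
    obtain ⟨_, ⟨Γ, hΓ, r₁, e₁, rfl⟩, r₂, e₂, _, ⟨B, hB, r₃, e₃, rfl⟩, _, h₄, _, h₅, _, h₆, rfl⟩ := h
    obtain rfl := h₄.eq (w := B.encode.reverse) (r := c) (by simp)
      (by simp [Store.get, Store.set, Tgt.put])
    obtain rfl := h₅.eq (w := (enc Γ).reverse) (r := b) (by simp)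
      (by simp [Store.get, Store.set, Tgt.put])
    simp only [Store.get, Store.set, Tgt.put, List.reverse_reverse] at *
    obtain ⟨B', r, hD, e, rfl⟩ := Proved.of_arrow h₆
    obtain ⟨rfl, rfl⟩ := B.encode_append_inj _ _ _ e
    refine ⟨[], rfl, ⟨Γ, B⟩, ?_, hD, ?_⟩
    · exact (bracketNonNegative_iff _).2 ⟨fun A hA => (hΓ A hA).2, hB.2⟩
    · simp_all [Sequent.encode_append_eq]
  · obtain ⟨r, e, _, ⟨w, e', S, h₁, h₂, e''⟩, rfl⟩ := h
    refine ⟨s :: w, ?_, S, h₁, h₂, ?_⟩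
    · simp_all [Store.get, Store.set]
    · simpa [Store.get, Store.set] using e''

/-- The program is partially correct. -/
theorem spec_of_mem_program (p : Proc) (body : List (Cmd Sym Proc)) (hb : body ∈ program p)
    (m m' : Store Sym) (h : RunRel spec body m m') : spec p m m' := by
  cases p with
  | formula μ t => exact spec_formula hb h
  | prove => exact spec_prove hb h
  | main => exact spec_main hb h
  | bits t =>
    simp only [program, List.mem_cons, List.not_mem_nil, or_false] at hb
    rcases hb with rfl | rfl | rfl
    · exact ⟨[], by simp, h.move⟩
    · obtain ⟨m₁, h₁, m₂, ⟨l, hl, h₂⟩, rfl⟩ := h.move_append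
      refine ⟨true :: l, ?_, h₁.append h₂⟩
      rw [List.getLast?_cons]
      cases hl' : l.getLast? <;> simp_all
    · obtain ⟨m₁, h₁, m₂, ⟨l, hl, h₂⟩, rfl⟩ := h.move_append
      exact ⟨false :: l, hl, h₁.append h₂⟩
  | bitsZero t =>
    simp only [program, List.mem_cons, List.not_mem_nil, or_false] at hb
    rcases hb with rfl | rfl
    · obtain ⟨m₁, h₁, m₂, ⟨l, hl, h₂⟩, rfl⟩ := h.move_append
      refine ⟨true :: l, ?_, h₁.append h₂⟩
      rw [List.getLast?_cons_cons, List.getLast?_cons]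
      cases hl' : l.getLast? <;> simp_all
    · obtain ⟨m₁, h₁, m₂, ⟨l, hl, h₂⟩, rfl⟩ := h.move_append
      exact ⟨false :: l, by rwa [List.getLast?_cons_cons], h₁.append h₂⟩
  | ante μ t =>
    simp only [program, List.mem_cons, List.not_mem_nil, or_false] at hb
    rcases hb with rfl | rfl | rfl
    · obtain rfl := h
      exact ⟨[], by simp, by simpa using .nil t m⟩
    · obtain ⟨m₁, ⟨A, hA, h₁⟩, m₂, ⟨Γ, hΓ, h₂⟩, rfl⟩ := h
      refine ⟨form A :: Γ, ?_, by simpa using h₁.append h₂⟩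
      simp only [flat_form, List.mem_cons, Tok.form.injEq]
      rintro B (rfl | hB)
      · exact hA
      · exact hΓ B hB
    · obtain ⟨m₁, h₁, m₂, ⟨Θ, hΘ, h₂⟩, h'⟩ := h.move_append
      obtain ⟨m₃, h₃, m₄, ⟨Γ, hΓ, h₄⟩, rfl⟩ := RunRel.move_append h'
      refine ⟨brack Θ :: Γ, ?_, by simpa using h₁.append (h₂.append (h₃.append h₄))⟩
      simp only [flat_brack, List.mem_cons, List.mem_append, reduceCtorEq, false_or]
      rintro B (hB | hB)
      · exact hΘ B hB
      · exact hΓ B hB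
  | nav =>
    simp only [program, List.mem_cons, List.not_mem_nil, or_false] at hb
    rcases hb with rfl | rfl | rfl | rfl
    · obtain rfl := h
      exact ⟨[], .nil .B m⟩
    · obtain ⟨m₁, ⟨A, hA, h₁⟩, m₂, ⟨u, h₂⟩, rfl⟩ := h
      exact ⟨.form A :: u, h₁.append h₂⟩
    · obtain ⟨m₁, h₁, m₂, ⟨u, h₂⟩, rfl⟩ := h.move_append
      exact ⟨.lb :: u, h₁.append h₂⟩
    · obtain ⟨m₁, h₁, m₂, ⟨u, h₂⟩, rfl⟩ := h.move_append
      exact ⟨.rb :: u, h₁.append h₂⟩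
  | bangs t =>
    simp only [program, List.mem_cons, List.not_mem_nil, or_false] at hb
    rcases hb with rfl | rfl
    · obtain rfl := h
      exact ⟨[], by simpa [bangs] using .nil t m⟩
    · obtain ⟨m₁, h₁, m₂, ⟨A, -, h₂⟩, m₃, ⟨As, h₃⟩, rfl⟩ := h.move_append
      exact ⟨A :: As, by simpa [bangs, Formula.encode] using h₁.append (h₂.append h₃)⟩
  | cmp =>
    simp only [program, List.mem_cons, List.mem_map, Finset.mem_toList, Finset.mem_erase,
      Finset.mem_univ, and_true] at hb
    rcases hb with rfl | ⟨s, hs, rfl⟩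
    · obtain ⟨r₁, e₁, r₂, e₂, rfl⟩ := h
      exact ⟨[], r₁, r₂, by simp, e₁, e₂, rfl⟩
    · obtain ⟨r₁, e₁, r₂, e₂, _, ⟨w, b, c, hw, e₃, e₄, rfl⟩, rfl⟩ := h
      refine ⟨s :: w, b, c, by simp [hw, hs.symm], ?_, ?_, rfl⟩ <;>
        simp_all [Store.get, Store.set]
  | ret k =>
    suffices k ≠ .A ∧ (body = [.pop k .arrow] ∨
        ∃ s, s ≠ Sym.arrow ∧ body = [.pop k s, .push .A s, .call (.ret k)]) by
      obtain ⟨hk, rfl | ⟨s, hs, rfl⟩⟩ := this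
      · obtain ⟨r, e, rfl⟩ := h
        refine ⟨[], r, by simp, e, ?_⟩
        cases k <;> simp_all [Store.set]
      · obtain ⟨r₁, e₁, _, ⟨w, r, hw, e₂, rfl⟩, rfl⟩ := h
        refine ⟨s :: w, r, by simp [hw, hs.symm], ?_, ?_⟩ <;>
          cases k <;> simp_all [Store.get, Store.set]
    cases k <;> simp_all [program, eq_comm]

/-! ### Completeness of the program -/

/-- The program can execute `cs` from `m` to `m'` with at most `n` commands. -/
def Runs (cs : List (Cmd Sym Proc)) (m m' : Store Sym) (n : ℕ) : Prop :=
  ∃ k ≤ n, Exec program cs m m' k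

namespace Runs

variable {cs ds body : List (Cmd Sym Proc)} {m m₁ m' : Store Sym} {n n₁ n₂ : ℕ}

theorem mono (h : Runs cs m m' n₁) (hn : n₁ ≤ n₂) : Runs cs m m' n₂ :=
  let ⟨k, hk, h⟩ := h; ⟨k, hk.trans hn, h⟩

theorem nil : Runs [] m m 0 := ⟨0, le_rfl, .nil⟩

theorem append (h : Runs cs m m₁ n₁) (h' : Runs ds m₁ m' n₂) : Runs (cs ++ ds) m m' (n₁ + n₂) :=
  let ⟨_, hk, h⟩ := h
  let ⟨_, hk', h'⟩ := h'
  ⟨_, Nat.add_le_add hk hk', h.append h'⟩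

theorem cons {x : Cmd Sym Proc} (h : Runs [x] m m₁ n₁) (h' : Runs ds m₁ m' n₂) :
    Runs (x :: ds) m m' (n₁ + n₂) := h.append h'

theorem push {k : Stk} {s : Sym} (h : Runs cs (m.set k (s :: m.get k)) m' n) :
    Runs (.push k s :: cs) m m' (n + 1) :=
  let ⟨_, hk, h⟩ := h; ⟨_, Nat.succ_le_succ hk, h.push⟩

theorem pop {k : Stk} {s : Sym} {r : List Sym} (e : m.get k = s :: r)
    (h : Runs cs (m.set k r) m' n) : Runs (.pop k s :: cs) m m' (n + 1) :=
  let ⟨_, hk, h⟩ := h; ⟨_, Nat.succ_le_succ hk, .pop e h⟩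

theorem call {p : Proc} (hb : body ∈ program p) (h : Runs body m m' n) :
    Runs [.call p] m m' (n + 1) :=
  let ⟨_, hk, h⟩ := h; ⟨_, Nat.succ_le_succ hk, .call hb h .nil⟩

end Runs

theorem runs_move {t : Tgt} {s : Sym} {m m' : Store Sym} (h : Moved t [s] m m') :
    Runs (move t s) m m' 3 := by
  obtain ⟨r, e, rfl⟩ := h
  refine Runs.pop e (Runs.mono (n₁ := (t.push s).length) ?_ (by cases t <;> simp [Tgt.push]))
  cases t <;> exact ⟨_, le_rfl, by repeat constructor⟩

theorem Moved.split {t : Tgt} {u v : List Sym} {m m' : Store Sym} (h : Moved t (u ++ v) m m') :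
    ∃ m₁, Moved t u m m₁ ∧ Moved t v m₁ m' := by
  obtain ⟨r, e, rfl⟩ := h
  refine ⟨_, ⟨v ++ r, by simpa using e, rfl⟩, r, ?_, ?_⟩ <;> cases t <;> simp [Tgt.put]

theorem Moved.split_cons {t : Tgt} {s : Sym} {v : List Sym} {m m' : Store Sym}
    (h : Moved t (s :: v) m m') : ∃ m₁, Moved t [s] m m₁ ∧ Moved t v m₁ m' :=
  Moved.split (u := [s]) h

theorem Moved.eq_of_nil {t : Tgt} {m m' : Store Sym} (h : Moved t [] m m') : m' = m := by
  obtain ⟨r, e, rfl⟩ := h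
  simp only [List.nil_append] at e
  subst e
  cases t <;> rfl

theorem runs_bits (t : Tgt) (l : List Bool) : ∀ m m',
    Moved t (l.map .bit ++ [.endVar]) m m' →
    (l.getLast? ≠ some false → Runs [.call (.bits t)] m m' (4 * (l.length + 1))) ∧
    ((false :: l).getLast? ≠ some false →
      Runs [.call (.bitsZero t)] m m' (4 * (l.length + 1))) := by
  induction l with
  | nil => exact fun m m' h => ⟨fun _ => .call (by simp [program]) (runs_move h), by simp⟩
  | cons b l ih =>
    intro m m' h
    obtain ⟨m₁, h₁, h₂⟩ := Moved.split_cons h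
    obtain ⟨ih₁, ih₂⟩ := ih _ _ h₂
    cases b with
    | false =>
      constructor
      · exact fun hl => (Runs.call (body := move t (.bit false) ++ [.call (.bitsZero t)])
          (by simp [program]) ((runs_move h₁).append (ih₂ hl))).mono (by simp; omega)
      · intro hl
        rw [List.getLast?_cons_cons] at hl
        exact (Runs.call (body := move t (.bit false) ++ [.call (.bitsZero t)])
          (by simp [program]) ((runs_move h₁).append (ih₂ hl))).mono (by simp; omega)
    | true =>
      have key : (true :: l).getLast? ≠ some false → l.getLast? ≠ some false := by
        intro h h'
        simp [List.getLast?_cons, h'] at h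
      constructor
      · exact fun hl => (Runs.call (body := move t (.bit true) ++ [.call (.bits t)])
          (by simp [program]) ((runs_move h₁).append (ih₁ (key hl)))).mono (by simp; omega)
      · intro hl
        rw [List.getLast?_cons_cons] at hl
        exact (Runs.call (body := move t (.bit true) ++ [.call (.bits t)])
          (by simp [program]) ((runs_move h₁).append (ih₁ (key hl)))).mono (by simp; omega)

/-- Each symbol costs one call, one `pop` and at most two `push` commands. -/
theorem runs_formula {t : Tgt} {A : Formula} {μ : Mode} (hA : μ.Accepts A) {m m' : Store Sym}
    (h : Moved t A.encode m m') : Runs [.call (.formula μ t)] m m' (4 * A.len) := by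
  induction A generalizing μ m m' with
  | var i =>
    obtain ⟨m₁, h₁, h₂⟩ := Moved.split_cons h
    refine (Runs.call (body := move t .var ++ [.call (.bits t)]) (by simp [program])
      ((runs_move h₁).append ((runs_bits t _ _ _ h₂).1
        ((exists_encodeNat_iff _).1 ⟨i, rfl⟩)))).mono ?_
    simp [Formula.len, Formula.encode]; omega
  | one => exact .call (body := move t .one) (by simp [program]) (runs_move h)
  | ldiv A C ihA ihC =>
    obtain ⟨m₁, h₁, h₂⟩ := Moved.split_cons h
    obtain ⟨m₂, h₂, h₃⟩ := h₂.split
    refine (Runs.call (body := move t .ldiv ++ [.call (.formula μ.flip t), .call (.formula μ t)])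
      (by simp [program]) ((runs_move h₁).append ((ihA ?_ h₂).cons (ihC ?_ h₃)))).mono
      (by simp; omega) <;>
    rcases μ with _ | ⟨b, p⟩ <;> simp_all [Mode.Accepts, Mode.flip, Formula.eat, Formula.Safe]
  | rdiv C B ihC ihB =>
    obtain ⟨m₁, h₁, h₂⟩ := Moved.split_cons h
    obtain ⟨m₂, h₂, h₃⟩ := h₂.split
    refine (Runs.call (body := move t .rdiv ++ [.call (.formula μ t), .call (.formula μ.flip t)])
      (by simp [program]) ((runs_move h₁).append ((ihC ?_ h₂).cons (ihB ?_ h₃)))).mono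
      (by simp; omega) <;>
    rcases μ with _ | ⟨b, p⟩ <;> simp_all [Mode.Accepts, Mode.flip, Formula.eat, Formula.Safe]
  | prod A B ihA ihB =>
    obtain ⟨m₁, h₁, h₂⟩ := Moved.split_cons h
    obtain ⟨m₂, h₂, h₃⟩ := h₂.split
    refine (Runs.call (body := move t .prod ++ [.call (.formula μ t), .call (.formula μ t)])
      (by simp [program]) ((runs_move h₁).append ((ihA ?_ h₂).cons (ihB ?_ h₃)))).mono
      (by simp; omega) <;>
    rcases μ with _ | ⟨b, p⟩ <;> simp_all [Mode.Accepts, Formula.eat, Formula.Safe]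
  | dia A ih =>
    obtain ⟨m₁, h₁, h₂⟩ := Moved.split_cons h
    refine (Runs.call (body := move t .dia ++ [.call (.formula μ t)]) ?_
      ((runs_move h₁).append (ih ?_ h₂))).mono (by simp; omega) <;>
    rcases μ with _ | ⟨_ | _, _ | _⟩ <;>
      simp_all [program, Mode.Accepts, Formula.eat, Formula.Safe]
  | boxInv A ih =>
    obtain ⟨m₁, h₁, h₂⟩ := Moved.split_cons h
    refine (Runs.call (body := move t .boxInv ++ [.call (.formula μ t)]) ?_
      ((runs_move h₁).append (ih ?_ h₂))).mono (by simp; omega) <;>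
    rcases μ with _ | ⟨_ | _, _ | _⟩ <;>
      simp_all [program, Mode.Accepts, Formula.eat, Formula.Safe]
  | bang A ih =>
    obtain ⟨m₁, h₁, h₂⟩ := Moved.split_cons h
    refine (Runs.call (body := move t .bang ++ [.call (.formula μ.bang t)]) (by simp [program])
      ((runs_move h₁).append (ih ?_ h₂))).mono (by simp; omega)
    rcases μ with _ | ⟨_ | _, _ | _⟩ <;>
      simp_all [Mode.Accepts, Mode.bang, Formula.eat, Formula.Safe]

theorem length_encode (A : Formula) : A.encode.length = A.len := rfl

theorem runs_ante {t : Tgt} {Γ : MetaFormula} {μ : Mode}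
    (hΓ : ∀ A, Tok.form A ∈ flat Γ → μ.Accepts A) {m m' : Store Sym} (h : Moved t (enc Γ) m m') :
    Runs [.call (.ante μ t)] m m' (5 * (enc Γ).length + 1) := by
  induction Γ using MetaFormula.induct generalizing m m' with
  | nil =>
    rw [enc_nil] at h
    obtain rfl := h.eq_of_nil
    exact .mono (.call (by simp [program]) .nil) (by simp)
  | form A Γ ih =>
    rw [enc_form] at h
    obtain ⟨m₁, h₁, h₂⟩ := h.split
    refine (Runs.call (body := [.call (.formula μ t), .call (.ante μ t)]) (by simp [program])
      ((runs_formula (hΓ A (by simp)) h₁).cons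
        (ih (fun B hB => hΓ B (by simp [hB])) h₂))).mono ?_
    have := A.len_pos
    simp [length_encode]; omega
  | brack Θ Γ ihΘ ih =>
    rw [enc_brack] at h
    obtain ⟨m₁, h₁, h₂⟩ := h.split_cons
    obtain ⟨m₂, h₂, h₃⟩ := h₂.split
    obtain ⟨m₃, h₃, h₄⟩ := h₃.split_cons
    refine (Runs.call (body := move t .lbrack ++ .call (.ante μ t) ::
      (move t .rbrack ++ [.call (.ante μ t)])) (by simp [program])
      ((runs_move h₁).append ((ihΘ (fun B hB => hΓ B (by simp [hB])) h₂).cons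
        ((runs_move h₃).append (ih (fun B hB => hΓ B (by simp [hB])) h₄))))).mono ?_
    simp; omega

theorem runs_nav {u : List Tok} {m m' : Store Sym} (h : Moved .B (encT u) m m') :
    Runs [.call .nav] m m' (5 * (encT u).length + 1) := by
  induction u generalizing m m' with
  | nil =>
    obtain rfl := h.eq_of_nil
    exact .mono (.call (by simp [program]) .nil) (by simp)
  | cons x u ih =>
    rw [encT_cons] at h
    obtain ⟨m₁, h₁, h₂⟩ := h.split
    cases x with
    | form A =>
      refine (Runs.call (body := [.call (.formula none .B), .call .nav]) (by simp [program])
        ((runs_formula (μ := none) trivial h₁).cons (ih h₂))).mono ?_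
      have := A.len_pos
      simp [length_encode, Tok.enc]; omega
    | lb =>
      exact (Runs.call (body := move .B .lbrack ++ [.call .nav]) (by simp [program])
        ((runs_move h₁).append (ih h₂))).mono (by simp [Tok.enc]; omega)
    | rb =>
      exact (Runs.call (body := move .B .rbrack ++ [.call .nav]) (by simp [program])
        ((runs_move h₁).append (ih h₂))).mono (by simp [Tok.enc]; omega)

@[simp] theorem bangs_nil : bangs [] = [] := rfl
@[simp] theorem bangs_cons (A : Formula) (As : List Formula) :
    bangs (A :: As) = form (bang A) :: bangs As := rfl

theorem runs_bangs {t : Tgt} {As : List Formula} {m m' : Store Sym}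
    (h : Moved t (enc (bangs As)) m m') :
    Runs [.call (.bangs t)] m m' (5 * (enc (bangs As)).length + 1) := by
  induction As generalizing m m' with
  | nil =>
    rw [bangs_nil, enc_nil] at h
    obtain rfl := h.eq_of_nil
    exact .mono (.call (by simp [program]) .nil) (by simp)
  | cons A As ih =>
    rw [bangs_cons, enc_form] at h
    obtain ⟨m₁, h₁, h₂⟩ := h.split
    obtain ⟨m₂, h₁, h₃⟩ := Moved.split_cons h₁
    refine (Runs.call (body := move t .bang ++ [.call (.formula none t), .call (.bangs t)])
      (by simp [program]) ((runs_move h₁).append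
        ((runs_formula (μ := none) trivial h₃).cons (ih h₂)))).mono ?_
    simp [length_encode]; omega

theorem mem_program_ret_arrow {k : Stk} (hk : k ≠ .A) : [.pop k .arrow] ∈ program (.ret k) := by
  cases k
  · exact absurd rfl hk
  all_goals simp [program]

theorem mem_program_ret {k : Stk} (hk : k ≠ .A) {s : Sym} (hs : s ≠ .arrow) :
    [.pop k s, .push .A s, .call (.ret k)] ∈ program (.ret k) := by
  cases k
  · exact absurd rfl hk
  all_goals simp [program, hs]

theorem runs_ret {k : Stk} (hk : k ≠ .A) {w r : List Sym} (hw : Sym.arrow ∉ w) {m : Store Sym}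
    (e : m.get k = w.reverse ++ .arrow :: r) :
    Runs [.call (.ret k)] m { m.set k r with a := w ++ m.a } (3 * w.length + 2) := by
  induction w using List.reverseRecOn generalizing m with
  | nil =>
    refine Runs.call (mem_program_ret_arrow hk) (.pop e ?_)
    convert Runs.nil using 1
    · cases k <;> simp_all [Store.set]
    · simp
  | append_singleton w s ih =>
    simp only [List.mem_append, List.mem_singleton, not_or, List.reverse_append,
      List.reverse_singleton, List.cons_append] at hw e
    have := ih hw.1 (m := { m.set k (w.reverse ++ .arrow :: r) with a := s :: m.a })
      (by cases k <;> simp_all [Store.get, Store.set])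
    refine (Runs.call (mem_program_ret hk (Ne.symm hw.2))
      (.pop e (.push ?_))).mono (n₁ := 3 * w.length + 2 + 1 + 1 + 1) ?_
    · convert this using 1 <;> cases k <;> simp_all [Store.get, Store.set]
    · simp; omega

theorem runs_cmp {w a b c d : List Sym} (hw : Sym.arrow ∉ w) :
    Runs [.call .cmp] ⟨a, w ++ .arrow :: b, w ++ .arrow :: c, d⟩ ⟨a, b, c, d⟩
      (3 * w.length + 3) := by
  induction w with
  | nil =>
    exact Runs.call (p := .cmp) (body := [.pop .B .arrow, .pop .C .arrow]) (by simp [program])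
      (.pop rfl (.pop rfl .nil))
  | cons s w ih =>
    simp only [List.mem_cons, not_or] at hw
    refine Runs.mono (n₁ := 3 * w.length + 3 + 1 + 1 + 1) ?_ (by simp; omega)
    exact Runs.call (p := .cmp) (body := [.pop .B s, .pop .C s, .call .cmp])
      (by simp [program, Ne.symm hw.1]) (.pop rfl (.pop rfl (ih hw.2)))

/-! ### Execution of the rules -/

theorem runs_formula_none (t : Tgt) (A : Formula) (r b c d : List Sym) :
    Runs [.call (.formula none t)] ⟨A.encode ++ r, b, c, d⟩ (t.put A.encode ⟨r, b, c, d⟩)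
      (4 * A.len) :=
  runs_formula (μ := none) trivial ⟨r, rfl, rfl⟩

theorem runs_ante_none (t : Tgt) (Γ : MetaFormula) (r b c d : List Sym) :
    Runs [.call (.ante none t)] ⟨enc Γ ++ r, b, c, d⟩ (t.put (enc Γ) ⟨r, b, c, d⟩)
      (5 * (enc Γ).length + 1) :=
  runs_ante (μ := none) (fun _ _ => trivial) ⟨r, rfl, rfl⟩

theorem runs_ret_B (a c d r : List Sym) {w : List Sym} (hw : Sym.arrow ∉ w) :
    Runs [.call (.ret .B)] ⟨a, w.reverse ++ .arrow :: r, c, d⟩ ⟨w ++ a, r, c, d⟩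
      (3 * w.length + 2) :=
  runs_ret (by simp) hw rfl

theorem runs_ret_C (a b d r : List Sym) {w : List Sym} (hw : Sym.arrow ∉ w) :
    Runs [.call (.ret .C)] ⟨a, b, w.reverse ++ .arrow :: r, d⟩ ⟨w ++ a, b, r, d⟩
      (3 * w.length + 2) :=
  runs_ret (by simp) hw rfl

theorem runs_ret_D (a b c r : List Sym) {w : List Sym} (hw : Sym.arrow ∉ w) :
    Runs [.call (.ret .D)] ⟨a, b, c, w.reverse ++ .arrow :: r⟩ ⟨w ++ a, b, c, r⟩
      (3 * w.length + 2) :=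
  runs_ret (by simp) hw rfl

/-- The commands `cs` replace the word `enc Y` on the stack `A` by a word whose initial part is
on `B` and which amounts to `enc X`. -/
def Rewrites (cs : List (Cmd Sym Proc)) (X Y : MetaFormula) : Prop :=
  ∀ x b c d, ∃ p y, Sym.arrow ∉ p ∧ p.length ≤ (enc Y).length + 2 ∧ p ++ y = enc X ++ x ∧
    Runs cs ⟨enc Y ++ x, b, c, d⟩ ⟨y, p.reverse ++ b, c, d⟩ (10 * (enc Y).length + 20)

/-- Every unary left rule is carried out by some element of `rewrites`. -/
theorem LeftRule.exists_rewrites {X Y : MetaFormula} (h : LeftRule X Y) :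
    ∃ cs ∈ rewrites, Rewrites cs X Y := by
  cases h with
  | prod A B =>
    refine ⟨_, List.mem_of_getElem? (i := 0) rfl, fun x b c d =>
      ⟨A.encode ++ B.encode, x, by simp, by simp [Formula.encode]; omega, by simp, ?_⟩⟩
    simp only [enc_form, enc_nil, Formula.encode, List.cons_append, List.append_assoc,
      List.append_nil, List.reverse_append]
    refine Runs.mono (Runs.pop rfl (.cons (runs_formula_none .B A _ _ _ _)
      (runs_formula_none .B B _ _ _ _))) ?_
    simp [length_encode]; omega
  | one =>
    refine ⟨_, List.mem_of_getElem? (i := 1) rfl, fun x b c d =>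
      ⟨[], x, by simp, by simp, by simp, ?_⟩⟩
    simp only [enc_form, enc_nil, Formula.encode, List.cons_append, List.append_nil]
    exact (Runs.pop rfl .nil).mono (by omega)
  | dia A =>
    refine ⟨_, List.mem_of_getElem? (i := 2) rfl, fun x b c d =>
      ⟨.lbrack :: (A.encode ++ [.rbrack]), x, by simp, by simp [Formula.encode], by simp, ?_⟩⟩
    simp only [enc_form, enc_nil, Formula.encode, List.cons_append, List.append_assoc,
      List.append_nil, List.reverse_append, List.reverse_cons, List.reverse_nil, List.nil_append]
    refine Runs.mono (Runs.pop rfl (.push (.cons (runs_formula_none .B A _ _ _ _) (.push .nil)))) ?_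
    simp [length_encode]; omega
  | boxInv A =>
    refine ⟨_, List.mem_of_getElem? (i := 3) rfl, fun x b c d =>
      ⟨A.encode, x, by simp, by simp [Formula.encode]; omega, by simp, ?_⟩⟩
    simp only [enc_form, enc_nil, enc_brack, Formula.encode, List.cons_append, List.append_assoc,
      List.append_nil, List.nil_append]
    refine Runs.mono (Runs.pop rfl (.pop rfl (.cons (runs_formula_none .B A _ _ _ _)
      (.pop rfl .nil)))) ?_
    simp [length_encode]; omega
  | bang A =>
    refine ⟨_, List.mem_of_getElem? (i := 4) rfl, fun x b c d =>
      ⟨A.encode, x, by simp, by simp [Formula.encode]; omega, by simp, ?_⟩⟩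
    simp only [enc_form, enc_nil, Formula.encode, List.cons_append, List.append_nil]
    refine Runs.mono (Runs.pop rfl (runs_formula_none .B A _ _ _ _)) ?_
    simp [length_encode]; omega
  | contr As Γ =>
    refine ⟨_, List.mem_of_getElem? (i := 5) rfl, fun x b c d =>
      ⟨enc (bangs As) ++ [.lbrack], enc (bangs As) ++ (enc Γ ++ .rbrack :: x), by simp,
        by simp; omega, by simp, ?_⟩⟩
    simp only [enc_append, List.append_assoc, List.reverse_append, List.reverse_cons,
      List.reverse_nil, List.nil_append, List.cons_append]
    refine Runs.mono (Runs.push (.cons (runs_bangs ⟨_, rfl, rfl⟩) (.push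
      (.cons (runs_ante_none .D Γ _ _ _ _)
      (.push (.cons (runs_ret_D _ _ _ _ (by simp)) (.push (runs_ret_C _ _ _ _ (by simp))))))))) ?_
    simp; omega

theorem PermRule.exists_rewrites {X Y : MetaFormula} (h : PermRule X Y) :
    ∃ cs ∈ rewrites, Rewrites cs X Y := by
  cases h with
  | right A Γ =>
    refine ⟨_, List.mem_of_getElem? (i := 6) rfl, fun x b c d =>
      ⟨.bang :: A.encode, enc Γ ++ x, by simp, by simp [Formula.encode]; omega,
        by simp [Formula.encode], ?_⟩⟩
    simp only [enc_append, enc_form, enc_nil, Formula.encode, List.cons_append, List.append_assoc,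
      List.append_nil, List.reverse_cons, List.nil_append]
    refine Runs.mono (Runs.push (.cons (runs_ante_none .C Γ _ _ _ _) (.pop rfl (.push (.cons
      (runs_formula_none .B A _ _ _ _) (runs_ret_C _ _ _ _ (by simp))))))) ?_
    simp [length_encode]; omega
  | left A Γ =>
    refine ⟨_, List.mem_of_getElem? (i := 7) rfl, fun x b c d =>
      ⟨enc Γ, .bang :: (A.encode ++ x), by simp, by simp [Formula.encode]; omega,
        by simp [Formula.encode], ?_⟩⟩
    simp only [List.cons_append, List.nil_append, enc_form, Formula.encode, List.append_assoc]
    refine Runs.mono (Runs.pop rfl (.push (.cons (runs_formula_none .C A _ _ _ _) (.cons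
      (runs_ante_none .B Γ _ _ _ _) (.cons (runs_ret_C _ _ _ _ (by simp)) (.push .nil)))))) ?_
    simp [length_encode]; omega

/-- Every left rule of a division is carried out by some element of `divisions`. -/
theorem DivRule.exists_divisions {Γ Y : MetaFormula} {A C : Formula} (h : DivRule Γ A C Y) :
    ∃ cs ∈ divisions, ∀ x b c d, Runs cs ⟨enc Y ++ x, b, c, d⟩ ⟨x, C.encode.reverse ++ b,
      (enc Γ).reverse ++ .arrow :: c, A.encode.reverse ++ .arrow :: d⟩
      (10 * (enc Y).length + 20) := by
  cases h with
  | rdiv =>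
    refine ⟨_, List.mem_of_getElem? (i := 0) rfl, fun x b c d => ?_⟩
    simp only [List.cons_append, List.nil_append, enc_form, Formula.encode, List.append_assoc]
    refine Runs.mono (Runs.pop rfl (.cons (runs_formula_none .B C _ _ _ _) (.push (.cons
      (runs_formula_none .D A _ _ _ _) (.push (runs_ante_none .C Γ _ _ _ _)))))) ?_
    simp [length_encode]; omega
  | ldiv =>
    refine ⟨_, List.mem_of_getElem? (i := 1) rfl, fun x b c d => ?_⟩
    simp only [enc_append, enc_form, enc_nil, Formula.encode, List.cons_append, List.append_assoc,
      List.append_nil]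
    refine Runs.mono (Runs.push (.cons (runs_ante_none .C Γ _ _ _ _) (.pop rfl (.push (.cons
      (runs_formula_none .D A _ _ _ _) (runs_formula_none .B C _ _ _ _)))))) ?_
    simp [length_encode]; omega

/-- A variant of `runs_ret_B` in which the equations between words need not hold by definition. -/
theorem runs_ret_B_of_eq {m m' : Store Sym} {w r : List Sym} (hw : Sym.arrow ∉ w)
    (e : m.b = w.reverse ++ .arrow :: r) (e' : m' = ⟨w ++ m.a, r, m.c, m.d⟩) :
    Runs [.call (.ret .B)] m m' (3 * w.length + 2) := by
  subst e'
  exact runs_ret (by simp) hw e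

/-- Every unary right rule is carried out by some element of `rightRewrites`. -/
theorem RightRule.exists_rightRewrites {Γ Γ' : MetaFormula} {B B' : Formula}
    (h : RightRule Γ B Γ' B') : ∃ cs ∈ rightRewrites, ∀ r b c d,
      Runs cs ⟨enc Γ' ++ .arrow :: (B'.encode ++ r), b, c, d⟩
        ⟨enc Γ ++ .arrow :: (B.encode ++ r), b, c, d⟩
        (10 * (enc Γ').length + 10 * B'.len + 20) := by
  cases h with
  | rdiv =>
    rename_i A
    refine ⟨_, List.mem_of_getElem? (i := 0) rfl, fun r b c d => ?_⟩
    simp only [enc_append, enc_form, enc_nil, Formula.encode, List.cons_append, List.append_assoc,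
      List.append_nil]
    refine Runs.mono (Runs.push (.cons (runs_ante_none .B Γ' _ _ _ _) (.pop rfl (.pop rfl (.push
      (.cons (runs_formula_none .D B _ _ _ _) (.cons (runs_formula_none .B A _ _ _ _) (.cons
      (runs_ret_D _ _ _ _ (by simp)) (.push (runs_ret_B_of_eq (w := enc Γ' ++ A.encode) (r := b)
      (by simp) ?_ ?_)))))))))) ?_
    · simp [Store.get, Store.set, Tgt.put]
    · simp [Store.get, Store.set, Tgt.put]
    · simp [length_encode]; omega
  | ldiv =>
    rename_i A
    refine ⟨_, List.mem_of_getElem? (i := 1) rfl, fun r b c d => ?_⟩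
    simp only [enc_form, Formula.encode, List.cons_append, List.append_assoc, List.nil_append]
    refine Runs.mono (Runs.push (.cons (runs_ante_none .B Γ' _ _ _ _) (.pop rfl (.pop rfl (.push
      (.cons (runs_formula_none .D A _ _ _ _) (.push (.cons (runs_ret_B _ _ _ _ (by simp))
      (runs_ret_D _ _ _ _ (by simp)))))))))) ?_
    simp [length_encode]; omega
  | dia =>
    refine ⟨_, List.mem_of_getElem? (i := 2) rfl, fun r b c d => ?_⟩
    simp only [enc_brack, enc_nil, Formula.encode, List.cons_append, List.append_assoc]
    refine Runs.mono (Runs.pop rfl (.push (.cons (runs_ante_none .B Γ _ _ _ _) (.pop rfl (.pop rfl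
      (.pop rfl (.push (runs_ret_B _ _ _ _ (by simp))))))))) ?_
    simp; omega
  | boxInv =>
    refine ⟨_, List.mem_of_getElem? (i := 3) rfl, fun r b c d => ?_⟩
    simp only [enc_brack, enc_nil, Formula.encode, List.cons_append, List.append_assoc,
      List.nil_append]
    refine Runs.mono (Runs.push (.cons (runs_ante_none .B Γ' _ _ _ _) (.pop rfl (.pop rfl
      (.push (.push (.cons (runs_ret_B _ _ _ _ (by simp)) (.push .nil)))))))) ?_
    simp; omega
  | bang As =>
    refine ⟨_, List.mem_of_getElem? (i := 4) rfl, fun r b c d => ?_⟩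
    simp only [Formula.encode, List.cons_append]
    refine Runs.mono (Runs.push (.cons (runs_bangs ⟨_, rfl, rfl⟩) (.pop rfl (.pop rfl
      (.push (runs_ret_B _ _ _ _ (by simp))))))) ?_
    simp; omega

/-- The program proves the sequent `Γ → B` with at most `n` commands. -/
def ProvesIn (Γ : MetaFormula) (B : Formula) (n : ℕ) : Prop :=
  ∀ r b c d, Runs [.call .prove] ⟨enc Γ ++ .arrow :: (B.encode ++ r), b, c, d⟩ ⟨r, b, c, d⟩ n

theorem seqSize_eq_length (Γ : MetaFormula) (B : Formula) :
    seqSize Γ B = (enc Γ).length + B.len + 1 := by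
  rw [seqSize, length_enc]

theorem ProvesIn.of_rewrites {X Y : MetaFormula} {cs : List (Cmd Sym Proc)} (hcs : cs ∈ rewrites)
    (h : Rewrites cs X Y) {Δ : Context} {D : Formula} {n s : ℕ}
    (hs : seqSize (Δ.fill Y) D ≤ s) (hX : ProvesIn (Δ.fill X) D n) :
    ProvesIn (Δ.fill Y) D (n + 40 * (s + 1)) := by
  intro r b c d
  rw [seqSize_eq_length, enc_fill] at hs
  simp only [ProvesIn, enc_fill, List.append_assoc] at hX ⊢
  obtain ⟨p, y, hp, hp', e, hr⟩ := h (encT Δ.post ++ .arrow :: (D.encode ++ r))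
    ((encT Δ.pre).reverse ++ .arrow :: b) c d
  have hX' : Runs [.call .prove] ⟨(encT Δ.pre ++ p) ++ y, b, c, d⟩ ⟨r, b, c, d⟩ n := by
    simpa [e] using hX r b c d
  refine Runs.mono (.call (p := .prove) (body := [.push .B .arrow, .call .nav] ++ cs ++
    [.call (.ret .B), .call .prove]) (by simp [program, hcs])
    (.append (.push (.cons (runs_nav ⟨_, rfl, rfl⟩) hr)) (.cons (runs_ret_B_of_eq
      (w := encT Δ.pre ++ p) (r := b) (by simp [hp]) (by simp) rfl) hX'))) ?_
  simp at hs ⊢; omega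

theorem ProvesIn.of_divRule {Γ Y : MetaFormula} {A C : Formula} (h : DivRule Γ A C Y)
    {Δ : Context} {D : Formula} {n₁ n₂ s : ℕ} (hs : seqSize (Δ.fill Y) D ≤ s)
    (h₁ : ProvesIn Γ A n₁) (h₂ : ProvesIn (Δ.fill [form C]) D n₂) :
    ProvesIn (Δ.fill Y) D (n₁ + n₂ + 40 * (s + 1)) := by
  intro r b c d
  obtain ⟨cs, hcs, hr⟩ := h.exists_divisions
  have hY : A.len + C.len + (enc Γ).length ≤ (enc Y).length := by
    cases h <;> simp [Formula.encode, length_encode] <;> omega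
  rw [seqSize_eq_length, enc_fill] at hs
  simp only [ProvesIn, enc_fill, enc_form, enc_nil, List.append_nil, List.append_assoc] at h₂ ⊢
  have h₂' : Runs [.call .prove] ⟨(encT Δ.pre ++ C.encode) ++
      (encT Δ.post ++ .arrow :: (D.encode ++ r)), b, c, d⟩ ⟨r, b, c, d⟩ n₂ := by
    simpa using h₂ r b c d
  refine Runs.mono (.call (p := .prove) (body := [.push .B .arrow, .call .nav] ++ cs ++
    [.call (.ret .B), .call (.ret .D), .push .A .arrow, .call (.ret .C), .call .prove,
      .call .prove]) (by simp [program, hcs])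
    (.append (.push (.cons (runs_nav ⟨_, rfl, rfl⟩) (hr _ _ _ _))) (.cons (runs_ret_B_of_eq
      (w := encT Δ.pre ++ C.encode) (r := b) (by simp) (by simp [Store.get, Store.set]) rfl)
      (.cons (runs_ret_D _ _ _ _ (by simp)) (.push (.cons (runs_ret_C _ _ _ _ (by simp))
      (.cons (h₁ _ _ _ _) h₂'))))))) ?_
  simp [length_encode] at hs ⊢; omega

theorem ProvesIn.of_rightRule {Γ Γ' : MetaFormula} {B B' : Formula} (h : RightRule Γ B Γ' B')
    {n s : ℕ} (hs : seqSize Γ' B' ≤ s) (h' : ProvesIn Γ B n) :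
    ProvesIn Γ' B' (n + 40 * (s + 1)) := by
  intro r b c d
  obtain ⟨cs, hcs, hr⟩ := h.exists_rightRewrites
  rw [seqSize_eq_length] at hs
  refine Runs.mono (.call (p := .prove) (body := cs ++ [.call .prove]) (by simp [program, hcs])
    (.append (hr r b c d) (h' r b c d))) ?_
  omega

theorem ProvesIn.prod_right {Γ₁ Γ₂ : MetaFormula} {A B : Formula} {n₁ n₂ s : ℕ}
    (hs : seqSize (Γ₁ ++ Γ₂) (.prod A B) ≤ s) (h₁ : ProvesIn Γ₁ A n₁) (h₂ : ProvesIn Γ₂ B n₂) :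
    ProvesIn (Γ₁ ++ Γ₂) (.prod A B) (n₁ + n₂ + 40 * (s + 1)) := by
  intro r b c d
  rw [seqSize_eq_length] at hs
  simp only [enc_append, Formula.encode, List.append_assoc, List.cons_append]
  refine Runs.mono (.call (p := .prove) (body := splitProd ++ [.call .prove, .call .prove])
    (by simp [program]) (Runs.push (.cons (runs_ante_none .C Γ₁ _ _ _ _) (.push (.cons
      (runs_ante_none .B Γ₂ _ _ _ _) (.pop rfl (.pop rfl (.push (.cons
      (runs_formula_none .D A _ _ _ _) (.push (.cons (runs_ret_B _ _ _ _ (by simp)) (.cons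
      (runs_ret_D _ _ _ _ (by simp)) (.push (.cons (runs_ret_C _ _ _ _ (by simp)) (.cons
      (h₁ _ _ _ _) (h₂ _ _ _ _)))))))))))))))) ?_
  simp [length_encode] at hs ⊢; omega

theorem ProvesIn.ax {A : Formula} {s : ℕ} (hs : seqSize [form A] A ≤ s) :
    ProvesIn [form A] A (40 * (s + 1)) := by
  intro r b c d
  rw [seqSize_eq_length] at hs
  simp only [enc_form, enc_nil, List.append_nil]
  refine Runs.mono (.call (p := .prove) (body := removeAxiom)
    (by simp [program]) (Runs.push (.cons (runs_formula_none .B A _ _ _ _) (.pop rfl (.push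
      (.cons (runs_formula_none .C A _ _ _ _) (runs_cmp (by simp)))))))) ?_
  simp [length_encode] at hs ⊢; omega

theorem ProvesIn.one_right {s : ℕ} : ProvesIn [] one (40 * (s + 1)) := by
  intro r b c d
  simp only [enc_nil, List.nil_append, Formula.encode, List.cons_append]
  exact Runs.mono (.call (p := .prove) (body := [.pop .A .arrow, .pop .A .one])
    (by simp [program]) (Runs.pop rfl (.pop rfl .nil))) (by omega)

theorem seqSize_eq_of_perm {Γ Γ' : MetaFormula} (h : (flat Γ).Perm (flat Γ')) (D : Formula) :
    seqSize Γ D = seqSize Γ' D := by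
  rw [seqSize, seqSize, total_eq_of_perm _ _ h]

/-- Permutations preserve the size of a sequent, so that each of them has the same cost. -/
theorem ProvesIn.of_moves {Γ Γ' : MetaFormula} {k : ℕ} (h : Moves k Γ Γ') {D : Formula} {n s : ℕ}
    (hs : seqSize Γ D ≤ s) (hΓ : ProvesIn Γ D n) : ProvesIn Γ' D (n + k * (40 * (s + 1))) := by
  induction h generalizing n with
  | refl => exact fun r b c d => (hΓ r b c d).mono (Nat.le_add_right _ _)
  | @step k X Y Γ' Δ h _ ih =>
    obtain ⟨cs, hcs, h'⟩ := h.exists_rewrites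
    have hs' : seqSize (Δ.fill Y) D ≤ s := by
      refine (seqSize_eq_of_perm ?_ D).symm.trans_le hs
      simpa [flat_fill] using (h.flat_perm.append_left Δ.pre).append_right Δ.post
    have := ih hs' (.of_rewrites hcs h' hs' hΓ)
    rwa [add_assoc, add_comm (40 * (s + 1)), ← Nat.succ_mul] at this

/-- The number of commands that are needed for one rule application, including the permutations
before it. -/
def ruleCost (s : ℕ) : ℕ := (2 * s ^ 2 + 1) * (40 * (s + 1))

theorem ProvesIn.of_nf_eq {Γ Γ' : MetaFormula} (h : nf Γ = nf Γ') {D : Formula} {n s : ℕ}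
    (hs : seqSize Γ D ≤ s) (hΓ : ProvesIn Γ D (n + 40 * (s + 1))) :
    ProvesIn Γ' D (n + ruleCost s) := by
  have hl : (flat Γ).length ≤ s := by
    have := length_flat_le Γ
    rw [seqSize_eq_length] at hs
    omega
  have := ProvesIn.of_moves ((moves_of_nf_eq h).mono
    (Nat.mul_le_mul_left 2 (Nat.pow_le_pow_left hl 2))) hs hΓ
  rwa [add_assoc, ← one_add_mul, add_comm 1] at this

/-- The permutations between two rule applications are reduced to quadratically many single moves by
comparing normal forms. -/
theorem BoundedProof.provesIn {s n : ℕ} {Γ : MetaFormula} {D : Formula}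
    (h : BoundedProof s n Γ D) : ∀ Γ', nf Γ = nf Γ' → ProvesIn Γ' D (n * ruleCost s) := by
  induction h with
  | ax A hs =>
    intro Γ' e
    simpa using ProvesIn.of_nf_eq (n := 0) e hs (by simpa using ProvesIn.ax hs)
  | one_right hs =>
    intro Γ' e
    simpa using ProvesIn.of_nf_eq (n := 0) e hs (by simpa using ProvesIn.one_right)
  | left Δ h hs _ ih =>
    intro Γ' e
    obtain ⟨cs, hcs, h'⟩ := h.exists_rewrites
    rw [Nat.succ_mul]
    exact .of_nf_eq e hs (.of_rewrites hcs h' hs (ih _ rfl))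
  | perm e' _ ih => exact fun Γ' e => ih _ (e'.trans e)
  | div Δ h hs _ _ ih₁ ih₂ =>
    intro Γ' e
    rw [Nat.succ_mul, Nat.add_mul]
    exact .of_nf_eq e hs (.of_divRule h hs (ih₁ _ rfl) (ih₂ _ rfl))
  | right h hs _ ih =>
    intro Γ' e
    rw [Nat.succ_mul]
    exact .of_nf_eq e hs (.of_rightRule h hs (ih _ rfl))
  | prod_right hs _ _ ih₁ ih₂ =>
    intro Γ' e
    rw [Nat.succ_mul, Nat.add_mul]
    exact .of_nf_eq e hs (.prod_right hs (ih₁ _ rfl) (ih₂ _ rfl))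

/-! ### Membership in NP -/

/-- The first part of `main` reverses the word on the stack `B`. -/
theorem runs_main_of_reverse (w a b : List Sym) {m' : Store Sym} {n : ℕ}
    (h : Runs [.call .main] ⟨w.reverse ++ a, b, [], []⟩ m' n) :
    Runs [.call .main] ⟨a, w ++ b, [], []⟩ m' (n + 3 * w.length) := by
  induction w generalizing a with
  | nil => simpa using h
  | cons s w ih =>
    refine Runs.mono (n₁ := n + 3 * w.length + 1 + 1 + 1) ?_ (by simp; omega)
    exact Runs.call (p := .main) (body := [.pop .B s, .push .A s, .call .main]) (by simp [program])
      (.pop rfl (.push (ih (s :: a) (by simpa using h))))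

/-- The number of commands that are needed for an input of length `N`. -/
noncomputable def runBound : Polynomial ℕ :=
  (.X + 2) ^ 2 * ((2 * ((.X + 2) ^ 2) ^ 2 + 1) * (40 * ((.X + 2) ^ 2 + 1))) + 20 * (.X + 1)

theorem eval_runBound (N : ℕ) :
    runBound.eval N = (N + 2) ^ 2 * ruleCost ((N + 2) ^ 2) + 20 * (N + 1) := by
  simp [runBound, ruleCost]

theorem Sequent.length_encode (S : Sequent) : S.encode.length = seqSize S.ante S.succ := by
  have := congrArg List.length (Sequent.encode_append_eq S [])
  rw [seqSize_eq_length]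
  simp only [List.append_nil, List.length_append, List.length_cons,
    BracketLambek.length_encode] at this
  omega

theorem exists_exec_of_derivable {S : Sequent} (hS : S.BracketNonNegative) (h : S.IsDerivable) :
    ∃ n ≤ runBound.eval S.encode.length,
      Exec program [.call .main] ⟨[], S.encode.reverse, [], []⟩ ⟨[], [], [], []⟩ n := by
  obtain ⟨hΓ, hB⟩ := (bracketNonNegative_iff S).1 hS
  obtain ⟨n, hn, hp⟩ := h.boundedProof hΓ hB S.length_encode.ge
  have hprove := hp.provesIn _ rfl
  rw [eval_runBound]
  set N := S.encode.length with hN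
  have hN' := S.length_encode
  rw [seqSize_eq_length, ← hN] at hN'
  have hpar : Runs [.call .prove] ⟨enc S.ante ++ .arrow :: (S.succ.encode ++ []), [], [], []⟩
      ⟨[], [], [], []⟩ (n * ruleCost ((N + 2) ^ 2)) := hprove [] [] [] []
  have hA : Moved .B (enc S.ante)
      ⟨enc S.ante ++ .arrow :: (S.succ.encode ++ []), [.arrow], [], []⟩
      ⟨.arrow :: (S.succ.encode ++ []), (enc S.ante).reverse ++ [.arrow], [], []⟩ := ⟨_, rfl, rfl⟩
  have hC : Moved .C S.succ.encode
      ⟨S.succ.encode ++ [], (enc S.ante).reverse ++ [.arrow], [.arrow], []⟩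
      ⟨[], (enc S.ante).reverse ++ [.arrow], S.succ.encode.reverse ++ [.arrow], []⟩ :=
    ⟨_, rfl, rfl⟩
  have hmain := runs_main_of_reverse S.encode.reverse [] [] (m' := ⟨[], [], [], []⟩)
    (n := n * ruleCost ((N + 2) ^ 2) + 8 * N + 18) (by
      have e := Sequent.encode_append_eq S []
      rw [List.reverse_reverse, e]
      refine Runs.mono (.call (p := .main) (body := checkSequent ++ [.call .prove])
        (by simp [program]) (Runs.push (.cons (runs_ante (μ := some (false, false))
          (fun A hA => ⟨by simp, hΓ A hA⟩) hA)
        (.pop rfl (.push (.cons (runs_formula (μ := some (false, true)) ⟨by simp, hB⟩ hC)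
        (.cons (runs_ret_C _ _ _ _ (by simp)) (.push (.cons (runs_ret_B _ _ _ _ (by simp))
          hpar))))))))) ?_
      simp [BracketLambek.length_encode]; omega)
  obtain ⟨k, hk, hk'⟩ := hmain
  rw [List.append_nil] at hk'
  refine ⟨k, hk.trans ?_, hk'⟩
  have := Nat.mul_le_mul_right (ruleCost ((N + 2) ^ 2)) hn
  simp only [List.length_reverse, ← hN]
  omega

end BracketLambek

theorem theorem3 :
    BracketLambek.InNP (BracketLambek.languageOf fun S : BracketLambek.Sequent =>
      S.BracketNonNegative ∧ S.IsDerivable) := by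
  refine BracketLambek.InNP.of_program (P := BracketLambek.program) (main := .main)
    (p := BracketLambek.runBound) (fun x n h => ?_) ?_
  · obtain ⟨_, ⟨w, e, S, hS, hD, e'⟩, rfl⟩ := h.runRel BracketLambek.spec_of_mem_program
    refine ⟨S, ?_, hS, hD⟩
    simp only [List.append_nil] at e e'
    rw [← e', ← e, List.reverse_reverse]
  · rintro _ ⟨S, rfl, hS, hD⟩
    exact BracketLambek.exists_exec_of_derivable hS hD
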